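/- \textbf{Setting.} Let $m,N\ge 0$, $n\ge 1$ be integers. For $0<|p|<1$ put $\theta(x;p)=\prod_{r\ge 0}(1-xp^r)(1-p^{r+1}/x)$. For a partition $\lambda$ with conjugate $\lambda'$ put $$C^0_\lambda(x)=\prod_{(i,j)\in\lambda}\theta(q^{j-1}t^{1-i}x;p),\quad C^-_\lambda(x)=\prod_{(i,j)\in\lambda}\theta(q^{\lambda_i-j}t^{\lambda'_j-i}x;p),\quad C^+_\lambda(x)=\prod_{(i,j)\in\lambda}\theta(q^{\lambda_i+j-1}t^{2-\lambda'_j-i}x;p),$$ and let $\tilde C^{0}_\lambda,\tilde C^{-}_\lambda,\tilde C^+_\lambda$ be the same products with $\theta(\,\cdot\,;p)$ replaced by $1-(\,\cdot\,)$. Several arguments separated by commas indicate a product. Let $|\lambda|=\sum_i\lambda_i$, $n(\lambda)=\sum_i(i-1)\lambda_i$, $n(\lambda')=\sum_i\binom{\lambda_i}{2}$, $(2\lambda^2)_i=2\lambda_{\lceil i/2\rceil}$, and $$\Delta_\lambda(a\,|\,b_1,\dots,b_s)=\prod_{r=1}^s\frac{C^0_\lambda(b_r)}{C^0_\lambda(pqa/b_r)}\cdot\frac{C^0_{2\lambda^2}(pqa)}{C^-_\lambda(pq,t)\,C^+_\lambda(a,pqa/t)}.$$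 For $\mu\subset N^n$ (that is, $N\ge\mu_1\ge\dots\ge\mu_n\ge 0$) let $$w_\mu(t_0,\dots,t_{2m+5})=\Delta_\mu\big(t^{2(n-1)}t_0^2\,\big|\,t^n,t^{n-1}t_0t_1,t^{n-1}t_0t_2,\dots,t^{n-1}t_0t_{2m+5}\big).$$ The parameters $q,t,t_0,\dots,t_{2m+5}$ range over the variety $V$ of all nonzero complex numbers with $$t_0t_1=q^{-N}t^{1-n},\qquad t^{2(n-1)}\prod_{r=0}^{2m+5}t_r=q^{m+1}.$$ "Generic" means: outside the zero set of some polynomial in $(q,t,t_r)$ that does not vanish identically on $V$. A function $f$ of the parameters and of $p$ has valuation $v\in\mathbb R$ and leading coefficient $lc(f)=c$, where $c$ is a rational function of the parameters that is not identically zero on $V$, if $p^{-v}f\to c$ as $p\to 0$, locally uniformly on the set of generic parameters in $V$. (Powers $p^\beta$ with $\beta\in\mathbb R$ are taken with the principal branch.) \textbf{Hypotheses.} Let $\alpha=(\alpha_0,\dots,\alpha_{2m+5})\in\mathbb R^{2m+6}$ satisfy $$-\tfrac12\le\alpha_0\le 0,\quad \alpha_1=-\alpha_0,\quad \alpha_2\le\alpha_3\le\cdots\le\alpha_{2m+5}\le\alpha_2+1,\quad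 \sum_{r=2}^{2m+5}\alpha_r=m+1,$$ and $$-2\alpha_0+\sum_{r\ge2:\,\alpha_r\le\alpha_0}2\alpha_0+\sum_{r\ge2:\,\alpha_0<\alpha_r<-\alpha_0}(\alpha_0+\alpha_r)+\sum_{r\ge2:\,1+\alpha_0<\alpha_r<1-\alpha_0}(\alpha_r-1-\alpha_0)+\sum_{r\ge2:\,\alpha_r\ge1-\alpha_0}(-2\alpha_0)=0.$$ Put $A=\#\{r\ge2:\alpha_r<-\alpha_0\}$ and $B=\#\{r\ge2:\alpha_r>1+\alpha_0\}$, and write $w_\mu(t_rp^{\alpha_r})$ for the weight at the parameters $t_0p^{\alpha_0},\dots,t_{2m+5}p^{\alpha_{2m+5}}$. \textbf{Theorem.} (i) For every $\mu\subset N^n$ the function $w_\mu(t_rp^{\alpha_r})$ has valuation $0$ and leading coefficient $L_\mu=lc(w_\mu(t_rp^{\alpha_r}))$ given as follows. Put $$E_\mu=\frac{\tilde C^0_\mu(t^n,q^{-N})}{\tilde C^-_\mu(q,t)},\quad W_\mu=\frac{\tilde C^0_{2\mu^2}(qt^{2(n-1)}t_0^2)}{\tilde C^0_\mu(qt^{n-2}t_0^2,\,q^{N+1}t^{2(n-1)}t_0^2)\;\tilde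 C^+_\mu(t^{2(n-1)}t_0^2,\,qt^{2n-3}t_0^2)},$$ $$X_r=\tilde C^0_\mu(t^{n-1}t_0t_r),\quad Y_r=\tilde C^0_\mu(qt^{n-1}t_0/t_r),\quad M_\mu=q^{-B|\mu|}(-t^{n-1}t_0)^{(A-B-2)|\mu|}q^{(A-B-2)n(\mu')}t^{(B-A+4)n(\mu)}.$$ \begin{itemize} \item If $\alpha_0=0$, then $$L_\mu=W_\mu E_\mu\,(q^{N-1}t^{-3(n-1)}t_0^{-2})^{|\mu|}q^{-2n(\mu')}t^{4n(\mu)}\Big((qt^{2(n-1)}t_0^2)^{|\mu|}q^{2n(\mu')}t^{-2n(\mu)}\Big)^{A-B}$$ $$\times\prod_{r\ge2:\alpha_r=0}\frac{X_r}{Y_r}\Big(-\frac{qt^{n-1}t_0}{t_r}\Big)^{|\mu|}q^{n(\mu')}t^{-n(\mu)}\prod_{r\ge2:\alpha_r=1}\frac{X_r}{Y_r}\Big(-\frac1{t^{n-1}t_0t_r}\Big)^{|\mu|}q^{-n(\mu')}t^{n(\mu)}.$$ \item If $-\frac12<\alpha_0<0$ and $\alpha_2\le\alpha_0$, then $$L_\mu=E_\mu\,t^{2n(\mu)}q^{|\mu|}\,Y_2^{-1_{\{\alpha_2=\alpha_0\}}}\,\frac{\prod_{r\ge3:\alpha_r=-\alpha_0}X_r}{\prod_{r\ge3:\alpha_r=1+\alpha_0}Y_r}.$$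 \item If $-\frac12<\alpha_0<0$ and $\alpha_2>\alpha_0$, then $$L_\mu=E_\mu M_\mu\,\frac{\prod_{r\ge3:\alpha_r=-\alpha_0}X_r}{\prod_{r\ge3:\alpha_r=1+\alpha_0}Y_r}\,z^{|\mu|},\qquad z=\prod_{r\ge2:\alpha_r<-\alpha_0}t_r\prod_{r\ge2:\alpha_r>1+\alpha_0}t_r.$$ \item If $\alpha_0=\alpha_2=-\frac12$, then $L_\mu=W_\mu E_\mu\,q^{|\mu|}t^{2n(\mu)}\prod_{r=2}^{2m+5}X_r/Y_r$. \item If $\alpha_0=-\frac12$ and $\alpha_2>-\frac12$, then $$L_\mu=W_\mu E_\mu M_\mu\,\prod_{r\ge2:\alpha_r=\frac12}\frac{X_r}{Y_r}\;z^{|\mu|},\qquad z=\prod_{r\ge2:\alpha_r\ne\frac12}t_r.$$ \end{itemize} (ii) The series $\sum_{\mu\subset N^n}w_\mu(t_rp^{\alpha_r})$ has valuation $0$ and $$lc\Big(\sum_{\mu\subset N^n}w_\mu(t_rp^{\alpha_r})\Big)=\sum_{\mu\subset N^n}lc\big(w_\mu(t_rp^{\alpha_r})\big)$$ (in particular the right-hand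 side is not identically zero), unless one of the following holds: \begin{itemize} \item $\alpha_0=0$, $A=1$, $B=0$ and $\alpha_r\notin\mathbb Z$ for all $r\ge2$; \item $-\frac12<\alpha_0<0$, $\alpha_2<\alpha_0$ and $-\alpha_0<\alpha_r<1+\alpha_0$ for all $r\ge3$; \item $-\frac12<\alpha_0<0$, $A=m+3$ and $B=m+1$; \item $\alpha_0=-\frac12$, $\alpha_2>-\frac12$, $A=m+3$ and $B=m+1$. \end{itemize} (iii) In each of these four exceptional cases, if $N\ge1$, the right-hand side $\sum_{\mu\subset N^n}L_\mu$ vanishes for generic parameters in $V$, i.e. identically as a rational function on $V$. -/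

import Mathlib

open Filter Topology

namespace EllipticSeries

noncomputable section

/-! ### Partitions

A partition with at most `k` parts is an antitone function `l : Fin k → ℕ`; the part `l i`
is the part of index `i + 1` in the usual numbering. -/

/-- The partitions `μ ⊂ N^n`. -/
def boxPartitions (n N : ℕ) : Finset (Fin n → ℕ) :=
  open Classical in
  (Fintype.piFinset fun _ : Fin n => Finset.range (N + 1)).filter fun μ => Antitone μ

/-- `|l|`, the sum of the parts. -/
def size {k : ℕ} (l : Fin k → ℕ) : ℕ := ∑ i, l i

/-- `n(l) = ∑ (i - 1) l_i` (parts numbered from `1`). -/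
def nStat {k : ℕ} (l : Fin k → ℕ) : ℕ := ∑ i : Fin k, (i : ℕ) * l i

/-- `n(l') = ∑ binom(l_i, 2)`. -/
def nStatConj {k : ℕ} (l : Fin k → ℕ) : ℕ := ∑ i, (l i).choose 2

/-- The part `l'_j` of the conjugate partition, for `j ≥ 1`. -/
def conjPart {k : ℕ} (l : Fin k → ℕ) (j : ℕ) : ℕ := (Finset.univ.filter fun i => j ≤ l i).card

/-- The partition `2 l²`, with parts `2 l_{⌈i/2⌉}` (parts numbered from `1`). -/
def doubleSq {k : ℕ} (l : Fin k → ℕ) : Fin (2 * k) → ℕ :=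
  fun i => 2 * l ⟨(i : ℕ) / 2, by have := i.isLt; omega⟩

/-! ### Theta functions and elliptic symbols -/

/-- `(x; p) = ∏_{r ≥ 0} (1 - x p^r)`. -/
def poch (x p : ℂ) : ℂ := ∏' r : ℕ, (1 - x * p ^ r)

/-- `θ(x; p) = (x; p) (p / x; p)`. -/
def theta (x p : ℂ) : ℂ := poch x p * poch (p / x) p

/- In the products over the boxes `(i, j)` of the diagram of `l` below, the row number is
`i + 1` with `i : Fin k`, and the column number is `j ∈ {1, …, l i}`. -/

/-- `C⁰_l(x; q, t; p) = ∏ θ(q^{j-1} t^{1-i} x; p)`. -/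
def C0 {k : ℕ} (l : Fin k → ℕ) (x q t p : ℂ) : ℂ :=
  ∏ i : Fin k, ∏ j ∈ Finset.Icc 1 (l i),
    theta (q ^ ((j : ℤ) - 1) * t ^ (1 - ((i : ℤ) + 1)) * x) p

/-- `C⁻_l(x; q, t; p) = ∏ θ(q^{l_i - j} t^{l'_j - i} x; p)`. -/
def Cminus {k : ℕ} (l : Fin k → ℕ) (x q t p : ℂ) : ℂ :=
  ∏ i : Fin k, ∏ j ∈ Finset.Icc 1 (l i),
    theta (q ^ ((l i : ℤ) - j) * t ^ ((conjPart l j : ℤ) - ((i : ℤ) + 1)) * x) p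

/-- `C⁺_l(x; q, t; p) = ∏ θ(q^{l_i + j - 1} t^{2 - l'_j - i} x; p)`. -/
def Cplus {k : ℕ} (l : Fin k → ℕ) (x q t p : ℂ) : ℂ :=
  ∏ i : Fin k, ∏ j ∈ Finset.Icc 1 (l i),
    theta (q ^ ((l i : ℤ) + j - 1) * t ^ (2 - (conjPart l j : ℤ) - ((i : ℤ) + 1)) * x) p

/-- `Δ⁰_l(a | b_1, …, b_s; q, t; p) = ∏ C⁰_l(b_r) / C⁰_l(p q a / b_r)`. -/
def Delta0 {k s : ℕ} (l : Fin k → ℕ) (a : ℂ) (b : Fin s → ℂ) (q t p : ℂ) : ℂ :=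
  ∏ r, C0 l (b r) q t p / C0 l (p * q * a / b r) q t p

/-- `Δ_l(a | b_1, …, b_s; q, t; p)`. -/
def Delta {k s : ℕ} (l : Fin k → ℕ) (a : ℂ) (b : Fin s → ℂ) (q t p : ℂ) : ℂ :=
  Delta0 l a b q t p *
    (C0 (doubleSq l) (p * q * a) q t p /
      (Cminus l (p * q) q t p * Cminus l t q t p *
        (Cplus l a q t p * Cplus l (p * q * a / t) q t p)))

/-- The weight
`w_μ = Δ_μ(t^{2(n-1)} t_0² | t^n, t^{n-1} t_0 t_1, …, t^{n-1} t_0 t_{2m+5}; q, t; p)`. -/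
def weight (m n : ℕ) (μ : Fin n → ℕ) (q t : ℂ) (τ : Fin (2 * m + 6) → ℂ) (p : ℂ) : ℂ :=
  Delta μ (t ^ (2 * ((n : ℤ) - 1)) * τ 0 ^ 2)
    (Fin.cons (t ^ n) fun r : Fin (2 * m + 5) => t ^ ((n : ℤ) - 1) * τ 0 * τ r.succ : Fin (2 * m + 6) → ℂ)
    q t p

/-! ### The `q`-analogues of the symbols -/

/-- `C̃⁰_l(x; q, t) = ∏ (1 - q^{j-1} t^{1-i} x)`. -/
def qC0 {k : ℕ} (l : Fin k → ℕ) (x q t : ℂ) : ℂ :=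
  ∏ i : Fin k, ∏ j ∈ Finset.Icc 1 (l i),
    (1 - q ^ ((j : ℤ) - 1) * t ^ (1 - ((i : ℤ) + 1)) * x)

/-- `C̃⁻_l(x; q, t) = ∏ (1 - q^{l_i - j} t^{l'_j - i} x)`. -/
def qCminus {k : ℕ} (l : Fin k → ℕ) (x q t : ℂ) : ℂ :=
  ∏ i : Fin k, ∏ j ∈ Finset.Icc 1 (l i),
    (1 - q ^ ((l i : ℤ) - j) * t ^ ((conjPart l j : ℤ) - ((i : ℤ) + 1)) * x)

/-- `C̃⁺_l(x; q, t) = ∏ (1 - q^{l_i + j - 1} t^{2 - l'_j - i} x)`. -/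
def qCplus {k : ℕ} (l : Fin k → ℕ) (x q t : ℂ) : ℂ :=
  ∏ i : Fin k, ∏ j ∈ Finset.Icc 1 (l i),
    (1 - q ^ ((l i : ℤ) + j - 1) * t ^ (2 - (conjPart l j : ℤ) - ((i : ℤ) + 1)) * x)

/-! ### Parameters -/

/-- The space of all `(q, t; t_0, …, t_{2m+5})`. -/
abbrev Params (m : ℕ) : Type := Fin 2 ⊕ Fin (2 * m + 6) → ℂ

/-- The base `q`. -/
def Params.q {m : ℕ} (x : Params m) : ℂ := x (Sum.inl 0)

/-- The parameter `t`. -/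
def Params.t {m : ℕ} (x : Params m) : ℂ := x (Sum.inl 1)

/-- The parameters `t_0, …, t_{2m+5}`. -/
def Params.τ {m : ℕ} (x : Params m) (r : Fin (2 * m + 6)) : ℂ := x (Sum.inr r)

/-- Nonzero parameters satisfying the balancing conditions
`t_0 t_1 = q^{-N} t^{1-n}` and `t^{2(n-1)} ∏ t_r = q^{m+1}`. -/
def balanced (m n N : ℕ) : Set (Params m) :=
  {x | (∀ i, x i ≠ 0) ∧ x.τ 0 * x.τ 1 = x.q ^ (-(N : ℤ)) * x.t ^ (1 - (n : ℤ)) ∧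
    x.t ^ (2 * ((n : ℤ) - 1)) * ∏ r, x.τ r = x.q ^ (m + 1)}

/-- `p ↦ w_μ(t_r p^{α_r})`. -/
def scaledWeight (m n : ℕ) (α : Fin (2 * m + 6) → ℝ) (μ : Fin n → ℕ) (x : Params m) (p : ℂ) : ℂ :=
  weight m n μ x.q x.t (fun r => x.τ r * p ^ (α r : ℂ)) p

/-! ### Leading coefficients -/

/-- The property `P` holds for generic `x ∈ V`: outside the zero set of a polynomial that
does not vanish identically on `V`. -/
def Generically {σ : Type} (V : Set (σ → ℂ)) (P : (σ → ℂ) → Prop) : Prop :=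
  ∃ D : MvPolynomial σ ℂ, (∃ x ∈ V, MvPolynomial.eval x D ≠ 0) ∧
    ∀ x ∈ V, MvPolynomial.eval x D ≠ 0 → P x

/-- The function `f(x; p)` of `x ∈ V` and small `p` has valuation `v` and leading coefficient
`c` as `p → 0`: `c` is a rational function, not identically zero on `V`, and
`p^{-v} f(x; p) → c(x)` as `p → 0`, locally uniformly in `x ∈ V` outside the zero set of a
polynomial that does not vanish identically on `V` (and contains the poles of `c`). -/
def HasLeadingTerm {σ : Type} (V : Set (σ → ℂ)) (f : (σ → ℂ) → ℂ → ℂ) (v : ℝ)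
    (c : (σ → ℂ) → ℂ) : Prop :=
  ∃ D P Q : MvPolynomial σ ℂ,
    (∃ x ∈ V, MvPolynomial.eval x D ≠ 0 ∧ c x ≠ 0) ∧
    (∀ x ∈ V, MvPolynomial.eval x D ≠ 0 →
      MvPolynomial.eval x Q ≠ 0 ∧ c x = MvPolynomial.eval x P / MvPolynomial.eval x Q) ∧
    TendstoLocallyUniformlyOn (fun (p : ℂ) (x : σ → ℂ) => p ^ (-(v : ℂ)) * f x p) c (𝓝[≠] 0)
      {x ∈ V | MvPolynomial.eval x D ≠ 0}

/-! ### Exponents -/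

section Exponents

variable {m : ℕ}

/-- The fundamental domain of exponent vectors. -/
structure InFundamentalDomain (α : Fin (2 * m + 6) → ℝ) : Prop where
  lower : -(1 / 2) ≤ α 0
  upper : α 0 ≤ 0
  one : α 1 = -α 0
  mono : ∀ r s : Fin (2 * m + 6), 2 ≤ r → r ≤ s → α r ≤ α s
  spread : α (Fin.last (2 * m + 5)) ≤ α 2 + 1
  sum : ∑ r with 2 ≤ r, α r = m + 1

/-- The coefficient of `|μ|` in the valuation of `w_μ(t_r p^{α_r})`. -/
def slope (α : Fin (2 * m + 6) → ℝ) : ℝ :=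
  -2 * α 0 + (∑ r with 2 ≤ r ∧ α r ≤ α 0, 2 * α 0)
    + (∑ r with 2 ≤ r ∧ α 0 < α r ∧ α r < -α 0, (α 0 + α r))
    + (∑ r with 2 ≤ r ∧ 1 + α 0 < α r ∧ α r < 1 - α 0, (α r - 1 - α 0))
    + ∑ r with 2 ≤ r ∧ 1 - α 0 ≤ α r, -2 * α 0

/-- `A = #{r ≥ 2 : α_r < -α_0}`. -/
def numA (α : Fin (2 * m + 6) → ℝ) : ℕ := (Finset.univ.filter fun r => 2 ≤ r ∧ α r < -α 0).card

/-- `B = #{r ≥ 2 : α_r > 1 + α_0}`. -/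
def numB (α : Fin (2 * m + 6) → ℝ) : ℕ := (Finset.univ.filter fun r => 2 ≤ r ∧ 1 + α 0 < α r).card

/-- The four degenerate configurations. -/
def Degenerate (α : Fin (2 * m + 6) → ℝ) : Prop :=
  (α 0 = 0 ∧ numA α = 1 ∧ numB α = 0 ∧ ∀ r, 2 ≤ r → ∀ k : ℤ, α r ≠ k) ∨
  (-(1 / 2) < α 0 ∧ α 0 < 0 ∧ α 2 < α 0 ∧ ∀ r, 3 ≤ r → -α 0 < α r ∧ α r < 1 + α 0) ∨
  (-(1 / 2) < α 0 ∧ α 0 < 0 ∧ numA α = m + 3 ∧ numB α = m + 1) ∨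
  (α 0 = -(1 / 2) ∧ -(1 / 2) < α 2 ∧ numA α = m + 3 ∧ numB α = m + 1)

/-! ### The explicit leading coefficients of the weights -/

variable (n N : ℕ) (α : Fin (2 * m + 6) → ℝ) (μ : Fin n → ℕ) (x : Params m)

/-- `C̃⁰_μ(t^{n-1} t_0 t_r)`. -/
def numFactor (r : Fin (2 * m + 6)) : ℂ :=
  qC0 μ (x.t ^ ((n : ℤ) - 1) * x.τ 0 * x.τ r) x.q x.t

/-- `C̃⁰_μ(q t^{n-1} t_0 / t_r)`. -/
def denFactor (r : Fin (2 * m + 6)) : ℂ :=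
  qC0 μ (x.q * x.t ^ ((n : ℤ) - 1) * x.τ 0 / x.τ r) x.q x.t

/-- `C̃⁰_μ(t^n, q^{-N}) / C̃⁻_μ(q, t)`. -/
def prefactor : ℂ :=
  qC0 μ (x.t ^ n) x.q x.t * qC0 μ (x.q ^ (-(N : ℤ))) x.q x.t /
    (qCminus μ x.q x.q x.t * qCminus μ x.t x.q x.t)

/-- `C̃⁰_{2μ²}(q t^{2(n-1)} t_0²) / (C̃⁰_μ(q t^{n-2} t_0², q^{N+1} t^{2(n-1)} t_0²)
C̃⁺_μ(t^{2(n-1)} t_0², q t^{2n-3} t_0²))`. -/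
def wellPoisedFactor : ℂ :=
  qC0 (doubleSq μ) (x.q * x.t ^ (2 * ((n : ℤ) - 1)) * x.τ 0 ^ 2) x.q x.t /
    (qC0 μ (x.q * x.t ^ ((n : ℤ) - 2) * x.τ 0 ^ 2) x.q x.t *
      qC0 μ (x.q ^ (N + 1) * x.t ^ (2 * ((n : ℤ) - 1)) * x.τ 0 ^ 2) x.q x.t *
      (qCplus μ (x.t ^ (2 * ((n : ℤ) - 1)) * x.τ 0 ^ 2) x.q x.t *
        qCplus μ (x.q * x.t ^ (2 * (n : ℤ) - 3) * x.τ 0 ^ 2) x.q x.t))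

/-- The case `α_0 = 0`. -/
def lcZero : ℂ :=
  wellPoisedFactor n N μ x * prefactor n N μ x *
    (x.q ^ ((N : ℤ) - 1) * x.t ^ (-3 * ((n : ℤ) - 1)) * x.τ 0 ^ (-2 : ℤ)) ^ size μ *
    x.q ^ (-2 * (nStatConj μ : ℤ)) * x.t ^ (4 * nStat μ) *
    ((x.q * x.t ^ (2 * ((n : ℤ) - 1)) * x.τ 0 ^ 2) ^ size μ * x.q ^ (2 * nStatConj μ) *
      x.t ^ (-2 * (nStat μ : ℤ))) ^ ((numA α : ℤ) - numB α) *
    (∏ r with 2 ≤ r ∧ α r = 0,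
      (numFactor n μ x r / denFactor n μ x r *
        (-(x.q * x.t ^ ((n : ℤ) - 1) * x.τ 0 / x.τ r)) ^ size μ * x.q ^ nStatConj μ *
        x.t ^ (-(nStat μ : ℤ)))) *
    ∏ r with 2 ≤ r ∧ α r = 1,
      (numFactor n μ x r / denFactor n μ x r *
        (-(1 / (x.t ^ ((n : ℤ) - 1) * x.τ 0 * x.τ r))) ^ size μ * x.q ^ (-(nStatConj μ : ℤ)) *
        x.t ^ nStat μ)

/-- The case `-1/2 < α_0 < 0`, `α_2 ≤ α_0`. -/
def lcMiddleLow : ℂ :=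
  prefactor n N μ x * x.t ^ (2 * nStat μ) * x.q ^ size μ *
    (if α 2 = α 0 then 1 / denFactor n μ x 2 else 1) *
    ((∏ r with 3 ≤ r ∧ α r = -α 0, numFactor n μ x r) /
      ∏ r with 3 ≤ r ∧ α r = 1 + α 0, denFactor n μ x r)

/-- The monomial
`q^{-B|μ|} (-t^{n-1} t_0)^{(A-B-2)|μ|} q^{(A-B-2) n(μ')} t^{(B-A+4) n(μ)}`. -/
def monomialFactor : ℂ :=
  x.q ^ (-(numB α : ℤ) * size μ) *
    (-(x.t ^ ((n : ℤ) - 1) * x.τ 0)) ^ (((numA α : ℤ) - numB α - 2) * size μ) *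
    x.q ^ (((numA α : ℤ) - numB α - 2) * nStatConj μ) *
    x.t ^ (((numB α : ℤ) - numA α + 4) * nStat μ)

/-- The case `-1/2 < α_0 < 0`, `α_2 > α_0`. -/
def lcMiddleHigh : ℂ :=
  prefactor n N μ x * monomialFactor n α μ x *
    ((∏ r with 3 ≤ r ∧ α r = -α 0, numFactor n μ x r) /
      ∏ r with 3 ≤ r ∧ α r = 1 + α 0, denFactor n μ x r) *
    ((∏ r with 2 ≤ r ∧ α r < -α 0, x.τ r) * ∏ r with 2 ≤ r ∧ 1 + α 0 < α r, x.τ r) ^ size μ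

/-- The case `α_0 = α_2 = -1/2`. -/
def lcHalfLow : ℂ :=
  wellPoisedFactor n N μ x * prefactor n N μ x * x.q ^ size μ * x.t ^ (2 * nStat μ) *
    ∏ r with 2 ≤ r, numFactor n μ x r / denFactor n μ x r

/-- The case `α_0 = -1/2 < α_2`. -/
def lcHalfHigh : ℂ :=
  wellPoisedFactor n N μ x * prefactor n N μ x * monomialFactor n α μ x *
    (∏ r with 2 ≤ r ∧ α r = 1 / 2, numFactor n μ x r / denFactor n μ x r) *
    (∏ r with 2 ≤ r ∧ α r ≠ 1 / 2, x.τ r) ^ size μ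

/-- The explicit leading coefficient of `w_μ(t_r p^{α_r})`, in five cases. -/
def lcWeight : ℂ :=
  if α 0 = 0 then lcZero n N α μ x
  else if -(1 / 2) < α 0 then
    if α 2 ≤ α 0 then lcMiddleLow n N α μ x else lcMiddleHigh n N α μ x
  else
    if α 2 = -(1 / 2) then lcHalfLow n N μ x else lcHalfHigh n N α μ x

end Exponents

end

end EllipticSeries

/-!
The three parts rest on three different ideas.

**A single weight.** By quasi-periodicity `θ(y p^β; p)` behaves, for `-1 ≤ β < 2`, like an explicit
power of `p` times an explicit function of `y` (`leadsTo_theta`); multiplying over the boxes gives the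
leading behaviour of `Δ_μ` (`leadsTo_Delta`). The total power of `p` in a weight is `|μ|` times the
slope (`sum_thetaVal_eq_slope`), so that at slope `0` the weight has a limit, jointly in the nome and
the parameters (`tendsto_scaledWeight`). A joint limit at every nondegenerate point to a rational
function, which is continuous there, is locally uniform convergence
(`hasLeadingTerm_zero_of_tendsto`). It remains to identify the limit with the five explicit
expressions (`weightLc_eq_lcWeight`), which uses the restrictions that the vanishing of the slope puts
on the exponents.

**The sum.** The weights converge termwise, so the only question is whether the sum of the leading
coefficients vanishes identically. The empty partition contributes `1`. It therefore suffices to find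
nondegenerate parameters along which all other leading coefficients tend to `0`
(`exists_sum_ne_zero_of_tendsto`). If some `t_r` survives in a numerator, `t_r = 1 / (t^{n-1} t_0)`
annihilates every nonempty partition; otherwise one parameter, or `t_0` itself, is sent to `0` or to
infinity. This fails only in the degenerate configurations (`exists_sum_ne_zero`). Keeping `q = 2`,
`t = 3` and `t_0` imaginary makes nondegeneracy a matter of positivity.

**The degenerate configurations.** There the leading coefficients depend on `q`, `t` and `c = t_0²`
only: they are very-well-poised terms, or the limits of these for `c → 0` or `c → ∞`. That the terms
add up to zero follows from a reversible dynamics on the partitions in the box. There are rates for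
adding a box to a row and for removing one, which vanish when the result is not a partition in the
box, such that each term satisfies detailed balance (`AddBox.wellPoisedTerm_mul_downRate`). The sum of
the rates up minus the sum of the rates down is the same nonzero constant
`(q^N - 1) (t^n - 1) / (t - 1)` at every partition, an instance of Lagrange interpolation at the nodes
`X_i`, `1 / (c X_i)`, `0` and the two square roots of `1 / (c t)`, where `X_i = q^{μ_i} t^{n-i}`
(`sum_rates`). Summing the terms weighted with this constant, the flows up and down cancel, whence
`sum_wellPoisedTerm`; its limits are `sum_prefactor_zero` and `sum_prefactor_infty`.
-/

namespace EllipticSeries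

/-! ### Limits of theta functions -/

/-- Only the factor with `r = 0` survives, by dominated convergence for infinite products. -/
theorem tendsto_poch {ι : Type*} {l : Filter ι} {z P : ι → ℂ} {z₀ : ℂ}
    (hz : Tendsto z l (𝓝 z₀)) (hP : Tendsto P l (𝓝 0)) :
    Tendsto (fun i => poch (z i) (P i)) l (𝓝 (1 - z₀)) := by
  have key := tendsto_tprod_one_add_of_dominated_convergence (𝓕 := l)
    (f := fun i r => -(z i * P i ^ r)) (g := fun r : ℕ => if r = 0 then -z₀ else 0)
    (bound := fun r => (‖z₀‖ + 1) * (1 / 2 : ℝ) ^ r)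
    ((summable_geometric_of_lt_one (by norm_num) (by norm_num)).mul_left _) ?_ ?_
  · have h1 : (∏' r : ℕ, (1 + (if r = 0 then -z₀ else 0) : ℂ)) = 1 - z₀ := by
      rw [tprod_eq_mulSingle 0 (by intro b hb; simp [hb])]
      simp [sub_eq_add_neg]
    rw [h1] at key
    simpa [poch, sub_eq_add_neg] using key
  · intro r
    have h := (hz.mul (hP.pow r)).neg
    rcases r with _ | r
    · simpa using h
    · simpa using h
  · have e1 : ∀ᶠ i in l, ‖z i‖ ≤ ‖z₀‖ + 1 :=
      (hz.norm.eventually_lt_const (lt_add_one _)).mono fun i h => h.le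
    have e2 : ∀ᶠ i in l, ‖P i‖ ≤ 1 / 2 := by
      have := hP.norm.eventually_lt_const (u := 1 / 2) (by simp)
      exact this.mono fun i h => h.le
    filter_upwards [e1, e2] with i h1 h2 r
    rw [norm_neg, norm_mul, norm_pow]
    gcongr

/-- Removing the first factor of the infinite product. -/
theorem poch_eq_mul {z p : ℂ} (hp : ‖p‖ < 1) : poch z p = (1 - z) * poch (p * z) p := by
  have hs : Multipliable fun r : ℕ => (1 - z * p ^ (r + 1) : ℂ) := by
    have := Complex.multipliable_one_add_of_summable (f := fun r : ℕ => -(z * p ^ (r + 1))) (by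
      refine Summable.neg (Summable.mul_left _ ?_)
      exact (summable_nat_add_iff 1).2 (summable_geometric_of_norm_lt_one hp))
    simpa [sub_eq_add_neg] using this
  unfold poch
  rw [tprod_eq_zero_mul' (f := fun r : ℕ => (1 - z * p ^ r : ℂ)) hs]
  simp only [pow_zero, mul_one]
  congr 2
  ext r
  ring

/-- The quasi-periodicity of the theta function. -/
theorem theta_eq_neg_mul {z p : ℂ} (hp : ‖p‖ < 1) (hp0 : p ≠ 0) (hz : z ≠ 0) :
    theta z p = -z * theta (p * z) p := by
  unfold theta
  have h2 : p / (p * z) = z⁻¹ := by field_simp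
  rw [poch_eq_mul hp (z := z), h2, poch_eq_mul hp (z := z⁻¹), ← div_eq_mul_inv]
  field_simp
  ring

/-! ### Leading terms along a filter -/

/-- `f` behaves like `c P^v` along the filter `l`, where `P` is to be thought of as a small
parameter. -/
def LeadsTo {ι : Type*} (l : Filter ι) (P f : ι → ℂ) (v : ℝ) (c : ℂ) : Prop :=
  Tendsto (fun i => P i ^ (-(v : ℂ)) * f i) l (𝓝 c)

namespace LeadsTo

variable {ι : Type*} {l : Filter ι} {P f g : ι → ℂ} {v w : ℝ} {c d : ℂ}

theorem congr (h : LeadsTo l P f v c) (hfg : ∀ᶠ i in l, f i = g i) : LeadsTo l P g v c :=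
  Tendsto.congr' (hfg.mono fun i hi => by rw [hi]) h

theorem mul (hP : ∀ᶠ i in l, P i ≠ 0) (hf : LeadsTo l P f v c) (hg : LeadsTo l P g w d) :
    LeadsTo l P (fun i => f i * g i) (v + w) (c * d) := by
  refine Tendsto.congr' ?_ (Tendsto.mul hf hg)
  filter_upwards [hP] with i hi
  rw [show (-((v + w : ℝ) : ℂ)) = -(v : ℂ) + -(w : ℂ) by push_cast; ring, Complex.cpow_add _ _ hi]
  ring

theorem inv (hc : c ≠ 0) (hf : LeadsTo l P f v c) :
    LeadsTo l P (fun i => (f i)⁻¹) (-v) c⁻¹ := by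
  refine Tendsto.congr (fun i => ?_) (Tendsto.inv₀ hf hc)
  rw [mul_inv, Complex.cpow_neg, inv_inv]
  congr 1
  push_cast
  rw [neg_neg]

theorem div (hP : ∀ᶠ i in l, P i ≠ 0) (hf : LeadsTo l P f v c) (hg : LeadsTo l P g w d)
    (hd : d ≠ 0) : LeadsTo l P (fun i => f i / g i) (v - w) (c / d) := by
  simpa [div_eq_mul_inv, sub_eq_add_neg] using hf.mul hP (hg.inv hd)

theorem const : LeadsTo l P (fun _ => c) 0 c := by
  simpa [LeadsTo] using tendsto_const_nhds

theorem prod {κ : Type*} (hP : ∀ᶠ i in l, P i ≠ 0) (s : Finset κ) {F : κ → ι → ℂ} {V : κ → ℝ}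
    {C : κ → ℂ} (h : ∀ k ∈ s, LeadsTo l P (F k) (V k) (C k)) :
    LeadsTo l P (fun i => ∏ k ∈ s, F k i) (∑ k ∈ s, V k) (∏ k ∈ s, C k) := by
  classical
  induction s using Finset.induction_on with
  | empty => simpa using const
  | insert a s ha ih =>
    simp only [Finset.prod_insert ha, Finset.sum_insert ha]
    exact (h a (Finset.mem_insert_self _ _)).mul hP
      (ih fun k hk => h k (Finset.mem_insert_of_mem hk))

end LeadsTo

/-- The valuation of `θ(y p^β; p)` for `-1 ≤ β < 2`. It is `0` for `0 ≤ β ≤ 1`, and the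
quasi-periodicity gives the values `β` and `1 - β` on the two adjacent intervals. -/
noncomputable def thetaVal (β : ℝ) : ℝ := min β 0 + min 0 (1 - β)

/-- The leading coefficient of `θ(y p^β; p)`, for `-1 ≤ β < 2`. A zero of the leading coefficient is
possible only for integral `β`; the monomial comes from the quasi-periodicity. -/
noncomputable def thetaLc (β : ℝ) (y : ℂ) : ℂ :=
  (if Int.fract β = 0 then 1 - y else 1) * (-y) ^ (-⌊β⌋)

section

variable {ι : Type*} {l : Filter ι} {P y : ι → ℂ} {y₀ : ℂ}

theorem tendsto_cpow_pos (hP : Tendsto P l (𝓝 0)) {β : ℝ} (hβ : 0 < β) :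
    Tendsto (fun i => P i ^ (β : ℂ)) l (𝓝 0) := by
  rw [tendsto_zero_iff_norm_tendsto_zero]
  simp only [Complex.norm_cpow_real]
  have := hP.norm
  simp only [norm_zero] at this
  have h2 := this.rpow_const (p := β) (Or.inr hβ.le)
  rwa [Real.zero_rpow hβ.ne'] at h2

theorem leadsTo_theta_of_mem_Ico (hP : Tendsto P l (𝓝[≠] 0)) (hy : Tendsto y l (𝓝 y₀))
    (hy₀ : y₀ ≠ 0) {β : ℝ} (h0 : 0 ≤ β) (h1 : β < 1) :
    LeadsTo l P (fun i => theta (y i * P i ^ (β : ℂ)) (P i)) 0 (if β = 0 then 1 - y₀ else 1) := by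
  have hP0 : Tendsto P l (𝓝 0) := hP.mono_right nhdsWithin_le_nhds
  have hPne : ∀ᶠ i in l, P i ≠ 0 := hP.eventually self_mem_nhdsWithin
  unfold LeadsTo theta
  simp only [Complex.ofReal_zero, neg_zero, Complex.cpow_zero, one_mul]
  have e2 : Tendsto (fun i => P i / (y i * P i ^ (β : ℂ))) l (𝓝 0) := by
    have := (hy.inv₀ hy₀).mul (tendsto_cpow_pos hP0 (β := 1 - β) (by linarith))
    rw [mul_zero] at this
    refine this.congr' ?_
    filter_upwards [hPne] with i hi
    push_cast
    rw [Complex.cpow_sub _ _ hi, Complex.cpow_one, div_eq_mul_inv, div_eq_mul_inv, mul_inv]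
    ring
  have e1 : Tendsto (fun i => y i * P i ^ (β : ℂ)) l (𝓝 (if β = 0 then y₀ else 0)) := by
    split_ifs with h
    · simpa [h] using hy
    · simpa using hy.mul (tendsto_cpow_pos hP0 (lt_of_le_of_ne h0 (Ne.symm h)))
  have := (tendsto_poch e1 hP0).mul (tendsto_poch e2 hP0)
  convert this using 2
  split_ifs <;> simp

/-- The case `0 ≤ β < 1` is clear; one step of the quasi-periodicity reduces the other cases to it. -/
theorem leadsTo_theta (hP : Tendsto P l (𝓝[≠] 0)) (hy : Tendsto y l (𝓝 y₀))
    (hy₀ : y₀ ≠ 0) {β : ℝ} (h1 : -1 ≤ β) (h2 : β < 2) :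
    LeadsTo l P (fun i => theta (y i * P i ^ (β : ℂ)) (P i)) (thetaVal β) (thetaLc β y₀) := by
  have hP0 : Tendsto P l (𝓝 0) := hP.mono_right nhdsWithin_le_nhds
  have hPne : ∀ᶠ i in l, P i ≠ 0 := hP.eventually self_mem_nhdsWithin
  have hPlt : ∀ᶠ i in l, ‖P i‖ < 1 := hP0.norm.eventually_lt_const (by simp)
  have hyne : ∀ᶠ i in l, y i ≠ 0 := hy.eventually_ne hy₀
  have cpow_succ : ∀ γ : ℝ, ∀ i, P i ≠ 0 →
      P i ^ ((γ + 1 : ℝ) : ℂ) = P i ^ (γ : ℂ) * P i := fun γ i hi => by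
    push_cast
    rw [Complex.cpow_add _ _ hi, Complex.cpow_one]
  have cpow_neg_mul : ∀ γ : ℝ, ∀ i, P i ≠ 0 → P i ^ (-(γ : ℂ)) * P i ^ (γ : ℂ) = 1 :=
    fun γ i hi => by rw [← Complex.cpow_add _ _ hi]; simp
  rcases lt_or_ge β 0 with h0 | h0
  · -- shift the argument by one power of the nome upwards
    have hfl : ⌊β⌋ = -1 := by rw [Int.floor_eq_iff]; push_cast; constructor <;> linarith
    have hfr : Int.fract β = β + 1 := by rw [Int.fract, hfl]; push_cast; ring
    have hb := leadsTo_theta_of_mem_Ico hP hy hy₀ (β := β + 1) (by linarith) (by linarith)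
    have hv : thetaVal β = β := by
      rw [thetaVal, min_eq_left h0.le, min_eq_left (by linarith)]; ring
    have hc : thetaLc β y₀ = -y₀ * (if β + 1 = 0 then 1 - y₀ else 1) := by
      simp only [thetaLc, hfl, hfr, neg_neg, zpow_one]; ring
    rw [hv, hc]
    refine Tendsto.congr' ?_ (hy.neg.mul hb)
    filter_upwards [hPne, hPlt, hyne] with i hi hi1 hyi
    have hc0 : P i ^ (β : ℂ) ≠ 0 := fun h => hi ((Complex.cpow_eq_zero_iff _ _).1 h).1
    rw [theta_eq_neg_mul hi1 hi (z := y i * P i ^ (β : ℂ)) (mul_ne_zero hyi hc0), cpow_succ β i hi]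
    have h3 := cpow_neg_mul β i hi
    rw [show P i * (y i * P i ^ (β : ℂ)) = y i * (P i ^ (β : ℂ) * P i) by ring]
    simp only [Complex.ofReal_zero, neg_zero, Complex.cpow_zero, one_mul]
    linear_combination (y i * theta (y i * (P i ^ (β : ℂ) * P i)) (P i)) * h3
  rcases lt_or_ge β 1 with h0' | h0'
  · have hfl : ⌊β⌋ = 0 := by rw [Int.floor_eq_iff]; push_cast; constructor <;> linarith
    have hfr : Int.fract β = β := by rw [Int.fract, hfl]; push_cast; ring
    have hv : thetaVal β = 0 := by
      rw [thetaVal, min_eq_right h0, min_eq_left (by linarith)]; ring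
    have hc : thetaLc β y₀ = if β = 0 then 1 - y₀ else 1 := by
      simp only [thetaLc, hfl, hfr, neg_zero, zpow_zero, mul_one]
    rw [hv, hc]
    exact leadsTo_theta_of_mem_Ico hP hy hy₀ h0 h0'
  · -- shift the argument by one power of the nome downwards
    have hfl : ⌊β⌋ = 1 := by rw [Int.floor_eq_iff]; push_cast; constructor <;> linarith
    have hfr : Int.fract β = β - 1 := by rw [Int.fract, hfl]; push_cast; ring
    have hb := leadsTo_theta_of_mem_Ico hP hy hy₀ (β := β - 1) (by linarith) (by linarith)
    have hv : thetaVal β = 1 - β := by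
      rw [thetaVal, min_eq_right h0, min_eq_right (by linarith)]; ring
    have hc : thetaLc β y₀ = (-y₀)⁻¹ * (if β - 1 = 0 then 1 - y₀ else 1) := by
      simp only [thetaLc, hfl, hfr, zpow_neg, zpow_one]; ring
    rw [hv, hc]
    refine Tendsto.congr' ?_ ((hy.neg.inv₀ (neg_ne_zero.2 hy₀)).mul hb)
    filter_upwards [hPne, hPlt, hyne] with i hi hi1 hyi
    have hc0 : P i ^ ((β - 1 : ℝ) : ℂ) ≠ 0 := fun h => hi ((Complex.cpow_eq_zero_iff _ _).1 h).1
    have h3 := cpow_neg_mul (β - 1) i hi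
    have h4 := cpow_succ (β - 1) i hi
    rw [sub_add_cancel] at h4
    rw [theta_eq_neg_mul hi1 hi (z := y i * P i ^ ((β - 1 : ℝ) : ℂ)) (mul_ne_zero hyi hc0), h4,
      show P i * (y i * P i ^ ((β - 1 : ℝ) : ℂ)) = y i * (P i ^ ((β - 1 : ℝ) : ℂ) * P i) by ring,
      show (-((1 - β : ℝ) : ℂ)) = ((β - 1 : ℝ) : ℂ) by push_cast; ring]
    simp only [Complex.ofReal_zero, neg_zero, Complex.cpow_zero, one_mul]
    field_simp

end


/-! ### Products of monomials over the boxes of a diagram -/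

theorem prod_zpow_eq_zpow_sum {κ : Type*} (s : Finset κ) (f : κ → ℤ) {q : ℂ} (hq : q ≠ 0) :
    ∏ k ∈ s, q ^ f k = q ^ ∑ k ∈ s, f k := by
  classical
  induction s using Finset.induction_on with
  | empty => simp
  | insert a s ha ih => rw [Finset.prod_insert ha, Finset.sum_insert ha, ih, zpow_add₀ hq]

theorem sum_Icc_sub_one (L : ℕ) : ∑ j ∈ Finset.Icc 1 L, ((j : ℤ) - 1) = (L.choose 2 : ℕ) := by
  induction L with
  | zero => simp
  | succ L ih =>
    rw [Finset.sum_Icc_succ_top (by omega), ih, Nat.choose_succ_succ' L 1]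
    push_cast [Nat.choose_one_right]
    ring

theorem sum_Icc_cast (L : ℕ) : ∑ j ∈ Finset.Icc 1 L, (j : ℤ) = (L.choose 2 : ℕ) + L := by
  have := sum_Icc_sub_one L
  rw [Finset.sum_sub_distrib] at this
  simp only [Finset.sum_const, Nat.card_Icc, Nat.add_sub_cancel, nsmul_eq_mul, mul_one] at this
  linarith

/-- Two times the first binomial moment: `L² = 2 binom(L, 2) + L`. -/
theorem sq_eq_choose (L : ℕ) : (L : ℤ) * L = 2 * (L.choose 2 : ℕ) + L := by
  induction L with
  | zero => simp
  | succ L ih =>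
    rw [Nat.choose_succ_succ' L 1]
    push_cast [Nat.choose_one_right]
    linarith

theorem prod_box_monomial {k : ℕ} (l : Fin k → ℕ) (a b : Fin k → ℕ → ℤ) {q t : ℂ} (x : ℂ)
    (hq : q ≠ 0) (ht : t ≠ 0) :
    ∏ i : Fin k, ∏ j ∈ Finset.Icc 1 (l i), (-(q ^ a i j * t ^ b i j * x)) =
      (-x) ^ size l * q ^ (∑ i, ∑ j ∈ Finset.Icc 1 (l i), a i j) *
        t ^ (∑ i, ∑ j ∈ Finset.Icc 1 (l i), b i j) := by
  have h : ∀ i : Fin k, ∀ j, -(q ^ a i j * t ^ b i j * x) = (-x) * q ^ a i j * t ^ b i j :=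
    fun i j => by ring
  simp only [h, Finset.prod_mul_distrib, Finset.prod_const, Nat.card_Icc, Nat.add_sub_cancel,
    prod_zpow_eq_zpow_sum _ _ hq, prod_zpow_eq_zpow_sum _ _ ht, Finset.prod_pow_eq_pow_sum, size]

theorem sum_box_row {k : ℕ} (l : Fin k → ℕ) :
    ∑ i : Fin k, ∑ _j ∈ Finset.Icc 1 (l i), ((i : ℕ) : ℤ) = nStat l := by
  simp [nStat, mul_comm]

theorem sum_box_conjPart {k : ℕ} {l : Fin k → ℕ} (hl : Antitone l) :
    ∑ i : Fin k, ∑ j ∈ Finset.Icc 1 (l i), (conjPart l j : ℤ) = 2 * nStat l + size l := by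
  have h1 : ∀ i : Fin k, ∑ j ∈ Finset.Icc 1 (l i), (conjPart l j : ℤ) =
      ∑ i' : Fin k, ((if i' ≤ i then (l i : ℤ) else 0) + if i < i' then (l i' : ℤ) else 0) := by
    intro i
    have h2 : ∀ j, (conjPart l j : ℤ) = ∑ i' : Fin k, if j ≤ l i' then (1 : ℤ) else 0 := by
      intro j; simp [conjPart]
    simp only [h2]
    rw [Finset.sum_comm]
    refine Finset.sum_congr rfl fun i' _ => ?_
    rw [← Finset.sum_filter, Finset.sum_const, nsmul_eq_mul, mul_one]
    have h3 : (Finset.Icc 1 (l i)).filter (fun j => j ≤ l i') = Finset.Icc 1 (min (l i) (l i')) := by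
      ext j; simp only [Finset.mem_filter, Finset.mem_Icc]; omega
    rw [h3, Nat.card_Icc, Nat.add_sub_cancel]
    rcases le_or_gt i' i with h | h
    · simp [h, min_eq_left (hl h), not_lt.2 h]
    · simp [h, min_eq_right (hl h.le), not_le.2 h]
  simp only [h1, Finset.sum_add_distrib]
  rw [Finset.sum_comm (f := fun i i' : Fin k => if i < i' then (l i' : ℤ) else 0)]
  simp only [← Finset.sum_filter, Finset.sum_const, nsmul_eq_mul]
  have c1 : ∀ i : Fin k, (Finset.univ.filter fun i' => i' ≤ i).card = i + 1 := fun i => by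
    rw [Finset.filter_ge_eq_Iic, Fin.card_Iic]
  have c2 : ∀ i : Fin k, (Finset.univ.filter fun i' => i' < i).card = i := fun i => by
    rw [Finset.filter_gt_eq_Iio, Fin.card_Iio]
  simp only [c1, c2, nStat, size]
  push_cast
  rw [← Finset.sum_add_distrib, Finset.mul_sum, ← Finset.sum_add_distrib]
  exact Finset.sum_congr rfl fun i _ => by ring

/-- The product of the negated box monomials of `C⁰_l(x)`. -/
theorem prod_box_zero {k : ℕ} (l : Fin k → ℕ) {q t : ℂ} (x : ℂ) (hq : q ≠ 0) (ht : t ≠ 0) :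
    ∏ i : Fin k, ∏ j ∈ Finset.Icc 1 (l i),
        (-(q ^ ((j : ℤ) - 1) * t ^ (1 - ((i : ℤ) + 1)) * x)) =
      (-x) ^ size l * q ^ (nStatConj l : ℤ) * t ^ (-(nStat l : ℤ)) := by
  rw [prod_box_monomial l (fun _ j => (j : ℤ) - 1) (fun i _ => 1 - ((i : ℤ) + 1)) x hq ht]
  congr 2
  · simp only [sum_Icc_sub_one, nStatConj, Nat.cast_sum]
  · simp only [sub_add_cancel_right, Finset.sum_neg_distrib, sum_box_row]

/-- The product of the negated box monomials of `C⁻_l(x)`. -/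
theorem prod_box_minus {k : ℕ} {l : Fin k → ℕ} (hl : Antitone l) {q t : ℂ} (x : ℂ) (hq : q ≠ 0)
    (ht : t ≠ 0) :
    ∏ i : Fin k, ∏ j ∈ Finset.Icc 1 (l i),
        (-(q ^ ((l i : ℤ) - j) * t ^ ((conjPart l j : ℤ) - ((i : ℤ) + 1)) * x)) =
      (-x) ^ size l * q ^ (nStatConj l : ℤ) * t ^ (nStat l : ℤ) := by
  rw [prod_box_monomial l (fun i j => (l i : ℤ) - j)
    (fun i j => (conjPart l j : ℤ) - ((i : ℤ) + 1)) x hq ht]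
  congr 2
  · simp only [Finset.sum_sub_distrib, sum_Icc_cast]
    simp only [Finset.sum_const, Nat.card_Icc, Nat.add_sub_cancel, nsmul_eq_mul, sq_eq_choose,
      nStatConj]
    push_cast
    rw [← Finset.sum_sub_distrib]
    exact congrArg _ (Finset.sum_congr rfl fun i _ => by ring)
  · simp only [Finset.sum_sub_distrib, Finset.sum_add_distrib, sum_box_row, sum_box_conjPart hl]
    simp [size]
    ring

/-- The product of the negated box monomials of `C⁺_l(x)`. -/
theorem prod_box_plus {k : ℕ} {l : Fin k → ℕ} (hl : Antitone l) {q t : ℂ} (x : ℂ) (hq : q ≠ 0)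
    (ht : t ≠ 0) :
    ∏ i : Fin k, ∏ j ∈ Finset.Icc 1 (l i),
        (-(q ^ ((l i : ℤ) + j - 1) * t ^ (2 - (conjPart l j : ℤ) - ((i : ℤ) + 1)) * x)) =
      (-x) ^ size l * q ^ (3 * (nStatConj l : ℤ) + size l) * t ^ (-3 * (nStat l : ℤ)) := by
  rw [prod_box_monomial l (fun i j => (l i : ℤ) + j - 1)
    (fun i j => 2 - (conjPart l j : ℤ) - ((i : ℤ) + 1)) x hq ht]
  congr 2
  · simp only [Finset.sum_sub_distrib, Finset.sum_add_distrib, sum_Icc_cast]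
    simp only [Finset.sum_const, Nat.card_Icc, Nat.add_sub_cancel, nsmul_eq_mul, sq_eq_choose,
      nStatConj, size]
    push_cast
    simp only [Finset.mul_sum, ← Finset.sum_sub_distrib, ← Finset.sum_add_distrib]
    exact congrArg _ (Finset.sum_congr rfl fun i _ => by ring)
  · simp only [Finset.sum_sub_distrib, Finset.sum_add_distrib, sum_box_row, sum_box_conjPart hl]
    simp [size, ← Finset.sum_mul]
    ring

/-! ### The partition `2 l²` -/

theorem prod_fin_two_mul {M : Type*} [CommMonoid M] {k : ℕ} (g : Fin (2 * k) → M) :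
    ∏ i, g i = ∏ i : Fin k, g ⟨2 * i, by omega⟩ * g ⟨2 * i + 1, by omega⟩ := by
  rw [← Equiv.prod_comp (finProdFinEquiv.trans (finCongr (mul_comm k 2))) g,
    Fintype.prod_prod_type]
  refine Finset.prod_congr rfl fun i _ => ?_
  rw [Fin.prod_univ_two]
  congr 2
  · ext; simp
  · ext; simp [add_comm]

theorem sum_fin_two_mul {k : ℕ} (g : Fin (2 * k) → ℕ) :
    ∑ i, g i = ∑ i : Fin k, (g ⟨2 * i, by omega⟩ + g ⟨2 * i + 1, by omega⟩) :=
  prod_fin_two_mul (M := Multiplicative ℕ) g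

theorem doubleSq_even {k : ℕ} (l : Fin k → ℕ) (i : Fin k) (h : 2 * (i : ℕ) < 2 * k) :
    doubleSq l ⟨2 * i, h⟩ = 2 * l i := by
  simp [doubleSq]

theorem doubleSq_odd {k : ℕ} (l : Fin k → ℕ) (i : Fin k) (h : 2 * (i : ℕ) + 1 < 2 * k) :
    doubleSq l ⟨2 * i + 1, h⟩ = 2 * l i := by
  have : (2 * (i : ℕ) + 1) / 2 = i := by omega
  simp [doubleSq, this]

theorem size_doubleSq {k : ℕ} (l : Fin k → ℕ) : size (doubleSq l) = 4 * size l := by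
  unfold size
  rw [sum_fin_two_mul, Finset.mul_sum]
  exact Finset.sum_congr rfl fun i _ => by rw [doubleSq_even, doubleSq_odd]; ring

theorem nStat_doubleSq {k : ℕ} (l : Fin k → ℕ) :
    nStat (doubleSq l) = 8 * nStat l + 2 * size l := by
  unfold nStat size
  rw [sum_fin_two_mul, Finset.mul_sum, Finset.mul_sum, ← Finset.sum_add_distrib]
  exact Finset.sum_congr rfl fun i _ => by rw [doubleSq_even, doubleSq_odd]; ring

theorem nStatConj_doubleSq {k : ℕ} (l : Fin k → ℕ) :
    nStatConj (doubleSq l) = 8 * nStatConj l + 2 * size l := by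
  have h : ∀ L : ℕ, (2 * L).choose 2 = 4 * L.choose 2 + L := by
    intro L
    have h1 := sq_eq_choose L
    have h2 := sq_eq_choose (2 * L)
    push_cast at h2
    zify
    linarith
  unfold nStatConj size
  rw [sum_fin_two_mul, Finset.mul_sum, Finset.mul_sum, ← Finset.sum_add_distrib]
  exact Finset.sum_congr rfl fun i _ => by rw [doubleSq_even, doubleSq_odd, h]; ring


/-! ### Leading coefficients of the elliptic symbols -/

theorem thetaLc_ne_zero {β : ℝ} {y : ℂ} (h0 : y ≠ 0) (h1 : y ≠ 1) : thetaLc β y ≠ 0 := by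
  unfold thetaLc
  refine mul_ne_zero ?_ (zpow_ne_zero _ (neg_ne_zero.2 h0))
  split_ifs
  · exact sub_ne_zero.2 h1.symm
  · exact one_ne_zero

noncomputable section

/-- The leading coefficient of `C⁰_l(x p^β)`. -/
def C0Lc (β : ℝ) {k : ℕ} (l : Fin k → ℕ) (x q t : ℂ) : ℂ :=
  ∏ i : Fin k, ∏ j ∈ Finset.Icc 1 (l i),
    thetaLc β (q ^ ((j : ℤ) - 1) * t ^ (1 - ((i : ℤ) + 1)) * x)

/-- The leading coefficient of `C⁻_l(x p^β)`. -/
def CminusLc (β : ℝ) {k : ℕ} (l : Fin k → ℕ) (x q t : ℂ) : ℂ :=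
  ∏ i : Fin k, ∏ j ∈ Finset.Icc 1 (l i),
    thetaLc β (q ^ ((l i : ℤ) - j) * t ^ ((conjPart l j : ℤ) - ((i : ℤ) + 1)) * x)

/-- The leading coefficient of `C⁺_l(x p^β)`. -/
def CplusLc (β : ℝ) {k : ℕ} (l : Fin k → ℕ) (x q t : ℂ) : ℂ :=
  ∏ i : Fin k, ∏ j ∈ Finset.Icc 1 (l i),
    thetaLc β (q ^ ((l i : ℤ) + j - 1) * t ^ (2 - (conjPart l j : ℤ) - ((i : ℤ) + 1)) * x)

/-- The leading coefficient of `Δ_l(a p^A | b_1 p^{B_1}, …, b_s p^{B_s})`. -/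
def DeltaLc {k s : ℕ} (A : ℝ) (B : Fin s → ℝ) (l : Fin k → ℕ) (a : ℂ) (b : Fin s → ℂ)
    (q t : ℂ) : ℂ :=
  (∏ r, C0Lc (B r) l (b r) q t / C0Lc (1 + A - B r) l (q * a / b r) q t) *
    (C0Lc (1 + A) (doubleSq l) (q * a) q t /
      (CminusLc 1 l q q t * CminusLc 0 l t q t *
        (CplusLc A l a q t * CplusLc (1 + A) l (q * a / t) q t)))

end

theorem prod_box_thetaLc {k : ℕ} (l : Fin k → ℕ) (β : ℝ) (u : Fin k → ℕ → ℂ) :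
    ∏ i, ∏ j ∈ Finset.Icc 1 (l i), thetaLc β (u i j) =
      (if Int.fract β = 0 then ∏ i, ∏ j ∈ Finset.Icc 1 (l i), (1 - u i j) else 1) *
        (∏ i, ∏ j ∈ Finset.Icc 1 (l i), (-u i j)) ^ (-⌊β⌋) := by
  simp only [thetaLc, Finset.prod_mul_distrib, Finset.prod_zpow]
  congr 1
  split_ifs <;> simp

theorem C0Lc_eq (β : ℝ) {k : ℕ} (l : Fin k → ℕ) (x : ℂ) {q t : ℂ} (hq : q ≠ 0) (ht : t ≠ 0) :
    C0Lc β l x q t = (if Int.fract β = 0 then qC0 l x q t else 1) *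
      ((-x) ^ size l * q ^ (nStatConj l : ℤ) * t ^ (-(nStat l : ℤ))) ^ (-⌊β⌋) := by
  rw [C0Lc, prod_box_thetaLc, prod_box_zero l x hq ht]
  rfl

theorem CminusLc_eq (β : ℝ) {k : ℕ} {l : Fin k → ℕ} (hl : Antitone l) (x : ℂ) {q t : ℂ}
    (hq : q ≠ 0) (ht : t ≠ 0) :
    CminusLc β l x q t = (if Int.fract β = 0 then qCminus l x q t else 1) *
      ((-x) ^ size l * q ^ (nStatConj l : ℤ) * t ^ (nStat l : ℤ)) ^ (-⌊β⌋) := by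
  rw [CminusLc, prod_box_thetaLc, prod_box_minus hl x hq ht]
  rfl

theorem CplusLc_eq (β : ℝ) {k : ℕ} {l : Fin k → ℕ} (hl : Antitone l) (x : ℂ) {q t : ℂ}
    (hq : q ≠ 0) (ht : t ≠ 0) :
    CplusLc β l x q t = (if Int.fract β = 0 then qCplus l x q t else 1) *
      ((-x) ^ size l * q ^ (3 * (nStatConj l : ℤ) + size l) *
        t ^ (-3 * (nStat l : ℤ))) ^ (-⌊β⌋) := by
  rw [CplusLc, prod_box_thetaLc, prod_box_plus hl x hq ht]
  rfl

section

variable {ι : Type*} {f : Filter ι} {P q t : ι → ℂ} {q₀ t₀ : ℂ}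

theorem leadsTo_prod_box_theta (hP : Tendsto P f (𝓝[≠] 0)) {k : ℕ} (l : Fin k → ℕ)
    (hq : Tendsto q f (𝓝 q₀)) (ht : Tendsto t f (𝓝 t₀)) (hq0 : q₀ ≠ 0) (ht0 : t₀ ≠ 0)
    {x : ι → ℂ} {x₀ : ℂ} (hx : Tendsto x f (𝓝 x₀)) (hx0 : x₀ ≠ 0)
    {β : ℝ} (h1 : -1 ≤ β) (h2 : β < 2) (a b : Fin k → ℕ → ℤ) :
    LeadsTo f P (fun i => ∏ c : Fin k, ∏ j ∈ Finset.Icc 1 (l c),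
        theta (q i ^ a c j * t i ^ b c j * (x i * P i ^ (β : ℂ))) (P i))
      (size l * thetaVal β)
      (∏ c : Fin k, ∏ j ∈ Finset.Icc 1 (l c), thetaLc β (q₀ ^ a c j * t₀ ^ b c j * x₀)) := by
  have hPne : ∀ᶠ i in f, P i ≠ 0 := hP.eventually self_mem_nhdsWithin
  have key : ∀ c : Fin k, ∀ j, LeadsTo f P
      (fun i => theta (q i ^ a c j * t i ^ b c j * (x i * P i ^ (β : ℂ))) (P i)) (thetaVal β)
      (thetaLc β (q₀ ^ a c j * t₀ ^ b c j * x₀)) := by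
    intro c j
    have hy : Tendsto (fun i => q i ^ a c j * t i ^ b c j * x i) f
        (𝓝 (q₀ ^ a c j * t₀ ^ b c j * x₀)) :=
      ((hq.zpow₀ _ (Or.inl hq0)).mul (ht.zpow₀ _ (Or.inl ht0))).mul hx
    refine (leadsTo_theta hP hy (by positivity) h1 h2).congr (Eventually.of_forall fun i => ?_)
    simp only [mul_assoc]
  have := LeadsTo.prod hPne Finset.univ fun c _ =>
    LeadsTo.prod hPne (Finset.Icc 1 (l c)) fun j _ => key c j
  convert this using 1
  simp [size, Finset.sum_mul]

theorem leadsTo_C0 (hP : Tendsto P f (𝓝[≠] 0)) {k : ℕ} (l : Fin k → ℕ)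
    (hq : Tendsto q f (𝓝 q₀)) (ht : Tendsto t f (𝓝 t₀)) (hq0 : q₀ ≠ 0) (ht0 : t₀ ≠ 0)
    {x : ι → ℂ} {x₀ : ℂ} (hx : Tendsto x f (𝓝 x₀)) (hx0 : x₀ ≠ 0)
    {β : ℝ} (h1 : -1 ≤ β) (h2 : β < 2) :
    LeadsTo f P (fun i => C0 l (x i * P i ^ (β : ℂ)) (q i) (t i) (P i))
      (size l * thetaVal β) (C0Lc β l x₀ q₀ t₀) :=
  leadsTo_prod_box_theta hP l hq ht hq0 ht0 hx hx0 h1 h2 _ _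

theorem leadsTo_Cminus (hP : Tendsto P f (𝓝[≠] 0)) {k : ℕ} (l : Fin k → ℕ)
    (hq : Tendsto q f (𝓝 q₀)) (ht : Tendsto t f (𝓝 t₀)) (hq0 : q₀ ≠ 0) (ht0 : t₀ ≠ 0)
    {x : ι → ℂ} {x₀ : ℂ} (hx : Tendsto x f (𝓝 x₀)) (hx0 : x₀ ≠ 0)
    {β : ℝ} (h1 : -1 ≤ β) (h2 : β < 2) :
    LeadsTo f P (fun i => Cminus l (x i * P i ^ (β : ℂ)) (q i) (t i) (P i))
      (size l * thetaVal β) (CminusLc β l x₀ q₀ t₀) :=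
  leadsTo_prod_box_theta hP l hq ht hq0 ht0 hx hx0 h1 h2 _ _

theorem leadsTo_Cplus (hP : Tendsto P f (𝓝[≠] 0)) {k : ℕ} (l : Fin k → ℕ)
    (hq : Tendsto q f (𝓝 q₀)) (ht : Tendsto t f (𝓝 t₀)) (hq0 : q₀ ≠ 0) (ht0 : t₀ ≠ 0)
    {x : ι → ℂ} {x₀ : ℂ} (hx : Tendsto x f (𝓝 x₀)) (hx0 : x₀ ≠ 0)
    {β : ℝ} (h1 : -1 ≤ β) (h2 : β < 2) :
    LeadsTo f P (fun i => Cplus l (x i * P i ^ (β : ℂ)) (q i) (t i) (P i))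
      (size l * thetaVal β) (CplusLc β l x₀ q₀ t₀) :=
  leadsTo_prod_box_theta hP l hq ht hq0 ht0 hx hx0 h1 h2 _ _

/-- The leading term of `Δ_l(a p^A | b_1 p^{B_1}, …, b_s p^{B_s})`. -/
theorem leadsTo_Delta (hP : Tendsto P f (𝓝[≠] 0)) {k s : ℕ} (l : Fin k → ℕ)
    (hq : Tendsto q f (𝓝 q₀)) (ht : Tendsto t f (𝓝 t₀)) (hq0 : q₀ ≠ 0) (ht0 : t₀ ≠ 0)
    {a : ι → ℂ} {a₀ : ℂ} (ha : Tendsto a f (𝓝 a₀)) (ha0 : a₀ ≠ 0)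
    {b : ι → Fin s → ℂ} {b₀ : Fin s → ℂ} (hb : ∀ r, Tendsto (fun i => b i r) f (𝓝 (b₀ r)))
    (hb0 : ∀ r, b₀ r ≠ 0) {A : ℝ} {B : Fin s → ℝ} (hA1 : -1 ≤ A) (hA2 : A ≤ 0)
    (hB1 : ∀ r, -1 ≤ B r) (hB2 : ∀ r, B r < 2) (hB3 : ∀ r, -1 ≤ 1 + A - B r)
    (hB4 : ∀ r, 1 + A - B r < 2)
    (hd1 : ∀ r, C0Lc (1 + A - B r) l (q₀ * a₀ / b₀ r) q₀ t₀ ≠ 0)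
    (hd2 : CminusLc 1 l q₀ q₀ t₀ ≠ 0) (hd3 : CminusLc 0 l t₀ q₀ t₀ ≠ 0)
    (hd4 : CplusLc A l a₀ q₀ t₀ ≠ 0) (hd5 : CplusLc (1 + A) l (q₀ * a₀ / t₀) q₀ t₀ ≠ 0) :
    LeadsTo f P
      (fun i => Delta l (a i * P i ^ (A : ℂ)) (fun r => b i r * P i ^ (B r : ℂ)) (q i) (t i) (P i))
      (size l * ((∑ r, (thetaVal (B r) - thetaVal (1 + A - B r))) - thetaVal A))
      (DeltaLc A B l a₀ b₀ q₀ t₀) := by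
  have hPne : ∀ᶠ i in f, P i ≠ 0 := hP.eventually self_mem_nhdsWithin
  have hv0 : thetaVal 0 = 0 := by simp [thetaVal]
  have hv1 : thetaVal 1 = 0 := by simp [thetaVal]
  have hvA : thetaVal (1 + A) = 0 := by
    rw [thetaVal, min_eq_right (by linarith), min_eq_left (by linarith)]; ring
  have hqa : Tendsto (fun i => q i * a i) f (𝓝 (q₀ * a₀)) := hq.mul ha
  have e1 : ∀ r, LeadsTo f P (fun i => C0 l (b i r * P i ^ (B r : ℂ)) (q i) (t i) (P i) /
      C0 l (P i * q i * (a i * P i ^ (A : ℂ)) / (b i r * P i ^ (B r : ℂ))) (q i) (t i) (P i))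
      (size l * (thetaVal (B r) - thetaVal (1 + A - B r)))
      (C0Lc (B r) l (b₀ r) q₀ t₀ / C0Lc (1 + A - B r) l (q₀ * a₀ / b₀ r) q₀ t₀) := by
    intro r
    have n1 := leadsTo_C0 hP l hq ht hq0 ht0 (hb r) (hb0 r) (hB1 r) (hB2 r)
    have n2 := leadsTo_C0 hP l hq ht hq0 ht0 (hqa.div (hb r) (hb0 r))
      (div_ne_zero (mul_ne_zero hq0 ha0) (hb0 r)) (hB3 r) (hB4 r)
    rw [mul_sub]
    refine (n1.div hPne n2 (hd1 r)).congr ?_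
    filter_upwards [hPne] with i hi
    congr 2
    push_cast
    rw [Complex.cpow_sub _ _ hi, Complex.cpow_add _ _ hi, Complex.cpow_one, Pi.div_apply]
    ring
  have e2 : LeadsTo f P (fun i => C0 (doubleSq l) (P i * q i * (a i * P i ^ (A : ℂ)))
      (q i) (t i) (P i)) 0 (C0Lc (1 + A) (doubleSq l) (q₀ * a₀) q₀ t₀) := by
    have := leadsTo_C0 hP (doubleSq l) hq ht hq0 ht0 hqa (mul_ne_zero hq0 ha0)
      (β := 1 + A) (by linarith) (by linarith)
    rw [hvA, mul_zero] at this
    refine this.congr ?_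
    filter_upwards [hPne] with i hi
    congr 1
    push_cast
    rw [Complex.cpow_add _ _ hi, Complex.cpow_one]
    ring
  have e3 : LeadsTo f P (fun i => Cminus l (P i * q i) (q i) (t i) (P i)) 0
      (CminusLc 1 l q₀ q₀ t₀) := by
    have := leadsTo_Cminus hP l hq ht hq0 ht0 hq hq0 (β := 1) (by norm_num) (by norm_num)
    rw [hv1, mul_zero] at this
    refine this.congr (Eventually.of_forall fun i => ?_)
    congr 1
    simp [mul_comm]
  have e4 : LeadsTo f P (fun i => Cminus l (t i) (q i) (t i) (P i)) 0
      (CminusLc 0 l t₀ q₀ t₀) := by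
    have := leadsTo_Cminus hP l hq ht hq0 ht0 ht ht0 (β := 0) (by norm_num) (by norm_num)
    rw [hv0, mul_zero] at this
    refine this.congr (Eventually.of_forall fun i => ?_)
    congr 1
    simp
  have e5 := leadsTo_Cplus hP l hq ht hq0 ht0 ha ha0 (β := A) hA1 (by linarith)
  have e6 : LeadsTo f P (fun i => Cplus l (P i * q i * (a i * P i ^ (A : ℂ)) / t i)
      (q i) (t i) (P i)) 0 (CplusLc (1 + A) l (q₀ * a₀ / t₀) q₀ t₀) := by
    have := leadsTo_Cplus hP l hq ht hq0 ht0 (hqa.div ht ht0)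
      (div_ne_zero (mul_ne_zero hq0 ha0) ht0) (β := 1 + A) (by linarith) (by linarith)
    rw [hvA, mul_zero] at this
    refine this.congr ?_
    filter_upwards [hPne] with i hi
    congr 1
    push_cast
    rw [Complex.cpow_add _ _ hi, Complex.cpow_one, Pi.div_apply]
    ring
  have key := (LeadsTo.prod hPne Finset.univ fun r _ => e1 r).mul hPne
    (e2.div hPne ((e3.mul hPne e4).mul hPne (e5.mul hPne e6))
      (mul_ne_zero (mul_ne_zero hd2 hd3) (mul_ne_zero hd4 hd5)))
  have hval : (size l : ℝ) * ((∑ r, (thetaVal (B r) - thetaVal (1 + A - B r))) - thetaVal A) =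
      ∑ r, (size l : ℝ) * (thetaVal (B r) - thetaVal (1 + A - B r)) +
        (0 - (0 + 0 + (size l * thetaVal A + 0))) := by
    rw [← Finset.mul_sum]; ring
  rw [hval]
  exact key

end


/-! ### Rational functions and conditions cut out by polynomials -/

section

variable {σ : Type} {S : Set (σ → ℂ)} {f g : (σ → ℂ) → ℂ}

/-- `f` agrees on `S` with a quotient of polynomials whose denominator has no zero on `S`. -/
def RationalOn (S : Set (σ → ℂ)) (f : (σ → ℂ) → ℂ) : Prop :=
  ∃ P Q : MvPolynomial σ ℂ, ∀ x ∈ S, MvPolynomial.eval x Q ≠ 0 ∧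
    f x = MvPolynomial.eval x P / MvPolynomial.eval x Q

/-- On `S`, the condition `p` is the nonvanishing of a polynomial. -/
def PolynomialConditionOn (S : Set (σ → ℂ)) (p : (σ → ℂ) → Prop) : Prop :=
  ∃ D : MvPolynomial σ ℂ, ∀ x ∈ S, MvPolynomial.eval x D ≠ 0 ↔ p x

namespace RationalOn

theorem congr (hf : RationalOn S f) (h : ∀ x ∈ S, g x = f x) : RationalOn S g := by
  obtain ⟨P, Q, hPQ⟩ := hf
  exact ⟨P, Q, fun x hx => ⟨(hPQ x hx).1, (h x hx).trans (hPQ x hx).2⟩⟩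

theorem const (c : ℂ) : RationalOn S fun _ => c :=
  ⟨MvPolynomial.C c, 1, fun x _ => by simp⟩

theorem coord (i : σ) : RationalOn S fun x => x i :=
  ⟨MvPolynomial.X i, 1, fun x _ => by simp⟩

theorem add (hf : RationalOn S f) (hg : RationalOn S g) : RationalOn S fun x => f x + g x := by
  obtain ⟨P, Q, h⟩ := hf
  obtain ⟨P', Q', h'⟩ := hg
  refine ⟨P * Q' + Q * P', Q * Q', fun x hx => ?_⟩
  obtain ⟨h1, h2⟩ := h x hx
  obtain ⟨h1', h2'⟩ := h' x hx
  simp only [map_mul, map_add]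
  exact ⟨mul_ne_zero h1 h1', by rw [h2, h2', div_add_div _ _ h1 h1']⟩

theorem mul (hf : RationalOn S f) (hg : RationalOn S g) : RationalOn S fun x => f x * g x := by
  obtain ⟨P, Q, h⟩ := hf
  obtain ⟨P', Q', h'⟩ := hg
  refine ⟨P * P', Q * Q', fun x hx => ?_⟩
  obtain ⟨h1, h2⟩ := h x hx
  obtain ⟨h1', h2'⟩ := h' x hx
  simp only [map_mul]
  exact ⟨mul_ne_zero h1 h1', by rw [h2, h2', div_mul_div_comm]⟩

theorem neg (hf : RationalOn S f) : RationalOn S fun x => -f x :=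
  ((const (-1)).mul hf).congr fun x _ => by ring

theorem one_sub (hf : RationalOn S f) : RationalOn S fun x => 1 - f x :=
  ((const 1).add hf.neg).congr fun x _ => by ring

theorem inv (hf : RationalOn S f) (h0 : ∀ x ∈ S, f x ≠ 0) : RationalOn S fun x => (f x)⁻¹ := by
  obtain ⟨P, Q, h⟩ := hf
  refine ⟨Q, P, fun x hx => ?_⟩
  obtain ⟨h1, h2⟩ := h x hx
  have := h0 x hx
  rw [h2] at this
  exact ⟨fun h3 => this (by rw [h3, zero_div]), by simp only [h2, inv_div]⟩

theorem div (hf : RationalOn S f) (hg : RationalOn S g) (h0 : ∀ x ∈ S, g x ≠ 0) :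
    RationalOn S fun x => f x / g x :=
  (hf.mul (hg.inv h0)).congr fun _ _ => div_eq_mul_inv _ _

theorem pow (hf : RationalOn S f) (k : ℕ) : RationalOn S fun x => f x ^ k := by
  induction k with
  | zero => exact (const 1).congr fun x _ => pow_zero _
  | succ k ih => exact (ih.mul hf).congr fun x _ => pow_succ _ _

theorem zpow (hf : RationalOn S f) (h0 : ∀ x ∈ S, f x ≠ 0) (k : ℤ) :
    RationalOn S fun x => f x ^ k := by
  rcases k with k | k
  · exact (hf.pow k).congr fun x _ => by simp
  · exact ((hf.pow (k + 1)).inv fun x hx => pow_ne_zero _ (h0 x hx)).congr fun x _ => by simp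

theorem prod {κ : Type*} (s : Finset κ) {F : κ → (σ → ℂ) → ℂ}
    (h : ∀ k ∈ s, RationalOn S (F k)) : RationalOn S fun x => ∏ k ∈ s, F k x := by
  classical
  induction s using Finset.induction_on with
  | empty => simpa using const 1
  | insert a s ha ih =>
    simp only [Finset.prod_insert ha]
    exact (h a (Finset.mem_insert_self _ _)).mul
      (ih fun k hk => h k (Finset.mem_insert_of_mem hk))

theorem sum {κ : Type*} (s : Finset κ) {F : κ → (σ → ℂ) → ℂ}
    (h : ∀ k ∈ s, RationalOn S (F k)) : RationalOn S fun x => ∑ k ∈ s, F k x := by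
  classical
  induction s using Finset.induction_on with
  | empty => simpa using const 0
  | insert a s ha ih =>
    simp only [Finset.sum_insert ha]
    exact (h a (Finset.mem_insert_self _ _)).add
      (ih fun k hk => h k (Finset.mem_insert_of_mem hk))

theorem continuousOn [Finite σ] (hf : RationalOn S f) : ContinuousOn f S := by
  obtain ⟨P, Q, h⟩ := hf
  refine ContinuousOn.congr (ContinuousOn.div (MvPolynomial.continuous_eval P).continuousOn
    (MvPolynomial.continuous_eval Q).continuousOn fun x hx => (h x hx).1) fun x hx => (h x hx).2

theorem condition_ne_zero (hf : RationalOn S f) : PolynomialConditionOn S fun x => f x ≠ 0 := by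
  obtain ⟨P, Q, h⟩ := hf
  refine ⟨P, fun x hx => ?_⟩
  simp [(h x hx).2, (h x hx).1]

end RationalOn

namespace PolynomialConditionOn

variable {p r : (σ → ℂ) → Prop}

theorem and (hp : PolynomialConditionOn S p) (hr : PolynomialConditionOn S r) :
    PolynomialConditionOn S fun x => p x ∧ r x := by
  obtain ⟨D, hD⟩ := hp
  obtain ⟨E, hE⟩ := hr
  refine ⟨D * E, fun x hx => ?_⟩
  rw [map_mul, mul_ne_zero_iff, hD x hx, hE x hx]

theorem imp_left (q : Prop) (hp : PolynomialConditionOn S p) :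
    PolynomialConditionOn S fun x => q → p x := by
  by_cases hq : q
  · simpa [hq] using hp
  · exact ⟨1, fun x _ => by simp [hq]⟩

theorem forall_mem {κ : Type*} (s : Finset κ) {F : κ → (σ → ℂ) → Prop}
    (h : ∀ k ∈ s, PolynomialConditionOn S (F k)) :
    PolynomialConditionOn S fun x => ∀ k ∈ s, F k x := by
  classical
  induction s using Finset.induction_on with
  | empty => exact ⟨1, fun x _ => by simp⟩
  | insert a s ha ih =>
    simp only [Finset.forall_mem_insert]
    exact (h a (Finset.mem_insert_self _ _)).and
      (ih fun k hk => h k (Finset.mem_insert_of_mem hk))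

end PolynomialConditionOn

/-- For a rational leading coefficient, locally uniform convergence follows from the existence
of joint limits in the parameters and the nome. -/
theorem hasLeadingTerm_zero_of_tendsto [Finite σ] {F : (σ → ℂ) → ℂ → ℂ} {p : (σ → ℂ) → Prop}
    (hp : PolynomialConditionOn S p) (hf : RationalOn {x ∈ S | p x} f)
    (hne : ∃ x ∈ S, p x ∧ f x ≠ 0)
    (hlim : ∀ x ∈ S, p x → Tendsto (fun z : ℂ × (σ → ℂ) => F z.2 z.1)
      (𝓝[≠] 0 ×ˢ 𝓝[{x ∈ S | p x}] x) (𝓝 (f x))) :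
    HasLeadingTerm S F 0 f := by
  obtain ⟨D, hD⟩ := hp
  have hset : {x ∈ S | MvPolynomial.eval x D ≠ 0} = {x ∈ S | p x} := by
    ext x; simp only [Set.mem_ofPred_eq]; exact and_congr_right fun hx => hD x hx
  have hc := hf.continuousOn
  obtain ⟨P, Q, hPQ⟩ := hf
  refine ⟨D, P, Q, ?_, fun x hx h => hPQ x ⟨hx, (hD x hx).1 h⟩, ?_⟩
  · obtain ⟨x, hx, h1, h2⟩ := hne
    exact ⟨x, hx, (hD x hx).2 h1, h2⟩
  rw [hset, tendstoLocallyUniformlyOn_iff_filter]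
  intro x hx
  rw [tendstoUniformlyOnFilter_iff_tendsto]
  have h1 : Tendsto (fun z : ℂ × (σ → ℂ) => f z.2) (𝓝[≠] 0 ×ˢ 𝓝[{x ∈ S | p x}] x) (𝓝 (f x)) :=
    Tendsto.comp (hc x hx) tendsto_snd
  have h2 := (h1.prodMk_nhds (hlim x hx.1 hx.2)).mono_right (nhds_le_uniformity _)
  simpa using h2

end

/-! ### Nondegenerate parameters -/

/-- None of the monomials `q^a t^b` (except for `a = b = 0`), `q^a t^b t_0²`, `q^a t^b t_0 / t_r`
with exponents bounded by `M` equals `1`. -/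
def Nondegenerate {m : ℕ} (M : ℕ) (x : Params m) : Prop :=
  ∀ a ∈ Finset.Icc (-(M : ℤ)) M, ∀ b ∈ Finset.Icc (-(M : ℤ)) M,
    (¬(a = 0 ∧ b = 0) → 1 - x.q ^ a * x.t ^ b ≠ 0) ∧ 1 - x.q ^ a * x.t ^ b * x.τ 0 ^ 2 ≠ 0 ∧
      ∀ r ∈ Finset.univ.filter fun r : Fin (2 * m + 6) => 2 ≤ r,
        1 - x.q ^ a * x.t ^ b * (x.τ 0 / x.τ r) ≠ 0

section

variable {m : ℕ} {S : Set (Params m)}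

theorem rationalOn_q : RationalOn S Params.q := RationalOn.coord _

theorem rationalOn_t : RationalOn S Params.t := RationalOn.coord _

theorem rationalOn_τ (r : Fin (2 * m + 6)) : RationalOn S fun x => Params.τ x r :=
  RationalOn.coord _

theorem rationalOn_zpow_mul_zpow (hS : ∀ x ∈ S, ∀ i, x i ≠ 0) (a b : ℤ) :
    RationalOn S fun x : Params m => x.q ^ a * x.t ^ b :=
  (rationalOn_q.zpow (fun x hx => hS x hx _) a).mul (rationalOn_t.zpow (fun x hx => hS x hx _) b)

/-- Nondegeneracy is a finite conjunction of conditions of the form `f ≠ 0` with `f` rational. -/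
theorem condition_nondegenerate (hS : ∀ x ∈ S, ∀ i, x i ≠ 0) (M : ℕ) :
    PolynomialConditionOn S (Nondegenerate M) := by
  refine PolynomialConditionOn.forall_mem _ fun a _ => PolynomialConditionOn.forall_mem _ fun b _ =>
    PolynomialConditionOn.and ?_ (PolynomialConditionOn.and ?_
      (PolynomialConditionOn.forall_mem _ fun r _ => ?_))
  · exact .imp_left _ (rationalOn_zpow_mul_zpow hS a b).one_sub.condition_ne_zero
  · exact ((rationalOn_zpow_mul_zpow hS a b).mul
      ((rationalOn_τ 0).pow 2)).one_sub.condition_ne_zero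
  · exact ((rationalOn_zpow_mul_zpow hS a b).mul
      ((rationalOn_τ 0).div (rationalOn_τ r) fun x hx => hS x hx _)).one_sub.condition_ne_zero

end

section

variable {m M : ℕ} {x : Params m}

theorem Nondegenerate.qt_ne (h : Nondegenerate M x) {a b : ℤ} (ha : |a| ≤ M) (hb : |b| ≤ M)
    (hab : ¬(a = 0 ∧ b = 0)) : x.q ^ a * x.t ^ b ≠ 1 := fun h1 =>
  (h a (Finset.mem_Icc.2 (abs_le.1 ha)) b (Finset.mem_Icc.2 (abs_le.1 hb))).1 hab (by rw [h1, sub_self])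

theorem Nondegenerate.sq_ne (h : Nondegenerate M x) {a b : ℤ} (ha : |a| ≤ M) (hb : |b| ≤ M) :
    x.q ^ a * x.t ^ b * x.τ 0 ^ 2 ≠ 1 := fun h1 =>
  (h a (Finset.mem_Icc.2 (abs_le.1 ha)) b (Finset.mem_Icc.2 (abs_le.1 hb))).2.1 (by rw [h1, sub_self])

theorem Nondegenerate.div_ne (h : Nondegenerate M x) {a b : ℤ} (ha : |a| ≤ M) (hb : |b| ≤ M)
    {r : Fin (2 * m + 6)} (hr : 2 ≤ r) : x.q ^ a * x.t ^ b * (x.τ 0 / x.τ r) ≠ 1 := fun h1 =>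
  (h a (Finset.mem_Icc.2 (abs_le.1 ha)) b (Finset.mem_Icc.2 (abs_le.1 hb))).2.2 r (by simpa using hr)
    (by rw [h1, sub_self])

end


/-! ### The exponents -/

section

variable {m : ℕ} {α : Fin (2 * m + 6) → ℝ}

theorem two_le_succ_iff (r : Fin (2 * m + 5)) :
    (2 : Fin (2 * m + 6)) ≤ r.succ ↔ r ≠ 0 := by
  rw [Fin.le_def, Ne, Fin.ext_iff]
  have : ((2 : Fin (2 * m + 6)) : ℕ) = 2 :=
    Nat.mod_eq_of_lt (a := 2) (b := 2 * m + 6) (by omega)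
  rw [this]
  simp only [Fin.val_succ, Fin.val_zero]
  omega

theorem two_le_iff (r : Fin (2 * m + 6)) : 2 ≤ r ↔ 2 ≤ (r : ℕ) := by
  rw [Fin.le_def]
  have : ((2 : Fin (2 * m + 6)) : ℕ) = 2 :=
    Nat.mod_eq_of_lt (a := 2) (b := 2 * m + 6) (by omega)
  rw [this]

theorem three_le_iff (r : Fin (2 * m + 6)) : 3 ≤ r ↔ 3 ≤ (r : ℕ) := by
  rw [Fin.le_def]
  have : ((3 : Fin (2 * m + 6)) : ℕ) = 3 :=
    Nat.mod_eq_of_lt (a := 3) (b := 2 * m + 6) (by omega)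
  rw [this]

theorem prod_succ_eq {M : Type*} [CommMonoid M] (g : Fin (2 * m + 6) → M) :
    ∏ r : Fin (2 * m + 5), g r.succ = g 1 * ∏ r with 2 ≤ r, g r := by
  rw [Finset.prod_filter, Fin.prod_univ_succ (n := 2 * m + 5), if_neg (by rw [two_le_iff]; simp), one_mul,
    Fin.prod_univ_succ, Fin.prod_univ_succ (n := 2 * m + 4)]
  simp only [two_le_succ_iff, ne_eq, Fin.succ_ne_zero, not_false_eq_true, if_true, not_true_eq_false,
    if_false, one_mul]
  rfl

theorem sum_succ_eq (g : Fin (2 * m + 6) → ℝ) :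
    ∑ r : Fin (2 * m + 5), g r.succ = g 1 + ∑ r with 2 ≤ r, g r :=
  prod_succ_eq (M := Multiplicative ℝ) g

theorem card_two_le : (Finset.univ.filter fun r : Fin (2 * m + 6) => 2 ≤ r).card = 2 * m + 4 := by
  have h := sum_succ_eq (m := m) (fun _ => 1)
  simp only [Finset.sum_const, Finset.card_univ, Fintype.card_fin, nsmul_eq_mul, mul_one] at h
  have h2 : ((2 * m + 5 : ℕ) : ℝ) = ((1 + (Finset.univ.filter fun r : Fin (2 * m + 6) => 2 ≤ r).card : ℕ) : ℝ) := by
    push_cast; push_cast at h; linarith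
  have := Nat.cast_injective h2
  omega

namespace InFundamentalDomain

theorem two_le_apply (h : InFundamentalDomain α) {r : Fin (2 * m + 6)} (hr : 2 ≤ r) :
    α 2 ≤ α r := h.mono 2 r le_rfl hr

theorem apply_le (h : InFundamentalDomain α) {r : Fin (2 * m + 6)} (hr : 2 ≤ r) :
    α r ≤ α 2 + 1 := (h.mono r _ hr (Fin.le_last r)).trans h.spread

/-- An upper bound of the sum of the `α_r` in which all terms but one are replaced by the maximal
value `α_2 + 1`. -/
theorem sum_sub_le (h : InFundamentalDomain α) {s : Fin (2 * m + 6)} (hs : 2 ≤ s) :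
    (m : ℝ) + 1 ≤ α s + (2 * m + 3) * (α 2 + 1) := by
  have hmem : s ∈ Finset.univ.filter fun r : Fin (2 * m + 6) => 2 ≤ r := by simpa using hs
  have h1 := Finset.add_sum_erase _ α hmem
  have h2 : ∑ r ∈ (Finset.univ.filter fun r : Fin (2 * m + 6) => 2 ≤ r).erase s, α r ≤
      ((Finset.univ.filter fun r : Fin (2 * m + 6) => 2 ≤ r).erase s).card • (α 2 + 1) :=
    Finset.sum_le_card_nsmul _ _ _ fun r hr => h.apply_le (by simp at hr; exact hr.2)
  rw [Finset.card_erase_of_mem hmem, card_two_le, nsmul_eq_mul] at h2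
  have h3 := h.sum
  have h4 : ((2 * m + 4 - 1 : ℕ) : ℝ) = 2 * m + 3 := by
    rw [show 2 * m + 4 - 1 = 2 * m + 3 by omega]; push_cast; ring
  rw [h4] at h2
  linarith

/-- Otherwise all `α_r` with `r ≥ 3` would be less than `1 / 2`, and the sum of all of them too
small. -/
theorem neg_half_le (h : InFundamentalDomain α) : -(1 / 2) ≤ α 2 := by
  have h1 := h.sum_sub_le (s := 2) le_rfl
  have hm : (0 : ℝ) ≤ m := Nat.cast_nonneg m
  by_contra hlt
  push Not at hlt
  nlinarith

/-- Otherwise the other `α_r` would be at least `1 / 2`, and the sum of all of them too large. -/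
theorem lt_three_halves (h : InFundamentalDomain α) {s : Fin (2 * m + 6)} (hs : 2 ≤ s) :
    α s < 3 / 2 := by
  have hmem : s ∈ Finset.univ.filter fun r : Fin (2 * m + 6) => 2 ≤ r := by simpa using hs
  have h1 := Finset.add_sum_erase _ α hmem
  have h2 : ((Finset.univ.filter fun r : Fin (2 * m + 6) => 2 ≤ r).erase s).card • (α s - 1) ≤
      ∑ r ∈ (Finset.univ.filter fun r : Fin (2 * m + 6) => 2 ≤ r).erase s, α r :=
    Finset.card_nsmul_le_sum _ _ _ fun r hr => by
      simp at hr
      have := h.apply_le hs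
      have := h.two_le_apply hr.2
      linarith
  rw [Finset.card_erase_of_mem hmem, card_two_le, nsmul_eq_mul] at h2
  have h3 := h.sum
  have h4 : ((2 * m + 4 - 1 : ℕ) : ℝ) = 2 * m + 3 := by
    rw [show 2 * m + 4 - 1 = 2 * m + 3 by omega]; push_cast; ring
  rw [h4] at h2
  have hm : (0 : ℝ) ≤ m := Nat.cast_nonneg m
  by_contra hlt
  push Not at hlt
  nlinarith

end InFundamentalDomain

/-- The coefficient `slope α` is the sum of the valuations of the theta functions attached to one
box. -/
theorem slope_eq (h : InFundamentalDomain α) :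
    slope α = (∑ r with 2 ≤ r, (thetaVal (α 0 + α r) - thetaVal (1 + α 0 - α r))) -
      thetaVal (2 * α 0) := by
  have h1 := h.lower
  have h2 := h.upper
  have e0 : thetaVal (2 * α 0) = 2 * α 0 := by
    rw [thetaVal, min_eq_left (by linarith), min_eq_left (by linarith), add_zero]
  have key : ∑ r with 2 ≤ r, (thetaVal (α 0 + α r) - thetaVal (1 + α 0 - α r)) =
      (∑ r with 2 ≤ r ∧ α r ≤ α 0, 2 * α 0)
      + (∑ r with 2 ≤ r ∧ α 0 < α r ∧ α r < -α 0, (α 0 + α r))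
      + (∑ r with 2 ≤ r ∧ 1 + α 0 < α r ∧ α r < 1 - α 0, (α r - 1 - α 0))
      + ∑ r with 2 ≤ r ∧ 1 - α 0 ≤ α r, -2 * α 0 := by
    simp only [Finset.sum_filter, ← Finset.sum_add_distrib]
    refine Finset.sum_congr rfl fun r _ => ?_
    by_cases hr : 2 ≤ r
    · simp only [hr, true_and, if_true, thetaVal]
      rcases le_total (α 0 + α r) 0 with a1 | a1 <;>
      rcases le_total (1 - (α 0 + α r)) 0 with a2 | a2 <;>
      rcases le_total (1 + α 0 - α r) 0 with a3 | a3 <;>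
      rcases le_total (1 - (1 + α 0 - α r)) 0 with a4 | a4 <;>
      simp only [a1, a2, a3, a4, min_eq_left, min_eq_right] <;>
      split_ifs <;> first | linarith | grind
    · simp [hr]
  rw [slope, e0, key]
  ring

end

/-! ### The leading term of the weight -/

noncomputable section

variable {m n N : ℕ}

/-- The exponents of the nome in the arguments of `Δ_μ`. -/
def argExp (α : Fin (2 * m + 6) → ℝ) : Fin (2 * m + 6) → ℝ :=
  Fin.cons 0 fun r : Fin (2 * m + 5) => α 0 + α r.succ

/-- The arguments of `Δ_μ`, without the powers of the nome. -/
def argCoeff (n : ℕ) (x : Params m) : Fin (2 * m + 6) → ℂ :=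
  Fin.cons (x.t ^ n) fun r : Fin (2 * m + 5) => x.t ^ ((n : ℤ) - 1) * x.τ 0 * x.τ r.succ

/-- The leading coefficient of the weight as the product of the leading coefficients of its theta
functions. -/
def weightLc (n : ℕ) (α : Fin (2 * m + 6) → ℝ) (μ : Fin n → ℕ) (x : Params m) : ℂ :=
  DeltaLc (2 * α 0) (argExp α) μ (x.t ^ (2 * ((n : ℤ) - 1)) * x.τ 0 ^ 2) (argCoeff n x) x.q x.t

theorem scaledWeight_eq (α : Fin (2 * m + 6) → ℝ) (μ : Fin n → ℕ) (x : Params m) {p : ℂ}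
    (hp : p ≠ 0) :
    scaledWeight m n α μ x p = Delta μ (x.t ^ (2 * ((n : ℤ) - 1)) * x.τ 0 ^ 2 *
      p ^ ((2 * α 0 : ℝ) : ℂ)) (fun r => argCoeff n x r * p ^ (argExp α r : ℂ)) x.q x.t p := by
  unfold scaledWeight weight
  congr 1
  · push_cast
    rw [mul_pow, ← Complex.cpow_nat_mul]
    push_cast
    ring
  · ext r
    refine Fin.cases ?_ (fun r => ?_) r
    · simp [argCoeff, argExp]
    · simp only [argCoeff, argExp, Fin.cons_succ]
      push_cast
      rw [Complex.cpow_add _ _ hp]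
      ring

/-- The bound on the exponents in the nondegeneracy condition. It covers every monomial that occurs
in a factor of a denominator of a weight or of a transition rate; the exact value is immaterial. -/
def expBound (n N : ℕ) : ℕ := 4 * (n + N) + 4

theorem mem_boxPartitions {μ : Fin n → ℕ} :
    μ ∈ boxPartitions n N ↔ (∀ i, μ i ≤ N) ∧ Antitone μ := by
  simp [boxPartitions]

theorem conjPart_le {k : ℕ} (l : Fin k → ℕ) (j : ℕ) : conjPart l j ≤ k := by
  simpa [conjPart] using Finset.card_filter_le (Finset.univ : Finset (Fin k)) fun i => j ≤ l i

theorem lt_conjPart {k : ℕ} {l : Fin k → ℕ} (hl : Antitone l) {i : Fin k} {j : ℕ}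
    (hj : j ≤ l i) : (i : ℕ) < conjPart l j := by
  have h : Finset.Iic i ⊆ Finset.univ.filter fun i => j ≤ l i := by
    intro i' hi'
    simp only [Finset.mem_filter, Finset.mem_univ, true_and]
    exact hj.trans (hl (Finset.mem_Iic.1 hi'))
  have := Finset.card_le_card h
  rw [Fin.card_Iic] at this
  exact this

/-- A leading coefficient of a theta function vanishes only at the argument `1`; hence so does the
product over the boxes. -/
theorem C0Lc_ne_zero {β : ℝ} {k : ℕ} {l : Fin k → ℕ} {x q t : ℂ} (hq : q ≠ 0) (ht : t ≠ 0)
    (hx : x ≠ 0) (h : ∀ i : Fin k, ∀ j : ℕ, 1 ≤ j → j ≤ l i →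
      q ^ ((j : ℤ) - 1) * t ^ (1 - ((i : ℤ) + 1)) * x ≠ 1) : C0Lc β l x q t ≠ 0 :=
  Finset.prod_ne_zero_iff.2 fun i _ => Finset.prod_ne_zero_iff.2 fun j hj =>
    thetaLc_ne_zero (by positivity) (h i j (Finset.mem_Icc.1 hj).1 (Finset.mem_Icc.1 hj).2)

theorem CminusLc_ne_zero {β : ℝ} {k : ℕ} {l : Fin k → ℕ} {x q t : ℂ} (hq : q ≠ 0) (ht : t ≠ 0)
    (hx : x ≠ 0) (h : ∀ i : Fin k, ∀ j : ℕ, 1 ≤ j → j ≤ l i →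
      q ^ ((l i : ℤ) - j) * t ^ ((conjPart l j : ℤ) - ((i : ℤ) + 1)) * x ≠ 1) :
    CminusLc β l x q t ≠ 0 :=
  Finset.prod_ne_zero_iff.2 fun i _ => Finset.prod_ne_zero_iff.2 fun j hj =>
    thetaLc_ne_zero (by positivity) (h i j (Finset.mem_Icc.1 hj).1 (Finset.mem_Icc.1 hj).2)

theorem CplusLc_ne_zero {β : ℝ} {k : ℕ} {l : Fin k → ℕ} {x q t : ℂ} (hq : q ≠ 0) (ht : t ≠ 0)
    (hx : x ≠ 0) (h : ∀ i : Fin k, ∀ j : ℕ, 1 ≤ j → j ≤ l i →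
      q ^ ((l i : ℤ) + j - 1) * t ^ (2 - (conjPart l j : ℤ) - ((i : ℤ) + 1)) * x ≠ 1) :
    CplusLc β l x q t ≠ 0 :=
  Finset.prod_ne_zero_iff.2 fun i _ => Finset.prod_ne_zero_iff.2 fun j hj =>
    thetaLc_ne_zero (by positivity) (h i j (Finset.mem_Icc.1 hj).1 (Finset.mem_Icc.1 hj).2)

/-- The nonvanishing of all denominators of the leading coefficient of the weight. -/
structure DenominatorsNonzero (n : ℕ) (α : Fin (2 * m + 6) → ℝ) (μ : Fin n → ℕ) (x : Params m) :
    Prop where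
  zero : ∀ r, C0Lc (1 + 2 * α 0 - argExp α r) μ
    (x.q * (x.t ^ (2 * ((n : ℤ) - 1)) * x.τ 0 ^ 2) / argCoeff n x r) x.q x.t ≠ 0
  minus_q : CminusLc 1 μ x.q x.q x.t ≠ 0
  minus_t : CminusLc 0 μ x.t x.q x.t ≠ 0
  plus : CplusLc (2 * α 0) μ (x.t ^ (2 * ((n : ℤ) - 1)) * x.τ 0 ^ 2) x.q x.t ≠ 0
  plus_shift : CplusLc (1 + 2 * α 0) μ (x.q * (x.t ^ (2 * ((n : ℤ) - 1)) * x.τ 0 ^ 2) / x.t)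
    x.q x.t ≠ 0

theorem argCoeff_ne_zero {x : Params m} (hx : ∀ i, x i ≠ 0) (r : Fin (2 * m + 6)) :
    argCoeff n x r ≠ 0 := by
  refine Fin.cases ?_ (fun r => ?_) r
  · exact pow_ne_zero _ (hx _)
  · simp only [argCoeff, Fin.cons_succ]
    exact mul_ne_zero (mul_ne_zero (zpow_ne_zero _ (hx _)) (hx _)) (hx _)

/-- Each factor of a denominator is `1 - q^a t^b y` with `y` one of `1`, `t_0²`, `t_0 / t_r`; the
parameter `t_1` is eliminated by `t_0 t_1 = q^{-N} t^{1-n}`. -/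
theorem denominatorsNonzero (α : Fin (2 * m + 6) → ℝ) {μ : Fin n → ℕ}
    (hμ : μ ∈ boxPartitions n N) {x : Params m} (hx : x ∈ balanced m n N)
    (hnd : Nondegenerate (expBound n N) x) : DenominatorsNonzero n α μ x := by
  obtain ⟨hle, hanti⟩ := mem_boxPartitions.1 hμ
  obtain ⟨hx0, hb1, -⟩ := hx
  have hq : x.q ≠ 0 := hx0 _
  have ht : x.t ≠ 0 := hx0 _
  have hτ : ∀ r, x.τ r ≠ 0 := fun r => hx0 _
  refine ⟨fun r => ?_, ?_, ?_, ?_, ?_⟩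
  · refine C0Lc_ne_zero hq ht (div_ne_zero (mul_ne_zero hq
      (mul_ne_zero (zpow_ne_zero _ ht) (pow_ne_zero _ (hτ 0)))) (argCoeff_ne_zero hx0 r)) ?_
    intro i j hj1 hj2
    have := hle i
    have hi := i.isLt
    revert r
    intro r
    refine Fin.cases ?_ (fun r => ?_) r
    · have h := hnd.sq_ne (a := (j : ℤ)) (b := (n : ℤ) - 2 - i)
        (by rw [abs_le]; simp only [expBound]; push_cast; constructor <;> omega)
        (by rw [abs_le]; simp only [expBound]; push_cast; constructor <;> omega)
      convert h using 1
      simp only [argCoeff, Fin.cons_zero]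
      rw [zpow_sub₀ hq, zpow_sub₀ ht, zpow_add₀ ht, mul_sub, zpow_sub₀ ht, zpow_sub₀ ht,
        zpow_sub₀ ht, two_mul, zpow_add₀ ht]
      simp only [zpow_natCast, zpow_one, mul_one]
      field_simp
    · rcases eq_or_ne r 0 with rfl | hr
      · have h := hnd.sq_ne (a := (j : ℤ) + N) (b := 2 * (n : ℤ) - 2 - i)
          (by rw [abs_le]; simp only [expBound]; push_cast; constructor <;> omega)
          (by rw [abs_le]; simp only [expBound]; push_cast; constructor <;> omega)
        convert h using 1
        have hc : argCoeff n x (Fin.succ 0) = x.t ^ ((n : ℤ) - 1) * (x.τ 0 * x.τ 1) :=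
          mul_assoc _ _ _
        rw [hc, hb1, show (2 * (n : ℤ) - 2 - i) = 2 * ((n : ℤ) - 1) - i by ring, zpow_sub₀ hq, zpow_sub₀ ht,
          zpow_sub₀ ht, zpow_sub₀ ht, zpow_sub₀ ht, zpow_add₀ ht, zpow_add₀ hq, zpow_neg]
        simp only [zpow_natCast, zpow_one]
        field_simp
      · have h := hnd.div_ne (a := (j : ℤ)) (b := (n : ℤ) - 1 - i) (r := r.succ)
          (by rw [abs_le]; simp only [expBound]; push_cast; constructor <;> omega)
          (by rw [abs_le]; simp only [expBound]; push_cast; constructor <;> omega)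
          ((two_le_succ_iff r).2 hr)
        convert h using 1
        simp only [argCoeff, Fin.cons_succ]
        have := hτ r.succ
        have := hτ 0
        rw [zpow_sub₀ hq, zpow_sub₀ ht, zpow_sub₀ ht, zpow_add₀ ht, two_mul, zpow_add₀ ht]
        rw [zpow_sub₀ ht ((n : ℤ) - 1), zpow_sub₀ ht]
        simp only [zpow_natCast, zpow_one]
        field_simp
  · refine CminusLc_ne_zero hq ht hq fun i j hj1 hj2 => ?_
    have := hle i
    have hi := i.isLt
    have h1 := conjPart_le μ j
    have h2 := lt_conjPart hanti hj2
    have h := hnd.qt_ne (a := (μ i : ℤ) - j + 1) (b := (conjPart μ j : ℤ) - ((i : ℤ) + 1))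
        (by rw [abs_le]; simp only [expBound]; push_cast; constructor <;> omega)
        (by rw [abs_le]; simp only [expBound]; push_cast; constructor <;> omega) (by omega)
    convert h using 1
    rw [zpow_add₀ hq ((μ i : ℤ) - j), zpow_one]
    ring
  · refine CminusLc_ne_zero hq ht ht fun i j hj1 hj2 => ?_
    have := hle i
    have hi := i.isLt
    have h1 := conjPart_le μ j
    have h2 := lt_conjPart hanti hj2
    have h := hnd.qt_ne (a := (μ i : ℤ) - j) (b := (conjPart μ j : ℤ) - ((i : ℤ) + 1) + 1)
        (by rw [abs_le]; simp only [expBound]; push_cast; constructor <;> omega)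
        (by rw [abs_le]; simp only [expBound]; push_cast; constructor <;> omega) (by omega)
    convert h using 1
    rw [zpow_add₀ ht ((conjPart μ j : ℤ) - ((i : ℤ) + 1)), zpow_one]
    ring
  · refine CplusLc_ne_zero hq ht (mul_ne_zero (zpow_ne_zero _ ht) (pow_ne_zero _ (hτ 0)))
      fun i j hj1 hj2 => ?_
    have := hle i
    have hi := i.isLt
    have h1 := conjPart_le μ j
    have h := hnd.sq_ne (a := (μ i : ℤ) + j - 1)
        (b := 2 - (conjPart μ j : ℤ) - ((i : ℤ) + 1) + 2 * ((n : ℤ) - 1))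
        (by rw [abs_le]; simp only [expBound]; push_cast; constructor <;> omega)
        (by rw [abs_le]; simp only [expBound]; push_cast; constructor <;> omega)
    convert h using 1
    rw [zpow_add₀ ht (2 - (conjPart μ j : ℤ) - ((i : ℤ) + 1))]
    ring
  · refine CplusLc_ne_zero hq ht (div_ne_zero (mul_ne_zero hq (mul_ne_zero (zpow_ne_zero _ ht)
      (pow_ne_zero _ (hτ 0)))) ht) fun i j hj1 hj2 => ?_
    have := hle i
    have hi := i.isLt
    have h1 := conjPart_le μ j
    have h := hnd.sq_ne (a := (μ i : ℤ) + j - 1 + 1)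
        (b := 2 - (conjPart μ j : ℤ) - ((i : ℤ) + 1) + 2 * ((n : ℤ) - 1) - 1)
        (by rw [abs_le]; simp only [expBound]; push_cast; constructor <;> omega)
        (by rw [abs_le]; simp only [expBound]; push_cast; constructor <;> omega)
    convert h using 1
    rw [zpow_sub₀ ht _ 1, zpow_add₀ ht (2 - (conjPart μ j : ℤ) - ((i : ℤ) + 1)),
      zpow_add₀ hq ((μ i : ℤ) + j - 1), zpow_one, zpow_one]
    ring

theorem argExp_bounds {α : Fin (2 * m + 6) → ℝ} (h : InFundamentalDomain α)
    (r : Fin (2 * m + 6)) :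
    (-1 ≤ argExp α r ∧ argExp α r < 2) ∧
      -1 ≤ 1 + 2 * α 0 - argExp α r ∧ 1 + 2 * α 0 - argExp α r < 2 := by
  have h1 := h.lower
  have h2 := h.upper
  refine Fin.cases ?_ (fun r => ?_) r
  · simp only [argExp, Fin.cons_zero]
    refine ⟨⟨?_, ?_⟩, ?_, ?_⟩ <;> linarith
  · simp only [argExp, Fin.cons_succ]
    rcases eq_or_ne r 0 with rfl | hr
    · have h3 : α (Fin.succ 0) = -α 0 := h.one
      rw [h3]
      refine ⟨⟨?_, ?_⟩, ?_, ?_⟩ <;> linarith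
    · have hr' := (two_le_succ_iff r).2 hr
      have h3 := h.neg_half_le.trans (h.two_le_apply hr')
      have h4 := h.lt_three_halves hr'
      refine ⟨⟨?_, ?_⟩, ?_, ?_⟩ <;> linarith

theorem sum_thetaVal_eq_slope {α : Fin (2 * m + 6) → ℝ} (h : InFundamentalDomain α) :
    (∑ r, (thetaVal (argExp α r) - thetaVal (1 + 2 * α 0 - argExp α r))) - thetaVal (2 * α 0) =
      slope α := by
  have h1 := h.lower
  have h2 := h.upper
  have hv0 : thetaVal 0 = 0 := by simp [thetaVal]
  have hvA : thetaVal (1 + 2 * α 0) = 0 := by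
    rw [thetaVal, min_eq_right (by linarith), min_eq_left (by linarith)]; ring
  rw [slope_eq h, Fin.sum_univ_succ]
  simp only [argExp, Fin.cons_zero, Fin.cons_succ]
  rw [sum_succ_eq (g := fun r => thetaVal (α 0 + α r) - thetaVal (1 + 2 * α 0 - (α 0 + α r)))]
  simp only [h.one, add_neg_cancel, sub_zero, hv0, hvA, zero_add]
  congr 1
  refine Finset.sum_congr rfl fun r _ => ?_
  rw [show 1 + 2 * α 0 - (α 0 + α r) = 1 + α 0 - α r by ring]

/-- If the slope vanishes, the weight converges to the product of the leading coefficients of its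
theta functions, jointly in the nome and the parameters. -/
theorem tendsto_scaledWeight {α : Fin (2 * m + 6) → ℝ} (h : InFundamentalDomain α)
    (hslope : slope α = 0) {μ : Fin n → ℕ} (hμ : μ ∈ boxPartitions n N) {x₀ : Params m}
    (hx : x₀ ∈ balanced m n N) (hnd : Nondegenerate (expBound n N) x₀) (S : Set (Params m)) :
    Tendsto (fun z : ℂ × Params m => scaledWeight m n α μ z.2 z.1) (𝓝[≠] 0 ×ˢ 𝓝[S] x₀)
      (𝓝 (weightLc n α μ x₀)) := by
  obtain ⟨d1, d2, d3, d4, d5⟩ := denominatorsNonzero α hμ hx hnd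
  have hx0 := hx.1
  have hP : Tendsto (fun z : ℂ × Params m => z.1) (𝓝[≠] 0 ×ˢ 𝓝[S] x₀) (𝓝[≠] 0) := tendsto_fst
  have hPne := hP.eventually self_mem_nhdsWithin
  have hX : Tendsto (fun z : ℂ × Params m => z.2) (𝓝[≠] 0 ×ˢ 𝓝[S] x₀) (𝓝 x₀) :=
    tendsto_snd.mono_right nhdsWithin_le_nhds
  have hc : ∀ i, Tendsto (fun z : ℂ × Params m => z.2 i) (𝓝[≠] 0 ×ˢ 𝓝[S] x₀) (𝓝 (x₀ i)) :=
    fun i => ((continuous_apply i).tendsto x₀).comp hX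
  have hq : Tendsto (fun z : ℂ × Params m => z.2.q) (𝓝[≠] 0 ×ˢ 𝓝[S] x₀) (𝓝 x₀.q) := hc _
  have ht : Tendsto (fun z : ℂ × Params m => z.2.t) (𝓝[≠] 0 ×ˢ 𝓝[S] x₀) (𝓝 x₀.t) := hc _
  have hτ : ∀ r, Tendsto (fun z : ℂ × Params m => z.2.τ r) (𝓝[≠] 0 ×ˢ 𝓝[S] x₀) (𝓝 (x₀.τ r)) :=
    fun r => hc _
  have hb := argExp_bounds h
  have h1 := h.lower
  have h2 := h.upper
  have key := leadsTo_Delta hP μ hq ht (hx0 _) (hx0 _)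
    (a := fun z => z.2.t ^ (2 * ((n : ℤ) - 1)) * z.2.τ 0 ^ 2)
    ((ht.zpow₀ _ (Or.inl (hx0 _))).mul ((hτ 0).pow 2))
    (mul_ne_zero (zpow_ne_zero _ (hx0 _)) (pow_ne_zero _ (hx0 _)))
    (b := fun z => argCoeff n z.2) (b₀ := argCoeff n x₀)
    (by
      intro r
      refine Fin.cases ?_ (fun r => ?_) r
      · exact ht.pow n
      · exact ((ht.zpow₀ _ (Or.inl (hx0 _))).mul (hτ 0)).mul (hτ r.succ))
    (argCoeff_ne_zero hx0) (A := 2 * α 0) (B := argExp α) (by linarith) (by linarith)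
    (fun r => (hb r).1.1) (fun r => (hb r).1.2) (fun r => (hb r).2.1) (fun r => (hb r).2.2)
    d1 d2 d3 d4 d5
  rw [sum_thetaVal_eq_slope h, hslope, mul_zero] at key
  unfold LeadsTo at key
  refine key.congr' ?_
  filter_upwards [hPne] with z hz
  rw [scaledWeight_eq α μ z.2 hz]
  simp

theorem RationalOn.thetaLc {σ : Type} {S : Set (σ → ℂ)} {f : (σ → ℂ) → ℂ} (β : ℝ)
    (hf : RationalOn S f) (h0 : ∀ x ∈ S, f x ≠ 0) : RationalOn S fun x => thetaLc β (f x) := by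
  unfold EllipticSeries.thetaLc
  refine RationalOn.mul ?_ (hf.neg.zpow (fun x hx => neg_ne_zero.2 (h0 x hx)) _)
  split_ifs
  · exact hf.one_sub
  · exact .const 1

theorem rationalOn_prod_box_thetaLc {S : Set (Params m)} (hS : ∀ x ∈ S, ∀ i, x i ≠ 0)
    {f : Params m → ℂ} (hf : RationalOn S f) (h0 : ∀ x ∈ S, f x ≠ 0) (β : ℝ) {k : ℕ}
    (l : Fin k → ℕ) (a b : Fin k → ℕ → ℤ) :
    RationalOn S fun x : Params m => ∏ i, ∏ j ∈ Finset.Icc 1 (l i),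
      thetaLc β (x.q ^ a i j * x.t ^ b i j * f x) :=
  RationalOn.prod _ fun _ _ => RationalOn.prod _ fun _ _ => RationalOn.thetaLc β
    ((rationalOn_zpow_mul_zpow hS _ _).mul hf) fun x hx => mul_ne_zero
      (mul_ne_zero (zpow_ne_zero _ (hS x hx _)) (zpow_ne_zero _ (hS x hx _))) (h0 x hx)

theorem rationalOn_weightLc (α : Fin (2 * m + 6) → ℝ) {μ : Fin n → ℕ}
    (hμ : μ ∈ boxPartitions n N) :
    RationalOn {x ∈ balanced m n N | Nondegenerate (expBound n N) x} (weightLc n α μ) := by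
  have hden := fun x (hx : x ∈ {x ∈ balanced m n N | Nondegenerate (expBound n N) x}) =>
    denominatorsNonzero α hμ hx.1 hx.2
  have hS : ∀ x ∈ {x ∈ balanced m n N | Nondegenerate (expBound n N) x}, ∀ i, x i ≠ 0 :=
    fun x hx => hx.1.1
  generalize {x ∈ balanced m n N | Nondegenerate (expBound n N) x} = S at hS hden
  have ra : RationalOn S fun x : Params m => x.t ^ (2 * ((n : ℤ) - 1)) * x.τ 0 ^ 2 :=
    (rationalOn_t.zpow (fun x hx => hS x hx _) _).mul ((rationalOn_τ 0).pow 2)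
  have na : ∀ x ∈ S, x.t ^ (2 * ((n : ℤ) - 1)) * x.τ 0 ^ 2 ≠ 0 := fun x hx =>
    mul_ne_zero (zpow_ne_zero _ (hS x hx _)) (pow_ne_zero _ (hS x hx _))
  have rqa := rationalOn_q.mul ra
  have nqa : ∀ x ∈ S, x.q * (x.t ^ (2 * ((n : ℤ) - 1)) * x.τ 0 ^ 2) ≠ 0 := fun x hx =>
    mul_ne_zero (hS x hx _) (na x hx)
  have rb : ∀ r, RationalOn S fun x : Params m => argCoeff n x r := by
    intro r
    refine Fin.cases ?_ (fun r => ?_) r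
    · exact rationalOn_t.pow n
    · exact ((rationalOn_t.zpow (fun x hx => hS x hx _) _).mul (rationalOn_τ 0)).mul
        (rationalOn_τ r.succ)
  have nb : ∀ r, ∀ x ∈ S, argCoeff n x r ≠ 0 := fun r x hx => argCoeff_ne_zero (hS x hx) r
  refine RationalOn.mul (RationalOn.prod _ fun r _ => RationalOn.div ?_ ?_ ?_)
    (RationalOn.div ?_ (RationalOn.mul (RationalOn.mul ?_ ?_) (RationalOn.mul ?_ ?_)) ?_)
  · exact rationalOn_prod_box_thetaLc hS (rb r) (nb r) _ _ _ _
  · exact rationalOn_prod_box_thetaLc hS (rqa.div (rb r) (nb r))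
      (fun x hx => div_ne_zero (nqa x hx) (nb r x hx)) _ _ _ _
  · exact fun x hx => (hden x hx).zero r
  · exact rationalOn_prod_box_thetaLc hS rqa nqa _ _ _ _
  · exact rationalOn_prod_box_thetaLc hS rationalOn_q (fun x hx => hS x hx _) _ _ _ _
  · exact rationalOn_prod_box_thetaLc hS rationalOn_t (fun x hx => hS x hx _) _ _ _ _
  · exact rationalOn_prod_box_thetaLc hS ra na _ _ _ _
  · exact rationalOn_prod_box_thetaLc hS (rqa.div rationalOn_t fun x hx => hS x hx _)
      (fun x hx => div_ne_zero (nqa x hx) (hS x hx _)) _ _ _ _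
  · exact fun x hx => mul_ne_zero (mul_ne_zero (hden x hx).minus_q (hden x hx).minus_t)
      (mul_ne_zero (hden x hx).plus (hden x hx).plus_shift)

end


/-! ### Evaluation of the leading coefficient of the weight -/

noncomputable section

/-- The product of `-q^{j-1} t^{1-i} x` over the boxes `(i, j)` of `l`, that is, the highest term of
`C̃⁰_l(x)` as a polynomial in `x`. -/
def boxMonomial {k : ℕ} (l : Fin k → ℕ) (x q t : ℂ) : ℂ :=
  (-x) ^ size l * q ^ (nStatConj l : ℤ) * t ^ (-(nStat l : ℤ))

theorem boxMonomial_ne_zero {k : ℕ} (l : Fin k → ℕ) {x q t : ℂ} (hx : x ≠ 0) (hq : q ≠ 0)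
    (ht : t ≠ 0) : boxMonomial l x q t ≠ 0 :=
  mul_ne_zero (mul_ne_zero (pow_ne_zero _ (neg_ne_zero.2 hx)) (zpow_ne_zero _ hq))
    (zpow_ne_zero _ ht)

theorem C0Lc_of_neg {k : ℕ} (l : Fin k → ℕ) (x : ℂ) {q t : ℂ} (hq : q ≠ 0) (ht : t ≠ 0) {β : ℝ}
    (h1 : -1 ≤ β) (h2 : β < 0) :
    C0Lc β l x q t = (if β = -1 then qC0 l x q t else 1) * boxMonomial l x q t := by
  have hfl : ⌊β⌋ = -1 := by rw [Int.floor_eq_iff]; push_cast; constructor <;> linarith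
  have hfr : Int.fract β = β + 1 := by rw [Int.fract, hfl]; push_cast; ring
  rw [C0Lc_eq β l x hq ht, hfl, hfr, neg_neg, zpow_one, boxMonomial]
  simp only [add_eq_zero_iff_eq_neg]

theorem C0Lc_of_mem_Ico {k : ℕ} (l : Fin k → ℕ) (x : ℂ) {q t : ℂ} (hq : q ≠ 0) (ht : t ≠ 0) {β : ℝ}
    (h1 : 0 ≤ β) (h2 : β < 1) :
    C0Lc β l x q t = if β = 0 then qC0 l x q t else 1 := by
  have hfl : ⌊β⌋ = 0 := by rw [Int.floor_eq_iff]; push_cast; constructor <;> linarith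
  have hfr : Int.fract β = β := by rw [Int.fract, hfl]; push_cast; ring
  rw [C0Lc_eq β l x hq ht, hfl, hfr, neg_zero, zpow_zero, mul_one]

theorem C0Lc_of_one_le {k : ℕ} (l : Fin k → ℕ) (x : ℂ) {q t : ℂ} (hq : q ≠ 0) (ht : t ≠ 0) {β : ℝ}
    (h1 : 1 ≤ β) (h2 : β < 2) :
    C0Lc β l x q t = (if β = 1 then qC0 l x q t else 1) * (boxMonomial l x q t)⁻¹ := by
  have hfl : ⌊β⌋ = 1 := by rw [Int.floor_eq_iff]; push_cast; constructor <;> linarith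
  have hfr : Int.fract β = β - 1 := by rw [Int.fract, hfl]; push_cast; ring
  rw [C0Lc_eq β l x hq ht, hfl, hfr, zpow_neg, zpow_one, boxMonomial]
  simp only [sub_eq_zero]

variable {m n N : ℕ}

/-- The contribution of the parameter `t_r` to the leading coefficient of the weight. -/
def paramLc (n : ℕ) (α : Fin (2 * m + 6) → ℝ) (μ : Fin n → ℕ) (x : Params m)
    (r : Fin (2 * m + 6)) : ℂ :=
  C0Lc (α 0 + α r) μ (x.t ^ ((n : ℤ) - 1) * x.τ 0 * x.τ r) x.q x.t /
    C0Lc (1 + α 0 - α r) μ (x.q * x.t ^ ((n : ℤ) - 1) * x.τ 0 / x.τ r) x.q x.t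

/-- The contribution of `t_0` and `t_1` to the leading coefficient of the weight, apart from
`prefactor`. -/
def coreLc (n N : ℕ) (a : ℝ) (μ : Fin n → ℕ) (x : Params m) : ℂ :=
  ((-x.q) ^ size μ * x.q ^ (nStatConj μ : ℤ) * x.t ^ (nStat μ : ℤ)) *
    C0Lc (1 + 2 * a) (doubleSq μ) (x.q * x.t ^ (2 * ((n : ℤ) - 1)) * x.τ 0 ^ 2) x.q x.t /
      (C0Lc (1 + 2 * a) μ (x.q * x.t ^ ((n : ℤ) - 2) * x.τ 0 ^ 2) x.q x.t *
        C0Lc (1 + 2 * a) μ (x.q ^ (N + 1) * x.t ^ (2 * ((n : ℤ) - 1)) * x.τ 0 ^ 2) x.q x.t *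
        (CplusLc (2 * a) μ (x.t ^ (2 * ((n : ℤ) - 1)) * x.τ 0 ^ 2) x.q x.t *
          CplusLc (1 + 2 * a) μ (x.q * x.t ^ (2 * (n : ℤ) - 3) * x.τ 0 ^ 2) x.q x.t))

/-- The factor of `t^n`, the factor of `t_0 t_1 = q^{-N} t^{1-n}` and the factors not depending on
the parameters combine into `prefactor` and `coreLc`; every other parameter contributes its
`paramLc`. -/
theorem weightLc_eq {α : Fin (2 * m + 6) → ℝ} (h : InFundamentalDomain α) {μ : Fin n → ℕ}
    (hanti : Antitone μ) {x : Params m} (hx : x ∈ balanced m n N) :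
    weightLc n α μ x = prefactor n N μ x * coreLc n N (α 0) μ x *
      ∏ r with 2 ≤ r, paramLc n α μ x r := by
  obtain ⟨hx0, hb1, -⟩ := hx
  have hq : x.q ≠ 0 := hx0 _
  have ht : x.t ≠ 0 := hx0 _
  have hτ : ∀ r, x.τ r ≠ 0 := fun r => hx0 _
  have hb : x.t ^ ((n : ℤ) - 1) * x.τ 0 * x.τ 1 = x.q ^ (-(N : ℤ)) := by
    rw [mul_assoc, hb1, mul_left_comm, ← zpow_add₀ ht]
    simp
  have e0 : x.q * (x.t ^ (2 * ((n : ℤ) - 1)) * x.τ 0 ^ 2) / x.t ^ n =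
      x.q * x.t ^ ((n : ℤ) - 2) * x.τ 0 ^ 2 := by
    rw [show (n : ℤ) - 2 = 2 * ((n : ℤ) - 1) - n by ring, zpow_sub₀ ht, zpow_natCast]
    ring
  have e1 : x.q * (x.t ^ (2 * ((n : ℤ) - 1)) * x.τ 0 ^ 2) / x.q ^ (-(N : ℤ)) =
      x.q ^ (N + 1) * x.t ^ (2 * ((n : ℤ) - 1)) * x.τ 0 ^ 2 := by
    rw [zpow_neg, div_inv_eq_mul, zpow_natCast]
    ring
  have e2 : x.q * (x.t ^ (2 * ((n : ℤ) - 1)) * x.τ 0 ^ 2) / x.t =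
      x.q * x.t ^ (2 * (n : ℤ) - 3) * x.τ 0 ^ 2 := by
    rw [show 2 * (n : ℤ) - 3 = 2 * ((n : ℤ) - 1) - 1 by ring, zpow_sub₀ ht _ 1, zpow_one]
    ring
  have er : ∀ r, x.q * (x.t ^ (2 * ((n : ℤ) - 1)) * x.τ 0 ^ 2) /
      (x.t ^ ((n : ℤ) - 1) * x.τ 0 * x.τ r) = x.q * x.t ^ ((n : ℤ) - 1) * x.τ 0 / x.τ r := by
    intro r
    have := hτ 0
    have := hτ r
    have := zpow_ne_zero ((n : ℤ) - 1) ht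
    rw [two_mul, zpow_add₀ ht]
    field_simp
  have hprod : ∏ r, C0Lc (argExp α r) μ (argCoeff n x r) x.q x.t /
        C0Lc (1 + 2 * α 0 - argExp α r) μ
          (x.q * (x.t ^ (2 * ((n : ℤ) - 1)) * x.τ 0 ^ 2) / argCoeff n x r) x.q x.t =
      qC0 μ (x.t ^ n) x.q x.t /
        C0Lc (1 + 2 * α 0) μ (x.q * x.t ^ ((n : ℤ) - 2) * x.τ 0 ^ 2) x.q x.t *
      (qC0 μ (x.q ^ (-(N : ℤ))) x.q x.t /
        C0Lc (1 + 2 * α 0) μ (x.q ^ (N + 1) * x.t ^ (2 * ((n : ℤ) - 1)) * x.τ 0 ^ 2) x.q x.t *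
        ∏ r with 2 ≤ r, paramLc n α μ x r) := by
    rw [Fin.prod_univ_succ]
    simp only [argExp, argCoeff, Fin.cons_zero, Fin.cons_succ]
    rw [prod_succ_eq (g := fun r => C0Lc (α 0 + α r) μ (x.t ^ ((n : ℤ) - 1) * x.τ 0 * x.τ r) x.q x.t /
      C0Lc (1 + 2 * α 0 - (α 0 + α r)) μ (x.q * (x.t ^ (2 * ((n : ℤ) - 1)) * x.τ 0 ^ 2) /
        (x.t ^ ((n : ℤ) - 1) * x.τ 0 * x.τ r)) x.q x.t)]
    rw [e0, hb, e1, h.one, add_neg_cancel, sub_zero,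
      C0Lc_of_mem_Ico μ _ hq ht le_rfl one_pos, C0Lc_of_mem_Ico μ _ hq ht le_rfl one_pos,
      if_pos rfl, if_pos rfl]
    congr 2
    refine Finset.prod_congr rfl fun r _ => ?_
    rw [er, paramLc, show 1 + 2 * α 0 - (α 0 + α r) = 1 + α 0 - α r by ring]
  have hm1 : CminusLc 1 μ x.q x.q x.t = qCminus μ x.q x.q x.t *
      ((-x.q) ^ size μ * x.q ^ (nStatConj μ : ℤ) * x.t ^ (nStat μ : ℤ))⁻¹ := by
    rw [CminusLc_eq 1 hanti _ hq ht]
    simp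
  have hm0 : CminusLc 0 μ x.t x.q x.t = qCminus μ x.t x.q x.t := by
    rw [CminusLc_eq 0 hanti _ hq ht]
    simp
  rw [weightLc, DeltaLc, hprod, e2, hm1, hm0, ← mul_assoc x.q, prefactor, coreLc]
  simp only [div_eq_mul_inv, mul_inv, inv_inv]
  ring

/-- The monomial part of `coreLc` for `-1/2 ≤ α_0 < 0`. -/
def coreMonomial (n : ℕ) (μ : Fin n → ℕ) (x : Params m) : ℂ :=
  ((x.t ^ (2 * ((n : ℤ) - 1)) * x.τ 0 ^ 2) ^ size μ)⁻¹ * x.q ^ (-2 * (nStatConj μ : ℤ)) *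
    x.t ^ (4 * (nStat μ : ℤ))

section

variable {μ : Fin n → ℕ} {x : Params m}

theorem div_plusMonomial (hx : ∀ i, x i ≠ 0) :
    ((-x.q) ^ size μ * x.q ^ (nStatConj μ : ℤ) * x.t ^ (nStat μ : ℤ)) /
      ((-(x.t ^ (2 * ((n : ℤ) - 1)) * x.τ 0 ^ 2)) ^ size μ *
        x.q ^ (3 * (nStatConj μ : ℤ) + size μ) * x.t ^ (-3 * (nStat μ : ℤ))) =
      coreMonomial n μ x := by
  have hq : x.q ≠ 0 := hx _
  have ht : x.t ≠ 0 := hx _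
  have hτ : x.τ 0 ≠ 0 := hx _
  have ha : x.t ^ (2 * ((n : ℤ) - 1)) * x.τ 0 ^ 2 ≠ 0 :=
    mul_ne_zero (zpow_ne_zero _ ht) (pow_ne_zero _ hτ)
  unfold coreMonomial
  generalize x.t ^ (2 * ((n : ℤ) - 1)) * x.τ 0 ^ 2 = a at *
  rw [neg_pow, neg_pow a, zpow_add₀ hq, zpow_natCast _ (size μ),
    show -2 * (nStatConj μ : ℤ) = nStatConj μ - 3 * (nStatConj μ : ℤ) by ring, zpow_sub₀ hq,
    show 4 * (nStat μ : ℤ) = nStat μ - (-3 * (nStat μ : ℤ)) by ring, zpow_sub₀ ht]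
  have h1 := zpow_ne_zero (3 * (nStatConj μ : ℤ)) hq
  have h2 := zpow_ne_zero (-3 * (nStat μ : ℤ)) ht
  have h3 : ((-1 : ℂ)) ^ size μ ≠ 0 := pow_ne_zero _ (by norm_num)
  field_simp

theorem coreLc_middle (hx : ∀ i, x i ≠ 0) (hanti : Antitone μ) {a : ℝ} (h1 : -(1 / 2) < a)
    (h2 : a < 0) : coreLc n N a μ x = coreMonomial n μ x := by
  have hq : x.q ≠ 0 := hx _
  have ht : x.t ≠ 0 := hx _
  have e1 : 0 ≤ 1 + 2 * a := by linarith
  have e2 : 1 + 2 * a < 1 := by linarith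
  have e3 : 1 + 2 * a ≠ 0 := by linarith
  have hfl : ⌊2 * a⌋ = -1 := by rw [Int.floor_eq_iff]; push_cast; constructor <;> linarith
  have hfr : Int.fract (2 * a) ≠ 0 := by rw [Int.fract, hfl]; push_cast; linarith
  have hfl' : ⌊1 + 2 * a⌋ = 0 := by rw [Int.floor_eq_iff]; push_cast; constructor <;> linarith
  have hfr' : Int.fract (1 + 2 * a) ≠ 0 := by rw [Int.fract, hfl']; push_cast; linarith
  rw [coreLc, CplusLc_eq _ hanti _ hq ht, CplusLc_eq _ hanti _ hq ht, hfl, hfl', if_neg hfr,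
    if_neg hfr']
  simp only [C0Lc_of_mem_Ico _ _ hq ht e1 e2, if_neg e3, neg_neg, zpow_one, neg_zero, zpow_zero,
    mul_one, one_mul]
  exact div_plusMonomial hx

theorem coreLc_half (hx : ∀ i, x i ≠ 0) (hanti : Antitone μ) :
    coreLc n N (-(1 / 2)) μ x = wellPoisedFactor n N μ x * coreMonomial n μ x := by
  have hq : x.q ≠ 0 := hx _
  have ht : x.t ≠ 0 := hx _
  have e1 : (1 + 2 * (-(1 / 2)) : ℝ) = 0 := by norm_num
  have e2 : (2 * (-(1 / 2)) : ℝ) = -1 := by norm_num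
  have e3 : ⌊(-1 : ℝ)⌋ = -1 := by simpa using Int.floor_intCast (R := ℝ) (-1)
  have e4 : Int.fract (-1 : ℝ) = 0 := by rw [Int.fract, e3]; simp
  rw [coreLc, e1, e2, CplusLc_eq _ hanti _ hq ht, CplusLc_eq _ hanti _ hq ht,
    ← div_plusMonomial hx, wellPoisedFactor]
  simp only [C0Lc_of_mem_Ico _ _ hq ht le_rfl one_pos, Int.fract_zero, if_true, Int.floor_zero,
    e3, e4]
  simp only [neg_neg, zpow_one, neg_zero, zpow_zero, mul_one]
  ring

theorem coreLc_zero (hx : ∀ i, x i ≠ 0) (hanti : Antitone μ) :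
    coreLc n N 0 μ x = wellPoisedFactor n N μ x *
      ((x.q ^ ((N : ℤ) - 1) * x.t ^ (-3 * ((n : ℤ) - 1)) * x.τ 0 ^ (-2 : ℤ)) ^ size μ *
        x.q ^ (-2 * (nStatConj μ : ℤ)) * x.t ^ (4 * nStat μ)) := by
  have hq : x.q ≠ 0 := hx _
  have ht : x.t ≠ 0 := hx _
  have hτ : x.τ 0 ≠ 0 := hx _
  have e1 : (1 + 2 * 0 : ℝ) = 1 := by norm_num
  have e2 : (2 * 0 : ℝ) = 0 := by norm_num
  rw [coreLc, e1, e2, CplusLc_eq _ hanti _ hq ht, CplusLc_eq _ hanti _ hq ht, wellPoisedFactor]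
  simp only [C0Lc_of_one_le _ _ hq ht le_rfl (one_lt_two), Int.fract_zero, if_true, Int.floor_zero,
    Int.fract_one, Int.floor_one, zpow_neg_one]
  simp only [neg_zero, zpow_zero, mul_one]
  have key : ((-x.q) ^ size μ * x.q ^ (nStatConj μ : ℤ) * x.t ^ (nStat μ : ℤ)) *
      boxMonomial μ (x.q * x.t ^ ((n : ℤ) - 2) * x.τ 0 ^ 2) x.q x.t *
      boxMonomial μ (x.q ^ (N + 1) * x.t ^ (2 * ((n : ℤ) - 1)) * x.τ 0 ^ 2) x.q x.t *
      ((-(x.q * x.t ^ (2 * (n : ℤ) - 3) * x.τ 0 ^ 2)) ^ size μ *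
        x.q ^ (3 * (nStatConj μ : ℤ) + size μ) * x.t ^ (-3 * (nStat μ : ℤ))) *
      (boxMonomial (doubleSq μ) (x.q * x.t ^ (2 * ((n : ℤ) - 1)) * x.τ 0 ^ 2) x.q x.t)⁻¹ =
      (x.q ^ ((N : ℤ) - 1) * x.t ^ (-3 * ((n : ℤ) - 1)) * x.τ 0 ^ (-2 : ℤ)) ^ size μ *
        x.q ^ (-2 * (nStatConj μ : ℤ)) * x.t ^ (4 * nStat μ) := by
    have base : (-x.q) * (-(x.q * x.t ^ ((n : ℤ) - 2) * x.τ 0 ^ 2)) *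
        (-(x.q ^ (N + 1) * x.t ^ (2 * ((n : ℤ) - 1)) * x.τ 0 ^ 2)) *
        (-(x.q * x.t ^ (2 * (n : ℤ) - 3) * x.τ 0 ^ 2)) * x.q *
        ((-(x.q * x.t ^ (2 * ((n : ℤ) - 1)) * x.τ 0 ^ 2)) ^ 4 * x.q ^ 2 * (x.t ^ 2)⁻¹)⁻¹ =
        x.q ^ ((N : ℤ) - 1) * x.t ^ (-3 * ((n : ℤ) - 1)) * x.τ 0 ^ (-2 : ℤ) := by
      rw [show (n : ℤ) - 2 = ((n : ℤ) - 1) - 1 by ring,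
        show 2 * (n : ℤ) - 3 = 2 * ((n : ℤ) - 1) - 1 by ring,
        show -3 * ((n : ℤ) - 1) = -(((n : ℤ) - 1) + 2 * ((n : ℤ) - 1)) by ring]
      rw [zpow_neg, zpow_add₀ ht, zpow_sub₀ ht _ 1, zpow_sub₀ ht (2 * ((n : ℤ) - 1)) 1,
        zpow_sub₀ hq, two_mul ((n : ℤ) - 1), zpow_add₀ ht, zpow_neg]
      simp only [zpow_natCast, zpow_ofNat]
      have hT := zpow_ne_zero ((n : ℤ) - 1) ht
      generalize x.t ^ ((n : ℤ) - 1) = T at *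
      field_simp
      ring
    rw [← base]
    simp only [boxMonomial, size_doubleSq, nStat_doubleSq, nStatConj_doubleSq]
    have c1 : x.q ^ (((8 * nStatConj μ + 2 * size μ : ℕ)) : ℤ) =
        (x.q ^ (nStatConj μ : ℤ)) ^ 8 * (x.q ^ 2) ^ size μ := by
      rw [zpow_natCast, zpow_natCast]; ring
    have c2 : x.t ^ (-((8 * nStat μ + 2 * size μ : ℕ) : ℤ)) =
        ((x.t ^ (nStat μ : ℤ)) ^ 8)⁻¹ * ((x.t ^ 2)⁻¹) ^ size μ := by
      rw [zpow_neg, zpow_natCast, zpow_natCast, inv_pow, ← mul_inv]; ring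
    have c3 : x.q ^ (3 * (nStatConj μ : ℤ) + size μ) =
        (x.q ^ (nStatConj μ : ℤ)) ^ 3 * x.q ^ size μ := by
      rw [zpow_add₀ hq, mul_comm (3 : ℤ), zpow_mul]; simp only [zpow_natCast, zpow_ofNat]
    have c4 : x.t ^ (-3 * (nStat μ : ℤ)) = ((x.t ^ (nStat μ : ℤ)) ^ 3)⁻¹ := by
      rw [neg_mul, zpow_neg, mul_comm, zpow_mul]; simp only [zpow_natCast, zpow_ofNat]
    have c5 : x.q ^ (-2 * (nStatConj μ : ℤ)) = ((x.q ^ (nStatConj μ : ℤ)) ^ 2)⁻¹ := by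
      rw [neg_mul, zpow_neg, mul_comm, zpow_mul]; simp only [zpow_natCast, zpow_ofNat]
    have c6 : x.t ^ (4 * nStat μ) = (x.t ^ (nStat μ : ℤ)) ^ 4 := by
      rw [zpow_natCast]; ring
    have hT := zpow_ne_zero (nStat μ : ℤ) ht
    have hQ := zpow_ne_zero (nStatConj μ : ℤ) hq
    rw [c1, c2, c3, c4, c5, c6, zpow_neg, pow_mul (-(x.q * x.t ^ (2 * ((n : ℤ) - 1)) * x.τ 0 ^ 2)) 4]
    generalize x.t ^ (nStat μ : ℤ) = T at *
    generalize x.q ^ (nStatConj μ : ℤ) = Q at *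
    generalize -(x.q * x.t ^ (2 * ((n : ℤ) - 1)) * x.τ 0 ^ 2) = u1
    generalize -(x.q * x.t ^ ((n : ℤ) - 2) * x.τ 0 ^ 2) = u2
    generalize -(x.q ^ (N + 1) * x.t ^ (2 * ((n : ℤ) - 1)) * x.τ 0 ^ 2) = u3
    generalize -(x.q * x.t ^ (2 * (n : ℤ) - 3) * x.τ 0 ^ 2) = u4
    generalize -x.q = u5
    generalize x.q ^ 2 = u6
    generalize (x.t ^ 2)⁻¹ = u7
    generalize u1 ^ 4 = u1
    simp only [mul_pow, inv_pow, mul_inv, inv_inv]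
    field_simp
  rw [← key]
  simp only [div_eq_mul_inv, mul_inv, inv_inv]
  ring

end

end


/-! ### Consequences of the vanishing of the slope -/

section

variable {m : ℕ} {α : Fin (2 * m + 6) → ℝ}

theorem mem_two_le_iff (r : Fin (2 * m + 6)) :
    r ∈ Finset.univ.filter (fun r : Fin (2 * m + 6) => 2 ≤ r) ↔ 2 ≤ r := by simp

theorem three_le_iff_ne {r : Fin (2 * m + 6)} : 3 ≤ r ↔ 2 ≤ r ∧ r ≠ 2 := by
  have h2 : ((2 : Fin (2 * m + 6)) : ℕ) = 2 :=
    Nat.mod_eq_of_lt (a := 2) (b := 2 * m + 6) (by omega)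
  rw [three_le_iff, two_le_iff, Ne, Fin.ext_iff, h2]
  omega

theorem filter_two_le_eq_insert :
    (Finset.univ.filter fun r : Fin (2 * m + 6) => 2 ≤ r) =
      insert 2 (Finset.univ.filter fun r : Fin (2 * m + 6) => 3 ≤ r) := by
  ext r
  simp only [Finset.mem_filter, Finset.mem_univ, true_and, Finset.mem_insert, three_le_iff_ne]
  constructor
  · intro h; by_cases hr : r = 2 <;> simp [hr, h]
  · rintro (rfl | h)
    · exact le_rfl
    · exact h.1

theorem prod_two_le_eq {M : Type*} [CommMonoid M] (g : Fin (2 * m + 6) → M) :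
    ∏ r with 2 ≤ r, g r = g 2 * ∏ r with 3 ≤ r, g r := by
  rw [filter_two_le_eq_insert, Finset.prod_insert (by simp [three_le_iff_ne])]

theorem sum_two_le_eq (g : Fin (2 * m + 6) → ℝ) :
    ∑ r with 2 ≤ r, g r = g 2 + ∑ r with 3 ≤ r, g r :=
  prod_two_le_eq (M := Multiplicative ℝ) g

/-- If `α_2 ≤ α_0 < 0`, the parameter `t_2` alone accounts for the vanishing of the slope. -/
theorem neg_le_of_slope_eq_zero (h : InFundamentalDomain α) (hs : slope α = 0) (h0 : α 0 < 0)
    (h2 : α 2 ≤ α 0) {r : Fin (2 * m + 6)} (hr : 3 ≤ r) : -α 0 ≤ α r := by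
  have hl := h.lower
  have hneg : ∀ s ∈ Finset.univ.filter fun r : Fin (2 * m + 6) => 3 ≤ r,
      thetaVal (α 0 + α s) - thetaVal (1 + α 0 - α s) ≤ 0 := by
    intro s hs'
    have hs' : 3 ≤ s := by simpa using hs'
    have h3 := h.apply_le (three_le_iff_ne.1 hs').1
    simp only [thetaVal]
    rcases le_total (α 0 + α s) 0 with a1 | a1 <;>
    rcases le_total (1 - (α 0 + α s)) 0 with a2 | a2 <;>
    rcases le_total (1 + α 0 - α s) 0 with a3 | a3 <;>
    rcases le_total (1 - (1 + α 0 - α s)) 0 with a4 | a4 <;>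
    simp only [a1, a2, a3, a4, min_eq_left, min_eq_right] <;> linarith
  have e0 : thetaVal (2 * α 0) = 2 * α 0 := by
    rw [thetaVal, min_eq_left (by linarith), min_eq_left (by linarith), add_zero]
  have e2 : thetaVal (α 0 + α 2) - thetaVal (1 + α 0 - α 2) = 2 * α 0 := by
    rw [thetaVal, thetaVal, min_eq_left (by linarith), min_eq_left (by linarith),
      min_eq_right (by linarith [h.two_le_apply le_rfl]), min_eq_right (by linarith)]
    ring
  rw [slope_eq h, sum_two_le_eq, e0, e2, add_sub_cancel_left] at hs
  have hz := (Finset.sum_eq_zero_iff_of_nonpos hneg).1 hs r (by simpa using hr)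
  by_contra hlt
  push Not at hlt
  simp only [thetaVal] at hz
  revert hz
  rcases le_total (1 - (1 + α 0 - α r)) 0 with a4 | a4 <;>
  simp only [a4, min_eq_left, min_eq_right, min_eq_left (show α 0 + α r ≤ 0 by linarith),
    min_eq_left (show 0 ≤ 1 - (α 0 + α r) by linarith),
    min_eq_right (show 0 ≤ 1 + α 0 - α r by linarith)] <;>
  intro hz <;> linarith

/-- If `α_0 < 0`, some negative contribution to the slope is needed. -/
theorem two_lt_neg_of_slope_eq_zero (h : InFundamentalDomain α) (hs : slope α = 0) (h0 : α 0 < 0) :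
    α 2 < -α 0 := by
  by_contra hge
  push Not at hge
  have hpos : 0 ≤ ∑ s with 2 ≤ s, (thetaVal (α 0 + α s) - thetaVal (1 + α 0 - α s)) := by
    refine Finset.sum_nonneg fun s hs' => ?_
    have h3 := h.two_le_apply ((mem_two_le_iff s).1 hs')
    simp only [thetaVal]
    rcases le_total (α 0 + α s) 0 with a1 | a1 <;>
    rcases le_total (1 - (α 0 + α s)) 0 with a2 | a2 <;>
    rcases le_total (1 + α 0 - α s) 0 with a3 | a3 <;>
    rcases le_total (1 - (1 + α 0 - α s)) 0 with a4 | a4 <;>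
    simp only [a1, a2, a3, a4, min_eq_left, min_eq_right] <;> linarith
  have e0 : thetaVal (2 * α 0) = 2 * α 0 := by
    rw [thetaVal, min_eq_left (by linarith), min_eq_left (by linarith [h.lower]), add_zero]
  rw [slope_eq h, e0] at hs
  linarith

/-- Here the lower bound of `neg_le_of_slope_eq_zero` coincides with the upper bound `α_2 + 1`. -/
theorem half_of_slope_eq_zero (h : InFundamentalDomain α) (hs : slope α = 0) (h0 : α 0 = -(1 / 2))
    (h2 : α 2 = -(1 / 2)) {r : Fin (2 * m + 6)} (hr : 3 ≤ r) : α r = 1 / 2 := by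
  have h3 := neg_le_of_slope_eq_zero h hs (by linarith) (by linarith) hr
  have h4 := h.apply_le (three_le_iff_ne.1 hr).1
  linarith

end

/-! ### The five explicit forms of the leading coefficient -/

section

variable {m n N : ℕ} {α : Fin (2 * m + 6) → ℝ} {μ : Fin n → ℕ} {x : Params m}

/-- The product of the box monomials of `numFactor` and `denFactor`, which does not depend on the
parameter. -/
noncomputable def pairMonomial (n : ℕ) (μ : Fin n → ℕ) (x : Params m) : ℂ :=
  (x.q * x.t ^ (2 * ((n : ℤ) - 1)) * x.τ 0 ^ 2) ^ size μ * x.q ^ (2 * nStatConj μ) *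
    x.t ^ (-2 * (nStat μ : ℤ))

theorem pairMonomial_ne_zero (hx : ∀ i, x i ≠ 0) : pairMonomial n μ x ≠ 0 :=
  mul_ne_zero (mul_ne_zero (pow_ne_zero _ (mul_ne_zero (mul_ne_zero (hx _) (zpow_ne_zero _ (hx _)))
    (pow_ne_zero _ (hx _)))) (pow_ne_zero _ (hx _))) (zpow_ne_zero _ (hx _))

theorem boxMonomial_mul (hx : ∀ i, x i ≠ 0) (r : Fin (2 * m + 6)) :
    boxMonomial μ (x.t ^ ((n : ℤ) - 1) * x.τ 0 * x.τ r) x.q x.t *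
      boxMonomial μ (x.q * x.t ^ ((n : ℤ) - 1) * x.τ 0 / x.τ r) x.q x.t = pairMonomial n μ x := by
  have ht : x.t ≠ 0 := hx _
  have hr : x.τ r ≠ 0 := hx _
  have h1 : x.q * x.t ^ (2 * ((n : ℤ) - 1)) * x.τ 0 ^ 2 =
      (-(x.t ^ ((n : ℤ) - 1) * x.τ 0 * x.τ r)) *
        (-(x.q * x.t ^ ((n : ℤ) - 1) * x.τ 0 / x.τ r)) := by
    rw [two_mul ((n : ℤ) - 1), zpow_add₀ ht]; field_simp
  rw [boxMonomial, boxMonomial, pairMonomial, h1, mul_pow, zpow_natCast,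
    show -2 * (nStat μ : ℤ) = -(nStat μ : ℤ) + -(nStat μ : ℤ) by ring, zpow_add₀ ht]
  ring

theorem lcZero_eq (hx : ∀ i, x i ≠ 0) (h : InFundamentalDomain α) (h0 : α 0 = 0)
    (hanti : Antitone μ) :
    lcZero n N α μ x = prefactor n N μ x * coreLc n N (α 0) μ x *
      ∏ r with 2 ≤ r, paramLc n α μ x r := by
  have hq : x.q ≠ 0 := hx _
  have ht : x.t ≠ 0 := hx _
  have hZ := pairMonomial_ne_zero (n := n) (μ := μ) hx
  have hZA : (pairMonomial n μ x) ^ ((numA α : ℤ) - numB α) =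
      (∏ r with 2 ≤ r, if α r < 0 then pairMonomial n μ x else 1) *
        ∏ r with 2 ≤ r, if 1 < α r then (pairMonomial n μ x)⁻¹ else 1 := by
    simp only [← Finset.prod_filter, Finset.filter_filter, Finset.prod_const, numA, numB, h0,
      neg_zero, add_zero]
    rw [zpow_sub₀ hZ, zpow_natCast, zpow_natCast, inv_pow, div_eq_mul_inv]
  have hR : ∀ r ∈ Finset.univ.filter fun r : Fin (2 * m + 6) => 2 ≤ r, paramLc n α μ x r =
      ((if α r < 0 then pairMonomial n μ x else 1) * if 1 < α r then (pairMonomial n μ x)⁻¹ else 1) *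
      ((if α r = 0 then (numFactor n μ x r / denFactor n μ x r *
        (-(x.q * x.t ^ ((n : ℤ) - 1) * x.τ 0 / x.τ r)) ^ size μ * x.q ^ nStatConj μ *
        x.t ^ (-(nStat μ : ℤ))) else 1) *
      if α r = 1 then (numFactor n μ x r / denFactor n μ x r *
        (-(1 / (x.t ^ ((n : ℤ) - 1) * x.τ 0 * x.τ r))) ^ size μ * x.q ^ (-(nStatConj μ : ℤ)) *
        x.t ^ nStat μ) else 1) := by
    intro r hr
    have hr := (mem_two_le_iff r).1 hr
    have b1 := h.neg_half_le.trans (h.two_le_apply hr)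
    have b2 := h.lt_three_halves hr
    have hm := boxMonomial_mul (μ := μ) hx r
    rw [paramLc, h0, zero_add, add_zero, ← hm, numFactor, denFactor]
    rcases lt_or_ge (α r) 0 with c1 | c1
    · rw [C0Lc_of_neg _ _ hq ht (by linarith) c1, C0Lc_of_one_le _ _ hq ht (by linarith) (by linarith),
        if_neg (by linarith), if_neg (by linarith), if_pos c1, if_neg (by linarith),
        if_neg (by linarith), if_neg (by linarith)]
      simp
    rcases eq_or_ne (α r) 0 with c2 | c2
    · rw [c2, sub_zero, C0Lc_of_mem_Ico _ _ hq ht le_rfl one_pos,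
        C0Lc_of_one_le _ _ hq ht le_rfl one_lt_two]
      simp only [if_true, lt_irrefl, if_false, not_lt.2 zero_le_one, zero_ne_one, one_mul, mul_one]
      rw [boxMonomial, zpow_natCast, div_eq_mul_inv, mul_inv, inv_inv, div_eq_mul_inv]
      ring
    rcases lt_or_ge (α r) 1 with c3 | c3
    · have c1' := lt_of_le_of_ne c1 c2.symm
      rw [C0Lc_of_mem_Ico _ _ hq ht c1 c3, C0Lc_of_mem_Ico _ _ hq ht (by linarith) (by linarith),
        if_neg c2, if_neg (by linarith), if_neg (by linarith), if_neg (by linarith),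
        if_neg c2, if_neg (by linarith)]
      simp
    rcases eq_or_ne (α r) 1 with c4 | c4
    · rw [c4, sub_self, C0Lc_of_mem_Ico _ _ hq ht le_rfl one_pos,
        C0Lc_of_one_le _ _ hq ht le_rfl one_lt_two]
      simp only [if_true, lt_irrefl, if_false, not_lt.2 zero_le_one, one_ne_zero, one_mul]
      rw [boxMonomial, mul_inv, mul_inv, ← inv_pow, zpow_neg, inv_inv, inv_neg, one_div, zpow_neg,
        zpow_natCast, zpow_natCast]
      ring
    · have c3' := lt_of_le_of_ne c3 c4.symm
      rw [C0Lc_of_one_le _ _ hq ht c3 (by linarith), C0Lc_of_neg _ _ hq ht (by linarith) (by linarith),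
        if_neg c4, if_neg (by linarith), if_neg (by linarith), if_pos c3',
        if_neg c2, if_neg c4, mul_inv]
      simp only [one_mul, mul_one, div_eq_mul_inv]
  rw [Finset.prod_congr rfl hR, Finset.prod_mul_distrib, Finset.prod_mul_distrib, ← hZA,
    Finset.prod_mul_distrib, h0, coreLc_zero hx hanti]
  simp only [← Finset.prod_filter, Finset.filter_filter]
  rw [lcZero, pairMonomial]
  ring

theorem coreMonomial_mul_pairMonomial (hx : ∀ i, x i ≠ 0) :
    coreMonomial n μ x * pairMonomial n μ x = x.t ^ (2 * nStat μ) * x.q ^ size μ := by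
  have hq : x.q ≠ 0 := hx _
  have ht : x.t ≠ 0 := hx _
  have hτ : x.τ 0 ≠ 0 := hx _
  have ha : x.t ^ (2 * ((n : ℤ) - 1)) * x.τ 0 ^ 2 ≠ 0 :=
    mul_ne_zero (zpow_ne_zero _ ht) (pow_ne_zero _ hτ)
  rw [coreMonomial, pairMonomial, mul_assoc x.q]
  generalize x.t ^ (2 * ((n : ℤ) - 1)) * x.τ 0 ^ 2 = a at *
  have c1 : x.q ^ (-2 * (nStatConj μ : ℤ)) = (x.q ^ (2 * nStatConj μ))⁻¹ := by
    rw [← zpow_natCast, ← zpow_neg]; push_cast; ring_nf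
  have c2 : x.t ^ (4 * (nStat μ : ℤ)) * x.t ^ (-2 * (nStat μ : ℤ)) = x.t ^ (2 * nStat μ) := by
    rw [← zpow_add₀ ht, ← zpow_natCast]; push_cast; ring_nf
  rw [c1, ← c2, mul_pow]
  have h2 := pow_ne_zero (2 * nStatConj μ) hq
  field_simp

theorem lcMiddleLow_eq (hx : ∀ i, x i ≠ 0) (h : InFundamentalDomain α) (hs : slope α = 0)
    (h0 : α 0 < 0) (h0' : -(1 / 2) < α 0) (h2 : α 2 ≤ α 0) (hanti : Antitone μ) :
    lcMiddleLow n N α μ x = prefactor n N μ x * coreLc n N (α 0) μ x *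
      ∏ r with 2 ≤ r, paramLc n α μ x r := by
  have hq : x.q ≠ 0 := hx _
  have ht : x.t ≠ 0 := hx _
  have hb := h.neg_half_le
  have hR : ∀ r ∈ Finset.univ.filter fun r : Fin (2 * m + 6) => 3 ≤ r, paramLc n α μ x r =
      (if α r = -α 0 then numFactor n μ x r else 1) /
        if α r = 1 + α 0 then denFactor n μ x r else 1 := by
    intro r hr
    have hr : 3 ≤ r := by simpa using hr
    have b1 := neg_le_of_slope_eq_zero h hs h0 h2 hr
    have b2 := h.apply_le (three_le_iff_ne.1 hr).1
    rw [paramLc, C0Lc_of_mem_Ico _ _ hq ht (by linarith) (by linarith),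
      C0Lc_of_mem_Ico _ _ hq ht (by linarith) (by linarith), numFactor, denFactor]
    have e1 : α 0 + α r = 0 ↔ α r = -α 0 := by constructor <;> intro <;> linarith
    have e2 : 1 + α 0 - α r = 0 ↔ α r = 1 + α 0 := by constructor <;> intro <;> linarith
    simp only [e1, e2]
  have hR2 : paramLc n α μ x 2 =
      (if α 2 = α 0 then 1 / denFactor n μ x 2 else 1) * pairMonomial n μ x := by
    have e2 : 1 + α 0 - α 2 = 1 ↔ α 2 = α 0 := by constructor <;> intro <;> linarith
    rw [paramLc, C0Lc_of_neg _ _ hq ht (by linarith) (by linarith),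
      C0Lc_of_one_le _ _ hq ht (by linarith) (by linarith), if_neg (by linarith),
      ← boxMonomial_mul hx 2, denFactor]
    simp only [e2]
    split_ifs
    · rw [div_eq_mul_inv, mul_inv, inv_inv]; ring
    · simp
  rw [prod_two_le_eq, Finset.prod_congr rfl hR, hR2, Finset.prod_div_distrib,
    coreLc_middle hx hanti h0' h0]
  simp only [← Finset.prod_filter, Finset.filter_filter]
  have := coreMonomial_mul_pairMonomial (n := n) (μ := μ) hx
  rw [lcMiddleLow]
  linear_combination (-(prefactor n N μ x * (if α 2 = α 0 then 1 / denFactor n μ x 2 else 1) *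
    ((∏ r with 3 ≤ r ∧ α r = -α 0, numFactor n μ x r) /
      ∏ r with 3 ≤ r ∧ α r = 1 + α 0, denFactor n μ x r))) * this

/-- The monomial factor collects the box monomials of the parameters with `α_r < -α_0` and with
`α_r > 1 + α_0`. -/
theorem monomialFactor_mul (hx : ∀ i, x i ≠ 0) :
    monomialFactor n α μ x *
      ((∏ r with 2 ≤ r ∧ α r < -α 0, x.τ r) * ∏ r with 2 ≤ r ∧ 1 + α 0 < α r, x.τ r) ^ size μ =
    coreMonomial n μ x *
      ((∏ r with 2 ≤ r ∧ α r < -α 0,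
          boxMonomial μ (x.t ^ ((n : ℤ) - 1) * x.τ 0 * x.τ r) x.q x.t) *
        ∏ r with 2 ≤ r ∧ 1 + α 0 < α r,
          (boxMonomial μ (x.q * x.t ^ ((n : ℤ) - 1) * x.τ 0 / x.τ r) x.q x.t)⁻¹) := by
  have hq : x.q ≠ 0 := hx _
  have ht : x.t ≠ 0 := hx _
  have hτ : ∀ r, x.τ r ≠ 0 := fun r => hx _
  have hu : -(x.t ^ ((n : ℤ) - 1) * x.τ 0) ≠ 0 :=
    neg_ne_zero.2 (mul_ne_zero (zpow_ne_zero _ ht) (hτ 0))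
  have m1 : ∀ r, boxMonomial μ (x.t ^ ((n : ℤ) - 1) * x.τ 0 * x.τ r) x.q x.t =
      boxMonomial μ (x.t ^ ((n : ℤ) - 1) * x.τ 0) x.q x.t * x.τ r ^ size μ := by
    intro r
    rw [boxMonomial, boxMonomial, ← neg_mul, mul_pow]; ring
  have m2 : ∀ r, (boxMonomial μ (x.q * x.t ^ ((n : ℤ) - 1) * x.τ 0 / x.τ r) x.q x.t)⁻¹ =
      (x.q ^ size μ * boxMonomial μ (x.t ^ ((n : ℤ) - 1) * x.τ 0) x.q x.t)⁻¹ * x.τ r ^ size μ := by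
    intro r
    rw [boxMonomial, boxMonomial, mul_assoc x.q, mul_div_assoc, ← mul_neg, mul_pow, neg_div',
      div_pow]
    have := pow_ne_zero (size μ) (hτ r)
    field_simp
  have hc : coreMonomial n μ x =
      boxMonomial μ (x.t ^ ((n : ℤ) - 1) * x.τ 0) x.q x.t ^ (-2 : ℤ) * x.t ^ (2 * (nStat μ : ℤ)) := by
    have : x.t ^ (2 * ((n : ℤ) - 1)) * x.τ 0 ^ 2 = (-(x.t ^ ((n : ℤ) - 1) * x.τ 0)) ^ 2 := by
      rw [two_mul ((n : ℤ) - 1), zpow_add₀ ht]; ring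
    rw [coreMonomial, this, boxMonomial, mul_zpow, mul_zpow, ← zpow_mul, ← zpow_mul,
      mul_assoc _ _ (x.t ^ (2 * (nStat μ : ℤ))), ← zpow_add₀ ht, zpow_neg _ 2, zpow_ofNat,
      ← pow_mul, ← pow_mul, mul_comm 2 (size μ)]
    ring_nf
  simp only [m1, m2, Finset.prod_mul_distrib, Finset.prod_const, Finset.prod_pow]
  rw [hc, monomialFactor]
  change _ = _ * (_ ^ numA α * _ * (_ ^ numB α * _))
  have hB := boxMonomial_ne_zero μ (mul_ne_zero (zpow_ne_zero ((n : ℤ) - 1) ht) (hτ 0)) hq ht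
  have key : x.q ^ (-(numB α : ℤ) * size μ) *
      (-(x.t ^ ((n : ℤ) - 1) * x.τ 0)) ^ (((numA α : ℤ) - numB α - 2) * size μ) *
      x.q ^ (((numA α : ℤ) - numB α - 2) * nStatConj μ) *
      x.t ^ (((numB α : ℤ) - numA α + 4) * nStat μ) =
      boxMonomial μ (x.t ^ ((n : ℤ) - 1) * x.τ 0) x.q x.t ^ (-2 : ℤ) * x.t ^ (2 * (nStat μ : ℤ)) *
      (boxMonomial μ (x.t ^ ((n : ℤ) - 1) * x.τ 0) x.q x.t ^ numA α *
        ((x.q ^ size μ * boxMonomial μ (x.t ^ ((n : ℤ) - 1) * x.τ 0) x.q x.t)⁻¹) ^ numB α) := by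
    have e1 : boxMonomial μ (x.t ^ ((n : ℤ) - 1) * x.τ 0) x.q x.t ^ ((numA α : ℤ) - numB α - 2) =
        boxMonomial μ (x.t ^ ((n : ℤ) - 1) * x.τ 0) x.q x.t ^ (-2 : ℤ) *
        (boxMonomial μ (x.t ^ ((n : ℤ) - 1) * x.τ 0) x.q x.t ^ numA α *
        (boxMonomial μ (x.t ^ ((n : ℤ) - 1) * x.τ 0) x.q x.t ^ numB α)⁻¹) := by
      rw [show (numA α : ℤ) - numB α - 2 = -2 + ((numA α : ℤ) + -(numB α : ℤ)) by ring,
        zpow_add₀ hB, zpow_add₀ hB, zpow_neg _ (numB α : ℤ), zpow_natCast, zpow_natCast]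
    have e2 : x.q ^ (-(numB α : ℤ) * size μ) = ((x.q ^ size μ) ^ numB α)⁻¹ := by
      rw [neg_mul, zpow_neg, ← pow_mul, ← zpow_natCast]; push_cast; ring_nf
    have e3 : x.t ^ (((numB α : ℤ) - numA α + 4) * nStat μ) =
        x.t ^ (2 * (nStat μ : ℤ)) * x.t ^ (-(nStat μ : ℤ) * ((numA α : ℤ) - numB α - 2)) := by
      rw [← zpow_add₀ ht]; ring_nf
    calc _ = ((x.q ^ size μ) ^ numB α)⁻¹ * x.t ^ (2 * (nStat μ : ℤ)) *
          boxMonomial μ (x.t ^ ((n : ℤ) - 1) * x.τ 0) x.q x.t ^ ((numA α : ℤ) - numB α - 2) := by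
            rw [e2, e3, boxMonomial, mul_zpow, mul_zpow,
              ← zpow_natCast (-(x.t ^ ((n : ℤ) - 1) * x.τ 0)) (size μ), ← zpow_mul, ← zpow_mul, ← zpow_mul, mul_comm (size μ : ℤ), mul_comm (nStatConj μ : ℤ)]
            ring
      _ = _ := by rw [e1, mul_inv, mul_pow, inv_pow, inv_pow]; ring
  rw [key, mul_pow]
  ring

theorem lcMiddleHigh_eq (hx : ∀ i, x i ≠ 0) (h : InFundamentalDomain α) (hs : slope α = 0)
    (h0 : α 0 < 0) (h0' : -(1 / 2) < α 0) (h2 : α 0 < α 2) (hanti : Antitone μ) :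
    lcMiddleHigh n N α μ x = prefactor n N μ x * coreLc n N (α 0) μ x *
      ∏ r with 2 ≤ r, paramLc n α μ x r := by
  have hq : x.q ≠ 0 := hx _
  have ht : x.t ≠ 0 := hx _
  have h2' := two_lt_neg_of_slope_eq_zero h hs h0
  have hR : ∀ r ∈ Finset.univ.filter fun r : Fin (2 * m + 6) => 2 ≤ r, paramLc n α μ x r =
      (((if α r < -α 0 then boxMonomial μ (x.t ^ ((n : ℤ) - 1) * x.τ 0 * x.τ r) x.q x.t else 1) *
        if 1 + α 0 < α r then
          (boxMonomial μ (x.q * x.t ^ ((n : ℤ) - 1) * x.τ 0 / x.τ r) x.q x.t)⁻¹ else 1)) *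
      ((if α r = -α 0 then numFactor n μ x r else 1) /
        if α r = 1 + α 0 then denFactor n μ x r else 1) := by
    intro r hr
    have hr := (mem_two_le_iff r).1 hr
    have b1 := h.two_le_apply hr
    have b2 := h.apply_le hr
    rw [paramLc, numFactor, denFactor]
    have e1 : α 0 + α r = 0 ↔ α r = -α 0 := by constructor <;> intro <;> linarith
    have e2 : 1 + α 0 - α r = 0 ↔ α r = 1 + α 0 := by constructor <;> intro <;> linarith
    rcases lt_or_ge (α r) (-α 0) with c1 | c1
    · rw [C0Lc_of_neg _ _ hq ht (by linarith) (by linarith),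
        C0Lc_of_mem_Ico _ _ hq ht (by linarith) (by linarith), if_neg (by linarith),
        if_neg (by linarith), if_pos c1, if_neg (by linarith), if_neg (by linarith),
        if_neg (by linarith)]
      simp
    rcases lt_or_ge (1 + α 0) (α r) with c2 | c2
    · rw [C0Lc_of_mem_Ico _ _ hq ht (by linarith) (by linarith),
        C0Lc_of_neg _ _ hq ht (by linarith) (by linarith), if_neg (by linarith),
        if_neg (by linarith), if_neg (by linarith), if_pos c2, if_neg (by linarith),
        if_neg (by linarith)]
      simp
    · rw [C0Lc_of_mem_Ico _ _ hq ht (by linarith) (by linarith),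
        C0Lc_of_mem_Ico _ _ hq ht (by linarith) (by linarith), if_neg (not_lt.2 c1),
        if_neg (not_lt.2 c2)]
      simp only [e1, e2, one_mul]
  have h3 : ∀ (c : ℝ) (g : Fin (2 * m + 6) → ℂ), α 2 ≠ c →
      (∏ r with 2 ≤ r, if α r = c then g r else 1) = ∏ r with 3 ≤ r ∧ α r = c, g r := by
    intro c g hc
    rw [prod_two_le_eq, if_neg hc, one_mul, ← Finset.prod_filter, Finset.filter_filter]
  rw [Finset.prod_congr rfl hR, Finset.prod_mul_distrib, Finset.prod_mul_distrib,
    Finset.prod_div_distrib, coreLc_middle hx hanti h0' h0, h3 _ _ (by linarith),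
    h3 _ _ (by linarith)]
  simp only [← Finset.prod_filter, Finset.filter_filter]
  have := monomialFactor_mul (n := n) (α := α) (μ := μ) hx
  rw [lcMiddleHigh]
  linear_combination (prefactor n N μ x *
    ((∏ r with 3 ≤ r ∧ α r = -α 0, numFactor n μ x r) /
      ∏ r with 3 ≤ r ∧ α r = 1 + α 0, denFactor n μ x r)) * this

theorem lcHalfLow_eq (hx : ∀ i, x i ≠ 0) (h : InFundamentalDomain α) (hs : slope α = 0)
    (h0 : α 0 = -(1 / 2)) (h2 : α 2 = -(1 / 2)) (hanti : Antitone μ) :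
    lcHalfLow n N μ x = prefactor n N μ x * coreLc n N (α 0) μ x *
      ∏ r with 2 ≤ r, paramLc n α μ x r := by
  have hq : x.q ≠ 0 := hx _
  have ht : x.t ≠ 0 := hx _
  have hR : ∀ r ∈ Finset.univ.filter fun r : Fin (2 * m + 6) => 3 ≤ r, paramLc n α μ x r =
      numFactor n μ x r / denFactor n μ x r := by
    intro r hr
    have hr : 3 ≤ r := by simpa using hr
    have b1 := half_of_slope_eq_zero h hs h0 h2 hr
    rw [paramLc, h0, b1, show (-(1 / 2) + 1 / 2 : ℝ) = 0 by norm_num,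
      show (1 + -(1 / 2) - 1 / 2 : ℝ) = 0 by norm_num, C0Lc_of_mem_Ico _ _ hq ht le_rfl one_pos,
      C0Lc_of_mem_Ico _ _ hq ht le_rfl one_pos, if_pos rfl, if_pos rfl, numFactor, denFactor]
  have hR2 : paramLc n α μ x 2 =
      numFactor n μ x 2 / denFactor n μ x 2 * pairMonomial n μ x := by
    rw [paramLc, h0, h2, show (-(1 / 2) + -(1 / 2) : ℝ) = -1 by norm_num,
      show (1 + -(1 / 2) - -(1 / 2) : ℝ) = 1 by norm_num,
      C0Lc_of_neg _ _ hq ht le_rfl (by norm_num), C0Lc_of_one_le _ _ hq ht le_rfl one_lt_two,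
      if_pos rfl, if_pos rfl, ← boxMonomial_mul hx 2, numFactor, denFactor, div_eq_mul_inv, mul_inv,
      inv_inv]
    ring
  have := coreMonomial_mul_pairMonomial (n := n) (μ := μ) hx
  rw [prod_two_le_eq, Finset.prod_congr rfl hR, hR2, h0, coreLc_half hx hanti, lcHalfLow,
    prod_two_le_eq]
  linear_combination (-(wellPoisedFactor n N μ x * prefactor n N μ x *
    (numFactor n μ x 2 / denFactor n μ x 2 *
      ∏ r with 3 ≤ r, numFactor n μ x r / denFactor n μ x r))) * this

theorem lcHalfHigh_eq (hx : ∀ i, x i ≠ 0) (h : InFundamentalDomain α)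
    (h0 : α 0 = -(1 / 2)) (h2 : -(1 / 2) < α 2) (hanti : Antitone μ) :
    lcHalfHigh n N α μ x = prefactor n N μ x * coreLc n N (α 0) μ x *
      ∏ r with 2 ≤ r, paramLc n α μ x r := by
  have hq : x.q ≠ 0 := hx _
  have ht : x.t ≠ 0 := hx _
  have hA : -α 0 = 1 / 2 := by rw [h0]; norm_num
  have hB : 1 + α 0 = 1 / 2 := by rw [h0]; norm_num
  have hR : ∀ r ∈ Finset.univ.filter fun r : Fin (2 * m + 6) => 2 ≤ r, paramLc n α μ x r =
      (((if α r < -α 0 then boxMonomial μ (x.t ^ ((n : ℤ) - 1) * x.τ 0 * x.τ r) x.q x.t else 1) *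
        if 1 + α 0 < α r then
          (boxMonomial μ (x.q * x.t ^ ((n : ℤ) - 1) * x.τ 0 / x.τ r) x.q x.t)⁻¹ else 1)) *
      if α r = 1 / 2 then numFactor n μ x r / denFactor n μ x r else 1 := by
    intro r hr
    have hr := (mem_two_le_iff r).1 hr
    have b1 := h.two_le_apply hr
    have b2 := h.lt_three_halves hr
    rw [paramLc, numFactor, denFactor, hA, hB]
    rcases lt_trichotomy (α r) (1 / 2) with c1 | c1 | c1
    · rw [C0Lc_of_neg _ _ hq ht (by linarith) (by linarith),
        C0Lc_of_mem_Ico _ _ hq ht (by linarith) (by linarith), if_neg (by linarith),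
        if_neg (by linarith), if_pos c1, if_neg (by linarith), if_neg (by linarith)]
      simp
    · rw [C0Lc_of_mem_Ico _ _ hq ht (by linarith) (by linarith),
        C0Lc_of_mem_Ico _ _ hq ht (by linarith) (by linarith), if_pos (by linarith),
        if_pos (by linarith), if_neg (by linarith), if_neg (by linarith), if_pos c1]
      simp
    · rw [C0Lc_of_mem_Ico _ _ hq ht (by linarith) (by linarith),
        C0Lc_of_neg _ _ hq ht (by linarith) (by linarith), if_neg (by linarith),
        if_neg (by linarith), if_neg (by linarith), if_pos c1, if_neg (by linarith)]
      simp
  have hz : (∏ r with 2 ≤ r ∧ α r ≠ 1 / 2, x.τ r) =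
      (∏ r with 2 ≤ r ∧ α r < -α 0, x.τ r) * ∏ r with 2 ≤ r ∧ 1 + α 0 < α r, x.τ r := by
    simp only [hA, hB, Finset.prod_filter, ← Finset.prod_mul_distrib]
    refine Finset.prod_congr rfl fun r _ => ?_
    by_cases hr : 2 ≤ r
    · rcases lt_trichotomy (α r) (1 / 2) with c1 | c1 | c1
      · simp only [hr, true_and, c1, c1.ne, if_true, not_lt.2 c1.le, if_false, mul_one, ne_eq,
          not_false_eq_true]
      · simp only [c1, lt_irrefl, ne_eq, not_true_eq_false, and_false, if_false, mul_one]
      · simp only [hr, true_and, c1, c1.ne', if_true, not_lt.2 c1.le, if_false, one_mul, ne_eq,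
          not_false_eq_true]
    · simp [hr]
  rw [Finset.prod_congr rfl hR, Finset.prod_mul_distrib, Finset.prod_mul_distrib, lcHalfHigh, hz,
    show coreLc n N (α 0) μ x = _ by rw [h0, coreLc_half hx hanti]]
  simp only [← Finset.prod_filter, Finset.filter_filter]
  have := monomialFactor_mul (n := n) (α := α) (μ := μ) hx
  linear_combination (wellPoisedFactor n N μ x * prefactor n N μ x *
    ∏ r with 2 ≤ r ∧ α r = 1 / 2, numFactor n μ x r / denFactor n μ x r) * this

/-- The product of the leading coefficients of the theta functions is the explicit leading
coefficient of the weight. -/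
theorem weightLc_eq_lcWeight (h : InFundamentalDomain α) (hs : slope α = 0)
    (hμ : μ ∈ boxPartitions n N) (hx : x ∈ balanced m n N) :
    weightLc n α μ x = lcWeight n N α μ x := by
  have hanti := (mem_boxPartitions.1 hμ).2
  have h1 := h.lower
  have h2 := h.upper
  have h3 := h.neg_half_le
  rw [weightLc_eq h hanti hx, lcWeight]
  split_ifs with c1 c2 c3 c3
  · exact (lcZero_eq hx.1 h c1 hanti).symm
  · exact (lcMiddleLow_eq hx.1 h hs (lt_of_le_of_ne h2 c1) c2 c3 hanti).symm
  · exact (lcMiddleHigh_eq hx.1 h hs (lt_of_le_of_ne h2 c1) c2 (not_le.1 c3) hanti).symm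
  · exact (lcHalfLow_eq hx.1 h hs (le_antisymm (not_lt.1 c2) h1) c3 hanti).symm
  · exact (lcHalfHigh_eq hx.1 h (le_antisymm (not_lt.1 c2) h1)
      (lt_of_le_of_ne h3 (Ne.symm c3)) hanti).symm

end


/-! ### Explicit nondegenerate parameters -/

noncomputable section

variable {m n N : ℕ}

/-- `z` is not a positive real number. -/
def NotPositive (z : ℂ) : Prop := ∀ ρ : ℝ, 0 < ρ → z ≠ ρ

theorem notPositive_of_im_ne_zero {z : ℂ} (h : z.im ≠ 0) : NotPositive z := by
  rintro ρ - rfl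
  exact h (Complex.ofReal_im ρ)

theorem notPositive_of_re_nonpos {z : ℂ} (h : z.re ≤ 0) : NotPositive z := by
  rintro ρ hρ rfl
  rw [Complex.ofReal_re] at h
  linarith

/-- At `q = 2`, `t = 3` all monomials `q^a t^b` are positive. -/
theorem NotPositive.mul_ne_one {z : ℂ} (h : NotPositive z) (a b : ℤ) :
    (2 : ℂ) ^ a * 3 ^ b * z ≠ 1 := by
  intro h1
  refine h ((2 : ℝ) ^ a * 3 ^ b)⁻¹ (by positivity) ?_
  push_cast
  exact eq_inv_of_mul_eq_one_right h1

theorem two_zpow_mul_three_zpow_ne_one {a b : ℤ} (hab : ¬(a = 0 ∧ b = 0)) :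
    (2 : ℂ) ^ a * 3 ^ b ≠ 1 := by
  intro h
  have h' : (2 : ℚ) ^ a * 3 ^ b = 1 := by
    have h1 : (((2 : ℚ) ^ a * 3 ^ b : ℚ) : ℂ) = ((1 : ℚ) : ℂ) := by push_cast; exact h
    exact Rat.cast_injective h1
  have h2 : padicValRat 2 ((2 : ℚ) ^ a * 3 ^ b) = a := by
    rw [padicValRat.mul (by positivity) (by positivity), padicValRat.zpow,
      padicValRat.zpow]
    have e2 : padicValRat 2 (2 : ℚ) = 1 := padicValRat.self (by norm_num)
    have e3 : padicValRat 2 (3 : ℚ) = 0 := by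
      have : padicValRat 2 ((3 : ℕ) : ℚ) = 0 := by
        rw [padicValRat.of_nat, padicValNat.eq_zero_of_not_dvd (by norm_num)]; rfl
      exact_mod_cast this
    rw [e2, e3]; ring
  rw [h', padicValRat.one] at h2
  subst h2
  rw [zpow_zero, one_mul, zpow_eq_one_iff_right₀ (by norm_num) (by norm_num)] at h'
  exact hab ⟨rfl, h'⟩

/-- The product of the parameters `t_r` with `r ≥ 2` at `q = 2`, `t = 3`. -/
def paramProd (m n N : ℕ) : ℝ := 2 ^ (m + 1 + N) * 3 ^ (1 - (n : ℤ))

theorem paramProd_pos : 0 < paramProd m n N := by unfold paramProd; positivity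

/-- The point with `q = 2`, `t = 3`, with `t_0 = u`, with the values `a`, `b`, `c` at the indices
`r₁`, `r₂`, `r₃`, with all other `t_r`, `r ≥ 2`, equal to `1`, and with `t_1` determined by the
balancing condition. -/
def samplePoint (m n N : ℕ) (u : ℂ) (r₁ r₂ r₃ : Fin (2 * m + 6)) (a b c : ℂ) : Params m :=
  Sum.elim ![2, 3] fun r => if r = 0 then u else if r = 1 then
    2 ^ (-(N : ℤ)) * 3 ^ (1 - (n : ℤ)) / u else
    (if r = r₁ then a else 1) * (if r = r₂ then b else 1) * if r = r₃ then c else 1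

section

variable {u a b c : ℂ} {r₁ r₂ r₃ : Fin (2 * m + 6)}

@[simp] theorem samplePoint_q : (samplePoint m n N u r₁ r₂ r₃ a b c).q = 2 := rfl

@[simp] theorem samplePoint_t : (samplePoint m n N u r₁ r₂ r₃ a b c).t = 3 := rfl

@[simp] theorem samplePoint_τ_zero : (samplePoint m n N u r₁ r₂ r₃ a b c).τ 0 = u := rfl

theorem samplePoint_τ_one : (samplePoint m n N u r₁ r₂ r₃ a b c).τ 1 =
    2 ^ (-(N : ℤ)) * 3 ^ (1 - (n : ℤ)) / u := by
  simp [samplePoint, Params.τ]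

theorem samplePoint_τ {r : Fin (2 * m + 6)} (hr : 2 ≤ r) :
    (samplePoint m n N u r₁ r₂ r₃ a b c).τ r =
      (if r = r₁ then a else 1) * (if r = r₂ then b else 1) * if r = r₃ then c else 1 := by
  have h := (two_le_iff r).1 hr
  have h0 : r ≠ 0 := fun h0 => by rw [h0] at h; simp at h
  have h1 : r ≠ 1 := fun h1 => by rw [h1] at h; simp at h
  simp [samplePoint, Params.τ, h0, h1]

theorem prod_samplePoint (h1 : 2 ≤ r₁) (h2 : 2 ≤ r₂) (h3 : 2 ≤ r₃) :
    ∏ r with 2 ≤ r, (samplePoint m n N u r₁ r₂ r₃ a b c).τ r = a * b * c := by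
  rw [Finset.prod_congr rfl fun r hr => samplePoint_τ ((mem_two_le_iff r).1 hr)]
  rw [Finset.prod_mul_distrib, Finset.prod_mul_distrib, Finset.prod_ite_eq', Finset.prod_ite_eq',
    Finset.prod_ite_eq', if_pos ((mem_two_le_iff _).2 h1), if_pos ((mem_two_le_iff _).2 h2),
    if_pos ((mem_two_le_iff _).2 h3)]

theorem prod_eq_mul_prod_two_le (g : Fin (2 * m + 6) → ℂ) :
    ∏ r, g r = g 0 * (g 1 * ∏ r with 2 ≤ r, g r) := by
  rw [Fin.prod_univ_succ, prod_succ_eq]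

theorem samplePoint_mem_balanced (hu : u ≠ 0) (ha : a ≠ 0) (hb : b ≠ 0) (hc : c ≠ 0)
    (h1 : 2 ≤ r₁) (h2 : 2 ≤ r₂) (h3 : 2 ≤ r₃) (habc : a * b * c = paramProd m n N) :
    samplePoint m n N u r₁ r₂ r₃ a b c ∈ balanced m n N := by
  have h01 : (samplePoint m n N u r₁ r₂ r₃ a b c).τ 0 * (samplePoint m n N u r₁ r₂ r₃ a b c).τ 1 =
      2 ^ (-(N : ℤ)) * 3 ^ (1 - (n : ℤ)) := by
    rw [samplePoint_τ_one, samplePoint_τ_zero]; field_simp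
  refine ⟨?_, h01, ?_⟩
  · rintro (i | r)
    · fin_cases i <;> simp [samplePoint]
    · simp only [samplePoint, Sum.elim_inr]
      split_ifs <;> simp [hu, ha, hb, hc, zpow_ne_zero]
  · rw [prod_eq_mul_prod_two_le, ← mul_assoc ((samplePoint m n N u r₁ r₂ r₃ a b c).τ 0), h01,
      prod_samplePoint h1 h2 h3, habc, paramProd]
    push_cast
    rw [samplePoint_t, samplePoint_q, zpow_neg, zpow_natCast, pow_add (2 : ℂ) (m + 1) N]
    have e : (3 : ℂ) ^ (2 * ((n : ℤ) - 1)) * (3 ^ (1 - (n : ℤ)) * 3 ^ (1 - (n : ℤ))) = 1 := by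
      rw [← zpow_add₀ (by norm_num), ← zpow_add₀ (by norm_num)]
      ring_nf
      simp
    have h2 : ((2 : ℂ) ^ N)⁻¹ * 2 ^ N = 1 := inv_mul_cancel₀ (pow_ne_zero _ two_ne_zero)
    linear_combination (((2 : ℂ) ^ N)⁻¹ * 2 ^ N * 2 ^ (m + 1)) * e + (2 : ℂ) ^ (m + 1) * h2

theorem samplePoint_nondegenerate {M : ℕ} (h12 : r₁ ≠ r₂) (h13 : r₁ ≠ r₃) (h23 : r₂ ≠ r₃)
    (hu : NotPositive (u ^ 2)) (hu1 : NotPositive (u / 1)) (ha : NotPositive (u / a))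
    (hb : NotPositive (u / b)) (hc : NotPositive (u / c)) :
    Nondegenerate M (samplePoint m n N u r₁ r₂ r₃ a b c) := by
  intro k _ l _
  refine ⟨fun h => ?_, ?_, fun r hr => ?_⟩
  · exact sub_ne_zero.2 (two_zpow_mul_three_zpow_ne_one h).symm
  · exact sub_ne_zero.2 (hu.mul_ne_one k l).symm
  · refine sub_ne_zero.2 (NotPositive.mul_ne_one ?_ k l).symm
    rw [samplePoint_τ ((mem_two_le_iff r).1 hr), samplePoint_τ_zero]
    by_cases e1 : r = r₁
    · subst e1; simpa [h12, h13] using ha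
    by_cases e2 : r = r₂
    · subst e2; simpa [h12.symm, h23] using hb
    by_cases e3 : r = r₃
    · subst e3; simpa [h13.symm, h23.symm] using hc
    · simpa [e1, e2, e3] using hu1

end

theorem notPositive_I_mul_div {u v : ℝ} (hu : u ≠ 0) (hv : v ≠ 0) :
    NotPositive (Complex.I * u / v) := by
  refine notPositive_of_im_ne_zero ?_
  rw [Complex.div_ofReal_im, Complex.I_mul_im, Complex.ofReal_re]
  exact div_ne_zero hu hv

theorem notPositive_I_mul_sq (u : ℝ) : NotPositive ((Complex.I * u) ^ 2) := by
  refine notPositive_of_re_nonpos ?_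
  rw [mul_pow, Complex.I_sq, ← Complex.ofReal_pow, neg_one_mul, Complex.neg_re, Complex.ofReal_re]
  nlinarith [sq_nonneg u]

theorem exists_third_index (r s : Fin (2 * m + 6)) : ∃ r₃, 2 ≤ r₃ ∧ r ≠ r₃ ∧ s ≠ r₃ := by
  have hlt : ({r, s} : Finset (Fin (2 * m + 6))).card <
      (Finset.univ.filter fun r : Fin (2 * m + 6) => 2 ≤ r).card := by
    rw [card_two_le]
    exact lt_of_le_of_lt Finset.card_le_two (by omega)
  obtain ⟨r₃, h1, h2⟩ := Finset.exists_mem_notMem_of_card_lt_card hlt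
  simp only [Finset.mem_insert, Finset.mem_singleton, not_or] at h2
  exact ⟨r₃, (mem_two_le_iff _).1 h1, Ne.symm h2.1, Ne.symm h2.2⟩

/-- With `t_0` imaginary and two real parameters, the sample point is balanced and
nondegenerate. -/
theorem samplePoint_real {M : ℕ} {r s r₃ : Fin (2 * m + 6)} (hr : 2 ≤ r) (hs : 2 ≤ s)
    (hr₃ : 2 ≤ r₃) (hrs : r ≠ s) (hr3 : r ≠ r₃) (hs3 : s ≠ r₃) {u ε : ℝ} (hu : 0 < u) (hε : 0 < ε) :
    samplePoint m n N (Complex.I * u) r s r₃ ε ((paramProd m n N / ε : ℝ) : ℂ) 1 ∈ balanced m n N ∧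
      Nondegenerate M
        (samplePoint m n N (Complex.I * u) r s r₃ ε ((paramProd m n N / ε : ℝ) : ℂ) 1) := by
  have hp := paramProd_pos (m := m) (n := n) (N := N)
  have hpe : paramProd m n N / ε ≠ 0 := (div_pos hp hε).ne'
  have h1 : NotPositive (Complex.I * u / 1) := by
    simpa using notPositive_I_mul_div hu.ne' one_ne_zero
  refine ⟨samplePoint_mem_balanced (mul_ne_zero Complex.I_ne_zero (by exact_mod_cast hu.ne'))
    (by exact_mod_cast hε.ne') (by exact_mod_cast hpe) one_ne_zero hr hs hr₃ ?_,
    samplePoint_nondegenerate hrs hr3 hs3 (notPositive_I_mul_sq u) h1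
      (notPositive_I_mul_div hu.ne' hε.ne') (notPositive_I_mul_div hu.ne' hpe) h1⟩
  rw [mul_one, ← Complex.ofReal_mul, mul_div_cancel₀ _ hε.ne']

/-! ### Nonvanishing of the leading coefficient of a single weight -/

theorem weightLc_ne_zero (α : Fin (2 * m + 6) → ℝ) {μ : Fin n → ℕ}
    (hμ : μ ∈ boxPartitions n N) {x : Params m} (hx : x ∈ balanced m n N)
    (hnd : Nondegenerate (expBound n N) x)
    (hnum : ∀ r, 2 ≤ r → ∀ a b : ℤ, x.q ^ a * x.t ^ b * (x.τ 0 * x.τ r) ≠ 1) :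
    weightLc n α μ x ≠ 0 := by
  obtain ⟨d1, d2, d3, d4, d5⟩ := denominatorsNonzero α hμ hx hnd
  obtain ⟨hle, hanti⟩ := mem_boxPartitions.1 hμ
  obtain ⟨hx0, hb1, -⟩ := hx
  have hq : x.q ≠ 0 := hx0 _
  have ht : x.t ≠ 0 := hx0 _
  have hnumer : ∀ r, C0Lc (argExp α r) μ (argCoeff n x r) x.q x.t ≠ 0 := by
    refine fun r => C0Lc_ne_zero hq ht (argCoeff_ne_zero hx0 r) ?_
    intro i j hj1 hj2
    have := hle i
    have hi := i.isLt
    refine Fin.cases ?_ (fun r => ?_) r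
    · have h := hnd.qt_ne (a := (j : ℤ) - 1) (b := (n : ℤ) - i)
        (by rw [abs_le]; simp only [expBound]; push_cast; constructor <;> omega)
        (by rw [abs_le]; simp only [expBound]; push_cast; constructor <;> omega) (by omega)
      convert h using 1
      simp only [argCoeff, Fin.cons_zero]
      rw [mul_assoc, ← zpow_natCast x.t n, ← zpow_add₀ ht]
      congr 2
      ring
    · rcases eq_or_ne r 0 with rfl | hr
      · have h := hnd.qt_ne (a := (j : ℤ) - 1 - N) (b := -(i : ℤ))
          (by rw [abs_le]; simp only [expBound]; push_cast; constructor <;> omega)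
          (by rw [abs_le]; simp only [expBound]; push_cast; constructor <;> omega) (by omega)
        convert h using 1
        have hc : argCoeff n x (Fin.succ 0) = x.t ^ ((n : ℤ) - 1) * (x.τ 0 * x.τ 1) :=
          mul_assoc _ _ _
        rw [hc, hb1, mul_left_comm (x.t ^ _), ← zpow_add₀ ht, sub_add_sub_cancel, sub_self, zpow_zero,
          mul_one, mul_right_comm, ← zpow_add₀ hq]
        congr 2
        ring
      · have h := hnum r.succ ((two_le_succ_iff r).2 hr) ((j : ℤ) - 1)
          (1 - ((i : ℤ) + 1) + ((n : ℤ) - 1))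
        convert h using 1
        simp only [argCoeff, Fin.cons_succ]
        rw [zpow_add₀ ht]
        ring
  refine mul_ne_zero (Finset.prod_ne_zero_iff.2 fun r _ => div_ne_zero (hnumer r) (d1 r))
    (div_ne_zero ?_ (mul_ne_zero (mul_ne_zero d2 d3) (mul_ne_zero d4 d5)))
  · refine C0Lc_ne_zero hq ht (mul_ne_zero hq (mul_ne_zero (zpow_ne_zero _ ht)
      (pow_ne_zero _ (hx0 _)))) fun i j hj1 hj2 => ?_
    have hj3 : j ≤ 2 * N := hj2.trans (Nat.mul_le_mul_left 2 (hle _))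
    have hi := i.isLt
    have h := hnd.sq_ne (a := (j : ℤ)) (b := 1 - ((i : ℤ) + 1) + 2 * ((n : ℤ) - 1))
        (by rw [abs_le]; simp only [expBound]; push_cast; constructor <;> omega)
        (by rw [abs_le]; simp only [expBound]; push_cast; constructor <;> omega)
    convert h using 1
    rw [zpow_add₀ ht, zpow_sub₀ hq, zpow_one]
    field_simp

/-- A point with `t_0` imaginary and all `t_r`, `r ≥ 2`, real: then `q^a t^b t_0 t_r` is never real,
so no numerator vanishes. -/
theorem exists_weightLc_ne_zero (α : Fin (2 * m + 6) → ℝ) :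
    ∃ x ∈ balanced m n N, Nondegenerate (expBound n N) x ∧
      ∀ μ ∈ boxPartitions n N, weightLc n α μ x ≠ 0 := by
  obtain ⟨s, hs, hs2, -⟩ := exists_third_index (2 : Fin (2 * m + 6)) 2
  obtain ⟨r₃, hr₃, h2, h3⟩ := exists_third_index (2 : Fin (2 * m + 6)) s
  obtain ⟨hx, hnd⟩ := samplePoint_real (n := n) (N := N) (M := expBound n N) (u := 1) (ε := 1)
    le_rfl hs hr₃ hs2 h2 h3 one_pos one_pos
  refine ⟨_, hx, hnd, fun μ hμ => weightLc_ne_zero α hμ hx hnd fun r hr a b => ?_⟩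
  refine NotPositive.mul_ne_one ?_ a b
  have hp := paramProd_pos (m := m) (n := n) (N := N)
  rw [samplePoint_τ hr, samplePoint_τ_zero]
  have key : ∀ v : ℝ, v ≠ 0 → NotPositive (Complex.I * (1 : ℝ) * v) := fun v hv => by
    have := notPositive_I_mul_div one_ne_zero (inv_ne_zero hv)
    rwa [Complex.ofReal_inv, div_inv_eq_mul] at this
  by_cases e2 : r = s
  · subst e2; simpa [hs2.symm] using key _ hp.ne'
  · simpa [e2] using key 1 one_ne_zero

/-- The limit in `tendsto_scaledWeight` is rational and given by the explicit formulas, and the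
sample point of `exists_weightLc_ne_zero` shows that it is not identically zero. -/
theorem hasLeadingTerm_scaledWeight {α : Fin (2 * m + 6) → ℝ} (h : InFundamentalDomain α)
    (hs : slope α = 0) {μ : Fin n → ℕ} (hμ : μ ∈ boxPartitions n N) :
    HasLeadingTerm (balanced m n N) (scaledWeight m n α μ) 0 (lcWeight n N α μ) := by
  refine hasLeadingTerm_zero_of_tendsto (condition_nondegenerate (fun x hx => hx.1) (expBound n N))
    ((rationalOn_weightLc α hμ).congr fun x hx => (weightLc_eq_lcWeight h hs hμ hx.1).symm) ?_ ?_
  · obtain ⟨x, hx, hnd, hne⟩ := exists_weightLc_ne_zero (m := m) (n := n) (N := N) α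
    exact ⟨x, hx, hnd, by rw [← weightLc_eq_lcWeight h hs hμ hx]; exact hne μ hμ⟩
  · intro x hx hnd
    rw [← weightLc_eq_lcWeight h hs hμ hx]
    exact tendsto_scaledWeight h hs hμ hx hnd _

/-! ### The leading coefficient of the sum -/

/-- Every weight converges to its leading coefficient, hence so does the sum; what has to be shown is
that the sum of the leading coefficients does not vanish identically. -/
theorem hasLeadingTerm_sum {α : Fin (2 * m + 6) → ℝ} (h : InFundamentalDomain α)
    (hs : slope α = 0) (hne : ∃ x ∈ balanced m n N, Nondegenerate (expBound n N) x ∧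
      ∑ μ ∈ boxPartitions n N, lcWeight n N α μ x ≠ 0) :
    HasLeadingTerm (balanced m n N)
      (fun x p => ∑ μ ∈ boxPartitions n N, scaledWeight m n α μ x p) 0
      (fun x => ∑ μ ∈ boxPartitions n N, lcWeight n N α μ x) := by
  refine hasLeadingTerm_zero_of_tendsto (condition_nondegenerate (fun x hx => hx.1) (expBound n N))
    (RationalOn.sum _ fun μ hμ => (rationalOn_weightLc α hμ).congr fun x hx =>
      (weightLc_eq_lcWeight h hs hμ hx.1).symm) hne ?_
  intro x hx hnd
  refine tendsto_finsetSum _ fun μ hμ => ?_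
  rw [← weightLc_eq_lcWeight h hs hμ hx]
  exact tendsto_scaledWeight h hs hμ hx hnd _

theorem zero_mem_boxPartitions : (0 : Fin n → ℕ) ∈ boxPartitions n N :=
  mem_boxPartitions.2 ⟨fun _ => Nat.zero_le _, fun _ _ _ => le_rfl⟩

theorem weightLc_zero (α : Fin (2 * m + 6) → ℝ) (x : Params m) :
    weightLc n α (0 : Fin n → ℕ) x = 1 := by
  simp [weightLc, DeltaLc, C0Lc, CminusLc, CplusLc, doubleSq]

/-- The sum of the leading coefficients is not identically zero if along some family of parameters
only the term of the empty partition survives. -/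
theorem exists_sum_ne_zero_of_tendsto {α : Fin (2 * m + 6) → ℝ} (h : InFundamentalDomain α)
    (hs : slope α = 0) {ι : Type*} {l : Filter ι} [l.NeBot] (X : ι → Params m)
    (hX : ∀ᶠ i in l, X i ∈ balanced m n N ∧ Nondegenerate (expBound n N) (X i))
    (hlim : ∀ μ ∈ boxPartitions n N, μ ≠ 0 →
      Tendsto (fun i => lcWeight n N α μ (X i)) l (𝓝 0)) :
    ∃ x ∈ balanced m n N, Nondegenerate (expBound n N) x ∧
      ∑ μ ∈ boxPartitions n N, lcWeight n N α μ x ≠ 0 := by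
  have key : Tendsto (fun i => ∑ μ ∈ boxPartitions n N, lcWeight n N α μ (X i)) l
      (𝓝 (∑ μ ∈ boxPartitions n N, if μ = 0 then 1 else 0)) := by
    refine tendsto_finsetSum _ fun μ hμ => ?_
    split_ifs with h0
    · subst h0
      refine tendsto_const_nhds.congr' ?_
      filter_upwards [hX] with i hi
      rw [← weightLc_eq_lcWeight h hs hμ hi.1, weightLc_zero]
    · exact hlim μ hμ h0
  rw [Finset.sum_ite_eq', if_pos zero_mem_boxPartitions] at key
  obtain ⟨i, h1, h2⟩ := ((key.eventually_ne one_ne_zero).and hX).exists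
  exact ⟨X i, h2.1, h2.2, h1⟩

end


/-! ### Asymptotics of the box products -/

noncomputable section

theorem eventually_cobounded_ne_zero : ∀ᶠ y : ℂ in Bornology.cobounded ℂ, y ≠ 0 :=
  (Bornology.isBounded_singleton (x := (0 : ℂ)))

theorem tendsto_box_zero {k : ℕ} (l : Fin k → ℕ) (c : Fin k → ℕ → ℂ) :
    Tendsto (fun y : ℂ => ∏ i, ∏ j ∈ Finset.Icc 1 (l i), (1 - c i j * y)) (𝓝 0) (𝓝 1) := by
  have h : Continuous fun y : ℂ => ∏ i, ∏ j ∈ Finset.Icc 1 (l i), (1 - c i j * y) := by fun_prop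
  simpa using h.tendsto 0

theorem tendsto_box_div_pow {k : ℕ} (l : Fin k → ℕ) (c : Fin k → ℕ → ℂ) :
    Tendsto (fun y : ℂ => (∏ i, ∏ j ∈ Finset.Icc 1 (l i), (1 - c i j * y)) / y ^ size l)
      (Bornology.cobounded ℂ) (𝓝 (∏ i, ∏ j ∈ Finset.Icc 1 (l i), -c i j)) := by
  have h : Tendsto (fun y : ℂ => ∏ i, ∏ j ∈ Finset.Icc 1 (l i), (y⁻¹ - c i j))
      (Bornology.cobounded ℂ) (𝓝 (∏ i, ∏ j ∈ Finset.Icc 1 (l i), -c i j)) := by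
    refine tendsto_finsetProd _ fun i _ => tendsto_finsetProd _ fun j _ => ?_
    simpa using (tendsto_inv₀_cobounded (α := ℂ)).sub_const (c i j)
  refine h.congr' ?_
  filter_upwards [eventually_cobounded_ne_zero] with y hy
  have e : y ^ size l = ∏ i, ∏ j ∈ Finset.Icc 1 (l i), y := by
    simp [size, Finset.prod_pow_eq_pow_sum]
  rw [e, ← Finset.prod_div_distrib]
  refine Finset.prod_congr rfl fun i _ => ?_
  rw [← Finset.prod_div_distrib]
  refine Finset.prod_congr rfl fun j _ => ?_
  field_simp

section

variable {k : ℕ} (l : Fin k → ℕ) (a : ℂ) {q t : ℂ}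

theorem tendsto_qC0_zero : Tendsto (fun y => qC0 l (a * y) q t) (𝓝 0) (𝓝 1) := by
  simpa only [qC0, ← mul_assoc] using
    tendsto_box_zero l fun i j => q ^ ((j : ℤ) - 1) * t ^ (1 - ((i : ℤ) + 1)) * a

theorem tendsto_qCplus_zero : Tendsto (fun y => qCplus l (a * y) q t) (𝓝 0) (𝓝 1) := by
  simpa only [qCplus, ← mul_assoc] using
    tendsto_box_zero l fun i j =>
      q ^ ((l i : ℤ) + j - 1) * t ^ (2 - (conjPart l j : ℤ) - ((i : ℤ) + 1)) * a

theorem tendsto_qC0_div_pow (hq : q ≠ 0) (ht : t ≠ 0) :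
    Tendsto (fun y => qC0 l (a * y) q t / y ^ size l) (Bornology.cobounded ℂ)
      (𝓝 (boxMonomial l a q t)) := by
  have h := tendsto_box_div_pow l fun i j => q ^ ((j : ℤ) - 1) * t ^ (1 - ((i : ℤ) + 1)) * a
  rw [prod_box_zero l a hq ht] at h
  simpa only [qC0, boxMonomial, ← mul_assoc] using h

variable {l} in
theorem tendsto_qCplus_div_pow (hl : Antitone l) (hq : q ≠ 0) (ht : t ≠ 0) :
    Tendsto (fun y => qCplus l (a * y) q t / y ^ size l) (Bornology.cobounded ℂ)
      (𝓝 ((-a) ^ size l * q ^ (3 * (nStatConj l : ℤ) + size l) * t ^ (-3 * (nStat l : ℤ)))) := by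
  have h := tendsto_box_div_pow l fun i j =>
    q ^ ((l i : ℤ) + j - 1) * t ^ (2 - (conjPart l j : ℤ) - ((i : ℤ) + 1)) * a
  rw [prod_box_plus hl a hq ht] at h
  simpa only [qCplus, ← mul_assoc] using h

end

theorem size_ne_zero {k : ℕ} {l : Fin k → ℕ} (hl : l ≠ 0) : size l ≠ 0 := fun h =>
  hl (funext fun i => Finset.sum_eq_zero_iff.1 h i (Finset.mem_univ i))

theorem tendsto_inv_qC0 {k : ℕ} {l : Fin k → ℕ} (hl : l ≠ 0) {a q t : ℂ} (ha : a ≠ 0)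
    (hq : q ≠ 0) (ht : t ≠ 0) :
    Tendsto (fun y => (qC0 l (a * y) q t)⁻¹) (Bornology.cobounded ℂ) (𝓝 0) := by
  have h1 := (tendsto_qC0_div_pow l a hq ht).inv₀ (boxMonomial_ne_zero l ha hq ht)
  have h2 := (tendsto_inv₀_cobounded (α := ℂ)).pow (size l)
  have h3 := h1.mul h2
  rw [zero_pow (size_ne_zero hl), mul_zero] at h3
  refine h3.congr' ?_
  filter_upwards [eventually_cobounded_ne_zero] with y hy
  have hy' := pow_ne_zero (size l) hy
  rw [inv_pow, inv_div, div_mul_eq_mul_div, mul_inv_cancel₀ hy', one_div]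

/-- `wellPoisedFactor` as a function of `q`, `t` and `c = t_0²`. -/
def wellPoisedRatio {n : ℕ} (N : ℕ) (μ : Fin n → ℕ) (q t c : ℂ) : ℂ :=
  qC0 (doubleSq μ) (q * t ^ (2 * ((n : ℤ) - 1)) * c) q t /
    (qC0 μ (q * t ^ ((n : ℤ) - 2) * c) q t *
      qC0 μ (q ^ (N + 1) * t ^ (2 * ((n : ℤ) - 1)) * c) q t *
      (qCplus μ (t ^ (2 * ((n : ℤ) - 1)) * c) q t *
        qCplus μ (q * t ^ (2 * (n : ℤ) - 3) * c) q t))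

variable {n N : ℕ} {μ : Fin n → ℕ} {q t : ℂ}

theorem tendsto_wellPoisedRatio_zero : Tendsto (wellPoisedRatio N μ q t) (𝓝 0) (𝓝 1) := by
  have h := (tendsto_qC0_zero (doubleSq μ) (q * t ^ (2 * ((n : ℤ) - 1))) (q := q) (t := t)).div
    (((tendsto_qC0_zero μ (q * t ^ ((n : ℤ) - 2)) (q := q) (t := t)).mul
      (tendsto_qC0_zero μ (q ^ (N + 1) * t ^ (2 * ((n : ℤ) - 1))) (q := q) (t := t))).mul
      ((tendsto_qCplus_zero μ (t ^ (2 * ((n : ℤ) - 1))) (q := q) (t := t)).mul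
        (tendsto_qCplus_zero μ (q * t ^ (2 * (n : ℤ) - 3)) (q := q) (t := t)))) (by norm_num)
  simp only [mul_one, div_one] at h
  exact h

/-- Numerator and denominator both have degree `4 |μ|` in `c`, so the limit is the quotient of the
highest coefficients. -/
theorem tendsto_wellPoisedRatio_cobounded (hμ : Antitone μ) (hq : q ≠ 0) (ht : t ≠ 0) :
    Tendsto (wellPoisedRatio N μ q t) (Bornology.cobounded ℂ)
      (𝓝 ((q ^ (1 - (N : ℤ)) * t ^ ((n : ℤ) - 1)) ^ size μ)) := by
  have hz : ∀ k : ℤ, t ^ k ≠ 0 := fun k => zpow_ne_zero k ht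
  have hz' : ∀ k : ℤ, q ^ k ≠ 0 := fun k => zpow_ne_zero k hq
  have hm : ∀ {a : ℂ}, a ≠ 0 → (-a) ^ size μ * q ^ (3 * (nStatConj μ : ℤ) + size μ) *
      t ^ (-3 * (nStat μ : ℤ)) ≠ 0 := fun ha =>
    mul_ne_zero (mul_ne_zero (pow_ne_zero _ (neg_ne_zero.2 ha)) (hz' _)) (hz _)
  have a1 : q * t ^ (2 * ((n : ℤ) - 1)) ≠ 0 := mul_ne_zero hq (hz _)
  have a2 : q * t ^ ((n : ℤ) - 2) ≠ 0 := mul_ne_zero hq (hz _)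
  have a3 : q ^ (N + 1) * t ^ (2 * ((n : ℤ) - 1)) ≠ 0 := mul_ne_zero (pow_ne_zero _ hq) (hz _)
  have a5 : q * t ^ (2 * (n : ℤ) - 3) ≠ 0 := mul_ne_zero hq (hz _)
  have h := (tendsto_qC0_div_pow (doubleSq μ) (q * t ^ (2 * ((n : ℤ) - 1))) hq ht).div
    (((tendsto_qC0_div_pow μ (q * t ^ ((n : ℤ) - 2)) hq ht).mul
      (tendsto_qC0_div_pow μ (q ^ (N + 1) * t ^ (2 * ((n : ℤ) - 1))) hq ht)).mul
      ((tendsto_qCplus_div_pow (t ^ (2 * ((n : ℤ) - 1))) hμ hq ht).mul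
        (tendsto_qCplus_div_pow (q * t ^ (2 * (n : ℤ) - 3)) hμ hq ht)))
    (mul_ne_zero (mul_ne_zero (boxMonomial_ne_zero μ a2 hq ht) (boxMonomial_ne_zero μ a3 hq ht))
      (mul_ne_zero (hm (hz _)) (hm a5)))
  have e : boxMonomial (doubleSq μ) (q * t ^ (2 * ((n : ℤ) - 1))) q t /
      (boxMonomial μ (q * t ^ ((n : ℤ) - 2)) q t *
        boxMonomial μ (q ^ (N + 1) * t ^ (2 * ((n : ℤ) - 1))) q t *
        ((-t ^ (2 * ((n : ℤ) - 1))) ^ size μ * q ^ (3 * (nStatConj μ : ℤ) + size μ) *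
          t ^ (-3 * (nStat μ : ℤ)) *
        ((-(q * t ^ (2 * (n : ℤ) - 3))) ^ size μ * q ^ (3 * (nStatConj μ : ℤ) + size μ) *
          t ^ (-3 * (nStat μ : ℤ))))) = (q ^ (1 - (N : ℤ)) * t ^ ((n : ℤ) - 1)) ^ size μ := by
    rw [div_eq_iff (mul_ne_zero (mul_ne_zero (boxMonomial_ne_zero μ a2 hq ht)
      (boxMonomial_ne_zero μ a3 hq ht)) (mul_ne_zero (hm (hz _)) (hm a5)))]
    simp only [boxMonomial, size_doubleSq, nStat_doubleSq, nStatConj_doubleSq]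
    have b1 : (-(q * t ^ (2 * ((n : ℤ) - 1)))) ^ (4 * size μ) =
        (q ^ (4 : ℤ) * t ^ (8 * (n : ℤ) - 8)) ^ size μ := by
      have c1 : (t ^ (2 * ((n : ℤ) - 1))) ^ 4 = t ^ (8 * (n : ℤ) - 8) := by
        rw [← zpow_natCast, ← zpow_mul]; push_cast; ring_nf
      rw [pow_mul, ← c1, zpow_ofNat]; ring
    have b2 : q ^ ((8 * nStatConj μ + 2 * size μ : ℕ) : ℤ) =
        q ^ (nStatConj μ : ℤ) * q ^ (nStatConj μ : ℤ) * (q ^ (3 * (nStatConj μ : ℤ) + size μ) *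
          q ^ (3 * (nStatConj μ : ℤ) + size μ)) := by
      rw [← zpow_add₀ hq, ← zpow_add₀ hq, ← zpow_add₀ hq]; push_cast; ring_nf
    have b3 : t ^ (-((8 * nStat μ + 2 * size μ : ℕ) : ℤ)) =
        t ^ (-(nStat μ : ℤ)) * t ^ (-(nStat μ : ℤ)) * (t ^ (-3 * (nStat μ : ℤ)) *
          t ^ (-3 * (nStat μ : ℤ))) * (t ^ (-2 : ℤ)) ^ size μ := by
      rw [← zpow_add₀ ht, ← zpow_add₀ ht, ← zpow_add₀ ht, ← zpow_natCast, ← zpow_mul,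
        ← zpow_add₀ ht]; push_cast; ring_nf
    have b4 : (q ^ (4 : ℤ) * t ^ (8 * (n : ℤ) - 8)) * t ^ (-2 : ℤ) =
        q ^ (1 - (N : ℤ)) * t ^ ((n : ℤ) - 1) * ((-(q * t ^ ((n : ℤ) - 2))) *
          (-(q ^ (N + 1) * t ^ (2 * ((n : ℤ) - 1)))) * ((-t ^ (2 * ((n : ℤ) - 1))) *
          (-(q * t ^ (2 * (n : ℤ) - 3))))) := by
      have c1 : q ^ (4 : ℤ) = q ^ (1 - (N : ℤ)) * q * q ^ (N + 1) * q := by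
        rw [← zpow_natCast, ← zpow_add_one₀ hq, ← zpow_add₀ hq, ← zpow_add_one₀ hq]
        push_cast; ring_nf
      have c2 : t ^ (8 * (n : ℤ) - 8) * t ^ (-2 : ℤ) = t ^ ((n : ℤ) - 1) * t ^ ((n : ℤ) - 2) *
          t ^ (2 * ((n : ℤ) - 1)) * t ^ (2 * ((n : ℤ) - 1)) * t ^ (2 * (n : ℤ) - 3) := by
        simp only [← zpow_add₀ ht]; ring_nf
      rw [mul_assoc, c2, c1]; ring
    have b5 := congrArg (· ^ size μ) b4
    simp only [mul_pow] at b5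
    rw [b1, b2, b3, mul_pow, mul_pow]
    generalize (-(q * t ^ ((n : ℤ) - 2))) ^ size μ = d1 at b5 ⊢
    generalize (-(q ^ (N + 1) * t ^ (2 * ((n : ℤ) - 1)))) ^ size μ = d2 at b5 ⊢
    generalize (-t ^ (2 * ((n : ℤ) - 1))) ^ size μ = d3 at b5 ⊢
    generalize (-(q * t ^ (2 * (n : ℤ) - 3))) ^ size μ = d4 at b5 ⊢
    linear_combination (q ^ (nStatConj μ : ℤ) * q ^ (nStatConj μ : ℤ) *
      (q ^ (3 * (nStatConj μ : ℤ) + size μ) * q ^ (3 * (nStatConj μ : ℤ) + size μ)) *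
      (t ^ (-(nStat μ : ℤ)) * t ^ (-(nStat μ : ℤ)) * (t ^ (-3 * (nStat μ : ℤ)) *
          t ^ (-3 * (nStat μ : ℤ))))) * b5
  rw [e] at h
  refine h.congr' ?_
  filter_upwards [eventually_cobounded_ne_zero] with y hy
  have hy' := pow_ne_zero (size μ) hy
  simp only [Pi.div_apply, wellPoisedRatio]
  rw [size_doubleSq, mul_comm 4, pow_mul]
  generalize y ^ size μ = w at hy' ⊢
  field_simp

end


/-! ### Nonvanishing of the sum of the leading coefficients -/

noncomputable section

variable {m n N : ℕ} {α : Fin (2 * m + 6) → ℝ} {μ : Fin n → ℕ} {x : Params m}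

/-- The term of index `μ` of the very-well-poised sum in `c = t_0²` to which the sum of the leading
coefficients reduces when no parameter `t_r` with `r ≥ 2` survives in it. -/
def wellPoisedTerm (N : ℕ) (μ : Fin n → ℕ) (q t c : ℂ) : ℂ :=
  wellPoisedRatio N μ q t c *
    (qC0 μ (t ^ n) q t * qC0 μ (q ^ (-(N : ℤ))) q t / (qCminus μ q q t * qCminus μ t q t)) *
    (q ^ N * t ^ (1 - (n : ℤ))) ^ size μ * t ^ (2 * nStat μ)

theorem prod_two_le_of_mem_balanced (hx : x ∈ balanced m n N) :
    ∏ r with 2 ≤ r, x.τ r = x.q ^ (m + 1 + N) * x.t ^ (1 - (n : ℤ)) := by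
  obtain ⟨hx0, h1, h2⟩ := hx
  have hq : x.q ≠ 0 := hx0 _
  have ht : x.t ≠ 0 := hx0 _
  rw [prod_eq_mul_prod_two_le, ← mul_assoc (x.τ 0), h1, zpow_neg, zpow_natCast] at h2
  have e : x.t ^ (2 * ((n : ℤ) - 1)) * x.t ^ (1 - (n : ℤ)) * x.t ^ (1 - (n : ℤ)) = 1 := by
    rw [← zpow_add₀ ht, ← zpow_add₀ ht]; ring_nf; simp
  have h3 := pow_ne_zero N hq
  rw [pow_add x.q (m + 1), ← h2]
  field_simp
  linear_combination -(∏ r with 2 ≤ r, x.τ r) * e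

theorem numA_add_numB (h : InFundamentalDomain α)
    (hne : ∀ r, 2 ≤ r → α r < -α 0 ∨ 1 + α 0 < α r) : numA α + numB α = 2 * m + 4 := by
  rw [← card_two_le, numA, numB, ← Finset.card_union_of_disjoint]
  · congr 1
    ext r
    simp only [Finset.mem_union, Finset.mem_filter, Finset.mem_univ, true_and]
    constructor
    · rintro (h1 | h1) <;> exact h1.1
    · intro hr
      exact (hne r hr).imp (fun h1 => ⟨hr, h1⟩) fun h1 => ⟨hr, h1⟩
  · rw [Finset.disjoint_filter]
    rintro r - ⟨-, h1⟩ ⟨-, h2⟩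
    linarith [h.lower]

/-- If no `α_r` is an integer, no parameter `t_r` with `r ≥ 2` survives in `lcZero`. -/
theorem lcZero_eq_wellPoisedTerm (hx : ∀ i, x i ≠ 0)
    (hne : ∀ r, 2 ≤ r → α r ≠ 0 ∧ α r ≠ 1) :
    lcZero n N α μ x = wellPoisedTerm N μ x.q x.t (x.τ 0 ^ 2) *
      pairMonomial n μ x ^ ((numA α : ℤ) - numB α - 1) := by
  have hq : x.q ≠ 0 := hx _
  have ht : x.t ≠ 0 := hx _
  have hτ : x.τ 0 ≠ 0 := hx _
  have e1 : (Finset.univ.filter fun r : Fin (2 * m + 6) => 2 ≤ r ∧ α r = 0) = ∅ :=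
    Finset.filter_eq_empty_iff.2 fun r _ h => (hne r h.1).1 h.2
  have e2 : (Finset.univ.filter fun r : Fin (2 * m + 6) => 2 ≤ r ∧ α r = 1) = ∅ :=
    Finset.filter_eq_empty_iff.2 fun r _ h => (hne r h.1).2 h.2
  have hZ := pairMonomial_ne_zero (n := n) (μ := μ) hx
  have key : (x.q ^ ((N : ℤ) - 1) * x.t ^ (-3 * ((n : ℤ) - 1)) * x.τ 0 ^ (-2 : ℤ)) ^ size μ *
      x.q ^ (-2 * (nStatConj μ : ℤ)) * x.t ^ (4 * nStat μ) * pairMonomial n μ x =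
      (x.q ^ N * x.t ^ (1 - (n : ℤ))) ^ size μ * x.t ^ (2 * nStat μ) := by
    have c1 : x.q ^ (-2 * (nStatConj μ : ℤ)) * x.q ^ (2 * nStatConj μ) = 1 := by
      rw [← zpow_natCast, ← zpow_add₀ hq]; push_cast; ring_nf; simp
    have c2 : x.t ^ (4 * nStat μ) * x.t ^ (-2 * (nStat μ : ℤ)) = x.t ^ (2 * nStat μ) := by
      rw [← zpow_natCast, ← zpow_add₀ ht, ← zpow_natCast]; push_cast; ring_nf
    have c3 : (x.q ^ ((N : ℤ) - 1) * x.t ^ (-3 * ((n : ℤ) - 1)) * x.τ 0 ^ (-2 : ℤ)) *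
        (x.q * x.t ^ (2 * ((n : ℤ) - 1)) * x.τ 0 ^ 2) = x.q ^ N * x.t ^ (1 - (n : ℤ)) := by
      have d1 : x.q ^ ((N : ℤ) - 1) * x.q = x.q ^ N := by
        rw [← zpow_add_one₀ hq, sub_add_cancel, zpow_natCast]
      have d2 : x.t ^ (-3 * ((n : ℤ) - 1)) * x.t ^ (2 * ((n : ℤ) - 1)) = x.t ^ (1 - (n : ℤ)) := by
        rw [← zpow_add₀ ht]; ring_nf
      have d3 : x.τ 0 ^ (-2 : ℤ) * x.τ 0 ^ 2 = 1 := by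
        rw [zpow_neg, zpow_ofNat, inv_mul_cancel₀ (pow_ne_zero 2 hτ)]
      linear_combination (x.q ^ ((N : ℤ) - 1) * x.q) * (x.t ^ (-3 * ((n : ℤ) - 1)) *
        x.t ^ (2 * ((n : ℤ) - 1))) * d3 + d1 * (x.t ^ (-3 * ((n : ℤ) - 1)) *
        x.t ^ (2 * ((n : ℤ) - 1))) + x.q ^ N * d2
    rw [pairMonomial, ← c2, ← c3, mul_pow _ (x.q * _ * _)]
    linear_combination ((x.q ^ ((N : ℤ) - 1) * x.t ^ (-3 * ((n : ℤ) - 1)) *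
      x.τ 0 ^ (-2 : ℤ)) ^ size μ * (x.q * x.t ^ (2 * ((n : ℤ) - 1)) * x.τ 0 ^ 2) ^ size μ *
      x.t ^ (4 * nStat μ) * x.t ^ (-2 * (nStat μ : ℤ))) * c1
  rw [lcZero, e1, e2, Finset.prod_empty, Finset.prod_empty, mul_one, mul_one]
  change _ * pairMonomial n μ x ^ ((numA α : ℤ) - numB α) = wellPoisedFactor n N μ x *
    prefactor n N μ x * _ * _ * _
  rw [show (numA α : ℤ) - numB α = 1 + (numA α - numB α - 1) by ring, zpow_add₀ hZ, zpow_one,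
    show (1 + ((numA α : ℤ) - numB α - 1) - 1) = numA α - numB α - 1 by ring]
  linear_combination (wellPoisedFactor n N μ x * prefactor n N μ x *
    pairMonomial n μ x ^ ((numA α : ℤ) - numB α - 1)) * key

theorem monomialFactor_eq (hx : ∀ i, x i ≠ 0) {h : ℤ} (hA : (numA α : ℤ) = m + 3 + h)
    (hB : (numB α : ℤ) = m + 1 - h) :
    monomialFactor n α μ x = (x.q ^ (-((m : ℤ) + 1))) ^ size μ * x.t ^ (2 * nStat μ) *
      pairMonomial n μ x ^ h := by
  have hq : x.q ≠ 0 := hx _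
  have ht : x.t ≠ 0 := hx _
  have hτ : x.τ 0 ≠ 0 := hx _
  have hw : -(x.t ^ ((n : ℤ) - 1) * x.τ 0) ≠ 0 :=
    neg_ne_zero.2 (mul_ne_zero (zpow_ne_zero _ ht) hτ)
  have e : x.q * x.t ^ (2 * ((n : ℤ) - 1)) * x.τ 0 ^ 2 =
      x.q * (-(x.t ^ ((n : ℤ) - 1) * x.τ 0)) ^ (2 : ℤ) := by
    rw [two_mul ((n : ℤ) - 1), zpow_add₀ ht, zpow_ofNat]; ring
  rw [monomialFactor, pairMonomial, e, hA, hB]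
  generalize -(x.t ^ ((n : ℤ) - 1) * x.τ 0) = w at hw
  simp only [mul_zpow, ← zpow_natCast, ← zpow_mul]
  have f1 : x.q ^ (-((m : ℤ) + 1 - h) * size μ) =
      x.q ^ (-((m : ℤ) + 1) * size μ) * x.q ^ ((size μ : ℤ) * h) := by
    rw [← zpow_add₀ hq]; ring_nf
  have f2 : x.t ^ (((m : ℤ) + 1 - h - (m + 3 + h) + 4) * nStat μ) =
      x.t ^ ((2 * nStat μ : ℕ) : ℤ) * x.t ^ (-2 * (nStat μ : ℤ) * h) := by
    rw [← zpow_add₀ ht]; push_cast; ring_nf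
  rw [f1, f2, show ((m : ℤ) + 3 + h - (m + 1 - h) - 2) = 2 * h by ring]
  push_cast
  ring_nf

/-- If no `α_r` equals `1 / 2`, then `z` is the product of all `t_r` with `r ≥ 2`, which is fixed by the
balancing conditions. -/
theorem lcHalfHigh_eq_wellPoisedTerm (hx : x ∈ balanced m n N) (hne : ∀ r, 2 ≤ r → α r ≠ 1 / 2)
    {h : ℤ} (hA : (numA α : ℤ) = m + 3 + h) (hB : (numB α : ℤ) = m + 1 - h) :
    lcHalfHigh n N α μ x = wellPoisedTerm N μ x.q x.t (x.τ 0 ^ 2) * pairMonomial n μ x ^ h := by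
  have hq : x.q ≠ 0 := hx.1 _
  have e1 : (Finset.univ.filter fun r : Fin (2 * m + 6) => 2 ≤ r ∧ α r = 1 / 2) = ∅ :=
    Finset.filter_eq_empty_iff.2 fun r _ h => hne r h.1 h.2
  have e2 : (Finset.univ.filter fun r : Fin (2 * m + 6) => 2 ≤ r ∧ α r ≠ 1 / 2) =
      Finset.univ.filter fun r : Fin (2 * m + 6) => 2 ≤ r :=
    Finset.filter_congr fun r _ => ⟨fun h => h.1, fun h => ⟨h, hne r h⟩⟩
  rw [lcHalfHigh, e1, e2, Finset.prod_empty, prod_two_le_of_mem_balanced hx,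
    monomialFactor_eq hx.1 hA hB]
  change _ = wellPoisedFactor n N μ x * prefactor n N μ x * _ * _ * _
  have e3 : x.q ^ (-((m : ℤ) + 1)) * (x.q ^ (m + 1 + N) * x.t ^ (1 - (n : ℤ))) =
      x.q ^ N * x.t ^ (1 - (n : ℤ)) := by
    rw [← mul_assoc, ← zpow_natCast x.q (m + 1 + N), ← zpow_add₀ hq, ← zpow_natCast x.q N]
    push_cast; ring_nf
  rw [← e3, mul_pow (x.q ^ (-((m : ℤ) + 1)))]
  ring

/-- A nonzero power of the pair monomial drives the very-well-poised term to zero as `t_0` tends to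
`0` or to infinity. -/
theorem tendsto_wellPoisedTerm_mul (hanti : Antitone μ) (hμ : μ ≠ 0) {q t : ℂ} (hq : q ≠ 0)
    (ht : t ≠ 0) {h : ℤ} (a : ℂ) {l : Filter ℂ} (hl : (0 < h ∧ l = 𝓝 0) ∨
      (h < 0 ∧ l = Bornology.cobounded ℂ)) :
    Tendsto (fun c => wellPoisedTerm N μ q t c * ((a * c) ^ size μ) ^ h) l (𝓝 0) := by
  have hs := size_ne_zero hμ
  rcases hl with ⟨hh, rfl⟩ | ⟨hh, rfl⟩
  · obtain ⟨k, rfl⟩ := Int.eq_ofNat_of_zero_le hh.le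
    have hk : k ≠ 0 := by rintro rfl; simp at hh
    have h1 : Tendsto (fun c : ℂ => ((a * c) ^ size μ) ^ (k : ℤ)) (𝓝 0) (𝓝 0) := by
      have : Continuous fun c : ℂ => ((a * c) ^ size μ) ^ (k : ℤ) := by
        simp only [zpow_natCast]; fun_prop
      simpa [hs, hk] using this.tendsto 0
    have h2 := (((tendsto_wellPoisedRatio_zero (N := N) (μ := μ) (q := q) (t := t)).mul_const
      (qC0 μ (t ^ n) q t * qC0 μ (q ^ (-(N : ℤ))) q t / (qCminus μ q q t * qCminus μ t q t))).mul_const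
      ((q ^ N * t ^ (1 - (n : ℤ))) ^ size μ)).mul_const (t ^ (2 * nStat μ))
    simpa only [wellPoisedTerm, mul_zero] using h2.mul h1
  · obtain ⟨k, hk⟩ := Int.eq_ofNat_of_zero_le (neg_nonneg.2 hh.le)
    have hk0 : k ≠ 0 := by rintro rfl; simp at hk; omega
    have h1 : Tendsto (fun c : ℂ => ((a * c) ^ size μ) ^ h) (Bornology.cobounded ℂ) (𝓝 0) := by
      have : Tendsto (fun c : ℂ => ((a⁻¹ * c⁻¹) ^ size μ) ^ k) (Bornology.cobounded ℂ)
          (𝓝 (((a⁻¹ * 0) ^ size μ) ^ k)) :=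
        (((tendsto_inv₀_cobounded (α := ℂ)).const_mul a⁻¹).pow _).pow _
      rw [mul_zero, zero_pow hs, zero_pow hk0] at this
      refine this.congr fun c => ?_
      rw [show h = -(k : ℤ) by omega, zpow_neg, zpow_natCast, ← mul_inv, inv_pow, inv_pow]
    have h2 := (((tendsto_wellPoisedRatio_cobounded (N := N) hanti hq ht).mul_const
      (qC0 μ (t ^ n) q t * qC0 μ (q ^ (-(N : ℤ))) q t / (qCminus μ q q t * qCminus μ t q t))).mul_const
      ((q ^ N * t ^ (1 - (n : ℤ))) ^ size μ)).mul_const (t ^ (2 * nStat μ))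
    simpa only [wellPoisedTerm, mul_zero] using h2.mul h1

/-- If the leading coefficients are the very-well-poised terms twisted by a nonzero power of the pair
monomial, then only the empty partition survives along the sample points with `t_0 = u i`, as `u`
tends to `0` or to infinity according to the sign of the power. -/
theorem exists_sum_ne_zero_of_pow (h : InFundamentalDomain α) (hs : slope α = 0) {k : ℤ}
    (hk : k ≠ 0) (hlc : ∀ μ ∈ boxPartitions n N, ∀ x ∈ balanced m n N, lcWeight n N α μ x =
      wellPoisedTerm N μ x.q x.t (x.τ 0 ^ 2) * pairMonomial n μ x ^ k) :
    ∃ x ∈ balanced m n N, Nondegenerate (expBound n N) x ∧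
      ∑ μ ∈ boxPartitions n N, lcWeight n N α μ x ≠ 0 := by
  obtain ⟨s, hs2, hs3, -⟩ := exists_third_index (2 : Fin (2 * m + 6)) 2
  obtain ⟨r₃, hr₃, h2, h3⟩ := exists_third_index (2 : Fin (2 * m + 6)) s
  obtain ⟨l, l', hl', hpos, hlim, hl⟩ : ∃ (l : Filter ℝ) (l' : Filter ℂ), l.NeBot ∧
      (∀ᶠ u in l, 0 < u) ∧ Tendsto (fun u : ℝ => (Complex.I * u) ^ 2) l l' ∧
      ((0 < k ∧ l' = 𝓝 0) ∨ (k < 0 ∧ l' = Bornology.cobounded ℂ)) := by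
    rcases lt_or_gt_of_ne hk with hk | hk
    · refine ⟨atTop, _, inferInstance, eventually_gt_atTop 0, ?_, .inr ⟨hk, rfl⟩⟩
      rw [← tendsto_norm_atTop_iff_cobounded]
      have : ∀ u : ℝ, ‖(Complex.I * u) ^ 2‖ = u ^ 2 := fun u => by simp
      simp only [this]
      exact tendsto_pow_atTop two_ne_zero
    · refine ⟨𝓝[>] 0, _, inferInstance, self_mem_nhdsWithin, ?_, .inl ⟨hk, rfl⟩⟩
      have : Continuous fun u : ℝ => (Complex.I * u) ^ 2 := by fun_prop
      simpa using (this.tendsto 0).mono_left nhdsWithin_le_nhds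
  refine exists_sum_ne_zero_of_tendsto h hs (l := l) (fun u : ℝ => samplePoint m n N (Complex.I * u)
    2 s r₃ ((1 : ℝ) : ℂ) ((paramProd m n N / (1 : ℝ) : ℝ) : ℂ) 1) ?_ fun μ hμ h0 => ?_
  · filter_upwards [hpos] with u hu
    exact samplePoint_real le_rfl hs2 hr₃ hs3 h2 h3 hu one_pos
  · have key := ((tendsto_wellPoisedTerm_mul (N := N) (mem_boxPartitions.1 hμ).2 h0
      (two_ne_zero (α := ℂ)) (three_ne_zero (α := ℂ)) (2 * 3 ^ (2 * ((n : ℤ) - 1))) hl).comp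
      hlim).mul_const (((2 : ℂ) ^ (2 * nStatConj μ) * 3 ^ (-2 * (nStat μ : ℤ))) ^ k)
    rw [zero_mul] at key
    refine key.congr' ?_
    filter_upwards [hpos] with u hu
    rw [hlc μ hμ _ (samplePoint_real (M := 0) le_rfl hs2 hr₃ hs3 h2 h3 hu one_pos).1, pairMonomial,
      samplePoint_q, samplePoint_t, samplePoint_τ_zero, mul_assoc (_ ^ size μ), mul_zpow (_ ^ size μ),
      Function.comp_apply, mul_assoc]

end


noncomputable section

variable {m n N : ℕ} {α : Fin (2 * m + 6) → ℝ} {μ : Fin n → ℕ} {x : Params m}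

/-- A nonempty diagram contains the box `(1, 1)`, whose factor is `1 - y`. -/
theorem qC0_one_eq_zero {k : ℕ} {l : Fin k → ℕ} (hl : Antitone l) (h0 : l ≠ 0) {y q t : ℂ}
    (hy : y = 1) : qC0 l y q t = 0 := by
  obtain ⟨i, hi⟩ := Function.ne_iff.1 h0
  have hk : 0 < k := i.pos
  have h1 : 1 ≤ l ⟨0, hk⟩ := (Nat.one_le_iff_ne_zero.2 hi).trans (hl (Fin.mk_le_of_le_val (Nat.zero_le _)))
  refine Finset.prod_eq_zero (Finset.mem_univ ⟨0, hk⟩)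
    (Finset.prod_eq_zero (Finset.mem_Icc.2 ⟨le_rfl, h1⟩) ?_)
  simp [hy]

theorem lcWeight_eq_zero_of_numFactor (h : InFundamentalDomain α) (hs : slope α = 0)
    {r : Fin (2 * m + 6)} (hr : 2 ≤ r)
    (hα : (α 0 = 0 ∧ (α r = 0 ∨ α r = 1)) ∨ (α 0 < 0 ∧ α r = -α 0))
    (h0 : numFactor n μ x r = 0) : lcWeight n N α μ x = 0 := by
  rcases hα with ⟨hα, hα' | hα'⟩ | ⟨hα, hα'⟩
  · rw [lcWeight, if_pos hα, lcZero, Finset.prod_eq_zero (i := r) (by simp [hr, hα']) (by simp [h0])]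
    simp
  · rw [lcWeight, if_pos hα, lcZero]
    exact mul_eq_zero_of_right _
      (Finset.prod_eq_zero (i := r) (by simp [hr, hα']) (by simp [h0]))
  · have h2 := two_lt_neg_of_slope_eq_zero h hs hα
    have hr3 : 3 ≤ r := three_le_iff_ne.2 ⟨hr, by rintro rfl; linarith⟩
    rw [lcWeight, if_neg hα.ne]
    split_ifs with h3 h4 h5
    · rw [lcMiddleLow, Finset.prod_eq_zero (i := r) (by simp [hr3, hα']) h0]
      simp
    · rw [lcMiddleHigh, Finset.prod_eq_zero (i := r) (by simp [hr3, hα']) h0]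
      simp
    · rw [lcHalfLow, Finset.prod_eq_zero (i := r) (by simp [hr]) (by simp [h0])]
      simp
    · have : α 0 = -(1 / 2) := le_antisymm (not_lt.1 h3) h.lower
      rw [lcHalfHigh, Finset.prod_eq_zero (i := r) (by simp [hr, hα', this]) (by simp [h0])]
      simp

/-- If a parameter `t_r` with `r ≥ 2` survives in a numerator, the specialization
`t^{n-1} t_0 t_r = 1` leaves only the term of the empty partition. -/
theorem exists_sum_ne_zero_of_numFactor (h : InFundamentalDomain α) (hs : slope α = 0)
    {r : Fin (2 * m + 6)} (hr : 2 ≤ r)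
    (hα : (α 0 = 0 ∧ (α r = 0 ∨ α r = 1)) ∨ (α 0 < 0 ∧ α r = -α 0)) :
    ∃ x ∈ balanced m n N, Nondegenerate (expBound n N) x ∧
      ∑ μ ∈ boxPartitions n N, lcWeight n N α μ x ≠ 0 := by
  obtain ⟨s, hs2, hrs, -⟩ := exists_third_index r r
  obtain ⟨r₃, hr₃, hr3, hs3⟩ := exists_third_index r s
  have hp := paramProd_pos (m := m) (n := n) (N := N)
  have h3 : (0 : ℝ) < 3 ^ ((n : ℤ) - 1) := by positivity
  have h3' : (3 : ℂ) ^ ((n : ℤ) - 1) ≠ 0 := zpow_ne_zero _ (by norm_num)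
  have hcast : (((3 : ℝ) ^ ((n : ℤ) - 1) : ℝ) : ℂ) = 3 ^ ((n : ℤ) - 1) := by push_cast; rfl
  have hp' : (paramProd m n N : ℂ) ≠ 0 := by exact_mod_cast hp.ne'
  -- `t_r = (t^{n-1} t_0)⁻¹` kills the numerator, and two further parameters restore the balancing
  -- condition; the value `-1` of `t_s` makes the value of `t_{r₃}` a negative multiple of `t_0`, so
  -- that no ratio `t_0 / t_r` is positive
  set X := samplePoint m n N Complex.I r s r₃ (3 ^ ((n : ℤ) - 1) * Complex.I)⁻¹ (-1)
    (-(paramProd m n N * 3 ^ ((n : ℤ) - 1) * Complex.I)) with hX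
  have hbal : X ∈ balanced m n N := by
    refine samplePoint_mem_balanced Complex.I_ne_zero
      (inv_ne_zero (mul_ne_zero h3' Complex.I_ne_zero)) (by norm_num)
      (neg_ne_zero.2 (mul_ne_zero (mul_ne_zero hp' h3') Complex.I_ne_zero)) hr hs2 hr₃ ?_
    have := Complex.I_ne_zero
    field_simp
  have hnd : Nondegenerate (expBound n N) X := by
    refine samplePoint_nondegenerate hrs hr3 hs3 ?_ ?_ ?_ ?_ ?_
    · exact notPositive_of_re_nonpos (by simp)
    · exact notPositive_of_im_ne_zero (by simp)
    · refine notPositive_of_re_nonpos ?_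
      rw [div_inv_eq_mul, mul_left_comm, Complex.I_mul_I, ← hcast, mul_neg_one, Complex.neg_re,
        Complex.ofReal_re]
      linarith
    · exact notPositive_of_im_ne_zero (by simp [div_neg])
    · refine notPositive_of_re_nonpos ?_
      have : Complex.I / -(paramProd m n N * 3 ^ ((n : ℤ) - 1) * Complex.I) =
          ((-(paramProd m n N * 3 ^ ((n : ℤ) - 1))⁻¹ : ℝ) : ℂ) := by
        have := Complex.I_ne_zero
        push_cast
        field_simp
      rw [this, Complex.ofReal_re]
      have := inv_pos.2 (mul_pos hp h3)
      linarith
  refine exists_sum_ne_zero_of_tendsto h hs (l := pure ()) (fun _ => X)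
    (by simpa using ⟨hbal, hnd⟩) fun μ hμ h0 => ?_
  rw [lcWeight_eq_zero_of_numFactor h hs hr hα]
  · exact tendsto_const_nhds
  · refine qC0_one_eq_zero (mem_boxPartitions.1 hμ).2 h0 ?_
    rw [hX, samplePoint_t, samplePoint_τ_zero, samplePoint_τ hr, if_pos rfl, if_neg hrs, if_neg hr3,
      mul_one, mul_one, mul_inv_cancel₀ (mul_ne_zero h3' Complex.I_ne_zero)]

/-- If every `r ≥ 2` has `α_r < -α_0` or `α_r > 1 + α_0`, then the slope is an affine function of
`A` and `B`, and its vanishing together with `A + B = 2 m + 4` determines both numbers. -/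
theorem numA_eq_of_forall (h : InFundamentalDomain α) (hs : slope α = 0) (h0 : α 0 < 0)
    (h0' : -(1 / 2) < α 0) (h2 : α 0 < α 2)
    (hne : ∀ r, 2 ≤ r → α r < -α 0 ∨ 1 + α 0 < α r) : numA α = m + 3 ∧ numB α = m + 1 := by
  have hAB := numA_add_numB h hne
  have h2' := two_lt_neg_of_slope_eq_zero h hs h0
  have hl := h.lower
  have hv : ∀ r ∈ Finset.univ.filter fun r : Fin (2 * m + 6) => 2 ≤ r,
      thetaVal (α 0 + α r) - thetaVal (1 + α 0 - α r) =
        α r + ((if α r < -α 0 then α 0 else 0) + if 1 + α 0 < α r then -1 - α 0 else 0) := by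
    intro r hr
    have hr := (mem_two_le_iff r).1 hr
    have b1 := h.two_le_apply hr
    have b2 := h.apply_le hr
    simp only [thetaVal]
    rcases hne r hr with h3 | h3
    · rw [if_pos h3, if_neg (by linarith), min_eq_left (by linarith), min_eq_left (by linarith),
        min_eq_right (by linarith), min_eq_left (by linarith)]
      ring
    · rw [if_neg (by linarith), if_pos h3, min_eq_right (by linarith), min_eq_left (by linarith),
        min_eq_left (by linarith), min_eq_left (by linarith)]
      ring
  have hcA : ∑ r with 2 ≤ r, (if α r < -α 0 then α 0 else 0) = numA α * α 0 := by
    rw [← Finset.sum_filter, Finset.filter_filter, Finset.sum_const, nsmul_eq_mul]; rfl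
  have hcB : ∑ r with 2 ≤ r, (if 1 + α 0 < α r then -1 - α 0 else 0) = numB α * (-1 - α 0) := by
    rw [← Finset.sum_filter, Finset.filter_filter, Finset.sum_const, nsmul_eq_mul]; rfl
  have e0 : thetaVal (2 * α 0) = 2 * α 0 := by
    rw [thetaVal, min_eq_left (by linarith), min_eq_left (by linarith), add_zero]
  rw [slope_eq h, Finset.sum_congr rfl hv, Finset.sum_add_distrib, Finset.sum_add_distrib, h.sum,
    hcA, hcB, e0] at hs
  have hAB' : (numA α : ℝ) + numB α = 2 * m + 4 := by exact_mod_cast hAB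
  have key : ((numA α : ℝ) - (m + 3)) * (1 + 2 * α 0) = 0 := by
    linear_combination hs + (1 + α 0) * hAB'
  have h3 : (numA α : ℝ) = m + 3 := by
    rcases mul_eq_zero.1 key with h | h <;> linarith
  have h4 : numA α = m + 3 := by exact_mod_cast h3
  omega

/-- The sample points with `t_2 = ε` and `t_s = κ / ε`, where `κ` is the product of the `t_r`, `r ≥ 2`,
prescribed by the balancing conditions. -/
theorem eventually_samplePoint {s r₃ : Fin (2 * m + 6)} (hs : 3 ≤ s) (hr₃ : 2 ≤ r₃) (h2 : 2 ≠ r₃)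
    (h3 : s ≠ r₃) : ∀ᶠ ε : ℝ in 𝓝[>] 0,
      samplePoint m n N (Complex.I * (1 : ℝ)) 2 s r₃ ε ((paramProd m n N / ε : ℝ) : ℂ) 1 ∈
        balanced m n N ∧ Nondegenerate (expBound n N)
        (samplePoint m n N (Complex.I * (1 : ℝ)) 2 s r₃ ε ((paramProd m n N / ε : ℝ) : ℂ) 1) := by
  filter_upwards [self_mem_nhdsWithin] with ε hε
  obtain ⟨hs2, hs3⟩ := three_le_iff_ne.1 hs
  exact samplePoint_real le_rfl hs2 hr₃ hs3.symm h2 h3 one_pos hε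

theorem samplePoint_τ_two {u a b : ℂ} {s r₃ : Fin (2 * m + 6)} (hs : 3 ≤ s) (h2 : 2 ≠ r₃) :
    (samplePoint m n N u 2 s r₃ a b 1).τ 2 = a := by
  rw [samplePoint_τ le_rfl, if_pos rfl, if_neg (three_le_iff_ne.1 hs).2.symm, if_neg h2]
  ring

theorem samplePoint_τ_of_three_le {u a b : ℂ} {r s r₃ : Fin (2 * m + 6)} (hr : 3 ≤ r) :
    (samplePoint m n N u 2 s r₃ a b 1).τ r = if r = s then b else 1 := by
  obtain ⟨h2, h3⟩ := three_le_iff_ne.1 hr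
  rw [samplePoint_τ h2, if_neg h3, ite_self]
  ring

theorem tendsto_inv_denFactor {s r₃ : Fin (2 * m + 6)} {r : Fin (2 * m + 6)} (hr : 3 ≤ r) :
    ∃ y, Tendsto (fun ε : ℝ => (denFactor n μ (samplePoint m n N (Complex.I * (1 : ℝ)) 2 s r₃ ε
      ((paramProd m n N / ε : ℝ) : ℂ) 1) r)⁻¹) (𝓝[>] 0) (𝓝 y) := by
  by_cases h : r = s
  · refine ⟨1⁻¹, Tendsto.inv₀ ?_ one_ne_zero⟩
    have h1 : Tendsto (fun ε : ℝ => ((ε / paramProd m n N : ℝ) : ℂ)) (𝓝[>] 0) (𝓝 0) := by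
      have : Continuous fun ε : ℝ => ((ε / paramProd m n N : ℝ) : ℂ) := by fun_prop
      simpa using (this.tendsto 0).mono_left nhdsWithin_le_nhds
    refine ((tendsto_qC0_zero μ (2 * 3 ^ ((n : ℤ) - 1) * (Complex.I * (1 : ℝ)))
      (q := 2) (t := 3)).comp h1).congr fun ε => ?_
    rw [denFactor, samplePoint_τ_of_three_le hr, if_pos h, samplePoint_q, samplePoint_t,
      samplePoint_τ_zero, Function.comp_apply, div_eq_mul_inv _ ((_ : ℝ) : ℂ), ← Complex.ofReal_inv,
      inv_div]
  · refine ⟨(qC0 μ (2 * 3 ^ ((n : ℤ) - 1) * (Complex.I * (1 : ℝ)) / 1) 2 3)⁻¹,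
      tendsto_const_nhds.congr fun ε => ?_⟩
    rw [denFactor, samplePoint_τ_of_three_le hr, if_neg h, samplePoint_q, samplePoint_t,
      samplePoint_τ_zero]

/-- Along the sample points with `t_2 = ε`, `t_s = κ / ε`, the remaining denominators stay away from
zero. -/
theorem tendsto_inv_prod_denFactor (s r₃ : Fin (2 * m + 6)) (p : Fin (2 * m + 6) → Prop)
    [DecidablePred p] :
    ∃ y, Tendsto (fun ε : ℝ => (∏ r with 3 ≤ r ∧ p r, denFactor n μ (samplePoint m n N
      (Complex.I * (1 : ℝ)) 2 s r₃ ε ((paramProd m n N / ε : ℝ) : ℂ) 1) r)⁻¹) (𝓝[>] 0) (𝓝 y) := by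
  choose! y hy using fun r (hr : r ∈ Finset.univ.filter fun r : Fin (2 * m + 6) => 3 ≤ r ∧ p r) =>
    tendsto_inv_denFactor (n := n) (N := N) (μ := μ) (s := s) (r₃ := r₃) (r := r)
      (by simp at hr; exact hr.1)
  refine ⟨∏ r with 3 ≤ r ∧ p r, y r, ?_⟩
  simp only [← Finset.prod_inv_distrib]
  exact tendsto_finsetProd _ hy

/-- If `α_2 = α_0`, the limit `t_2 → 0` leaves only the term of the empty partition, because
`denFactor` of the index `2` tends to infinity. -/
theorem exists_sum_ne_zero_middleLow (h : InFundamentalDomain α) (hs : slope α = 0) (h0 : α 0 < 0)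
    (h0' : -(1 / 2) < α 0) (h2 : α 2 = α 0) (hne : ∀ r, 2 ≤ r → α r ≠ -α 0) :
    ∃ x ∈ balanced m n N, Nondegenerate (expBound n N) x ∧
      ∑ μ ∈ boxPartitions n N, lcWeight n N α μ x ≠ 0 := by
  obtain ⟨s, hs2, hs3, -⟩ := exists_third_index (2 : Fin (2 * m + 6)) 2
  have hs' : 3 ≤ s := three_le_iff_ne.2 ⟨hs2, hs3.symm⟩
  obtain ⟨r₃, hr₃, h2', h3'⟩ := exists_third_index (2 : Fin (2 * m + 6)) s
  refine exists_sum_ne_zero_of_tendsto h hs (l := 𝓝[>] (0 : ℝ)) _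
    (eventually_samplePoint hs' hr₃ h2' h3') fun μ hμ hμ0 => ?_
  have e1 : (Finset.univ.filter fun r : Fin (2 * m + 6) => 3 ≤ r ∧ α r = -α 0) = ∅ :=
    Finset.filter_eq_empty_iff.2 fun r _ h => hne r (three_le_iff_ne.1 h.1).1 h.2
  obtain ⟨y, hy⟩ := tendsto_inv_prod_denFactor (n := n) (N := N) (μ := μ) s r₃
    fun r => α r = 1 + α 0
  have hε : Tendsto (fun ε : ℝ => ((ε : ℂ))⁻¹) (𝓝[>] 0) (Bornology.cobounded ℂ) := by
    refine tendsto_inv₀_nhdsNE_zero.comp (tendsto_nhdsWithin_iff.2 ⟨?_, ?_⟩)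
    · simpa using (Complex.continuous_ofReal.tendsto 0).mono_left nhdsWithin_le_nhds
    · filter_upwards [self_mem_nhdsWithin] with ε hε
      exact Complex.ofReal_ne_zero.2 (ne_of_gt hε)
  have hA : 2 * (3 : ℂ) ^ ((n : ℤ) - 1) * (Complex.I * (1 : ℝ)) ≠ 0 :=
    mul_ne_zero (mul_ne_zero two_ne_zero (zpow_ne_zero _ three_ne_zero))
      (mul_ne_zero Complex.I_ne_zero (by norm_num))
  have key := (((tendsto_inv_qC0 hμ0 hA two_ne_zero three_ne_zero).comp hε).mul hy).const_mul
    (qC0 μ ((3 : ℂ) ^ n) 2 3 * qC0 μ ((2 : ℂ) ^ (-(N : ℤ))) 2 3 /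
      (qCminus μ 2 2 3 * qCminus μ 3 2 3) * 3 ^ (2 * nStat μ) * 2 ^ size μ)
  rw [zero_mul, mul_zero] at key
  refine key.congr fun ε => ?_
  rw [lcWeight, if_neg h0.ne, if_pos h0', if_pos h2.le, lcMiddleLow, if_pos h2, e1,
    Finset.prod_empty, denFactor, samplePoint_τ_two hs' h2', one_div, one_div, ← mul_assoc]
  rfl

/-- If some `t_s` with `α_s` between `-α_0` and `1 + α_0` is available to compensate, the limit
`t_2 → 0` leaves only the term of the empty partition, because the base `z` of the power
`z^{|μ|}` tends to zero. -/
theorem exists_sum_ne_zero_middleHigh (h : InFundamentalDomain α) (hs : slope α = 0) (h0 : α 0 < 0)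
    (h0' : -(1 / 2) < α 0) (h2 : α 0 < α 2) (hne : ∀ r, 2 ≤ r → α r ≠ -α 0)
    {s : Fin (2 * m + 6)} (hs2 : 2 ≤ s) (hsA : -α 0 ≤ α s) (hsB : α s ≤ 1 + α 0) :
    ∃ x ∈ balanced m n N, Nondegenerate (expBound n N) x ∧
      ∑ μ ∈ boxPartitions n N, lcWeight n N α μ x ≠ 0 := by
  have hlt := two_lt_neg_of_slope_eq_zero h hs h0
  have hs' : 3 ≤ s := three_le_iff_ne.2 ⟨hs2, by rintro rfl; linarith⟩
  obtain ⟨r₃, hr₃, h2', h3'⟩ := exists_third_index (2 : Fin (2 * m + 6)) s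
  refine exists_sum_ne_zero_of_tendsto h hs (l := 𝓝[>] (0 : ℝ)) _
    (eventually_samplePoint hs' hr₃ h2' h3') fun μ hμ hμ0 => ?_
  have e1 : (Finset.univ.filter fun r : Fin (2 * m + 6) => 3 ≤ r ∧ α r = -α 0) = ∅ :=
    Finset.filter_eq_empty_iff.2 fun r _ h => hne r (three_le_iff_ne.1 h.1).1 h.2
  obtain ⟨y, hy⟩ := tendsto_inv_prod_denFactor (n := n) (N := N) (μ := μ) s r₃
    fun r => α r = 1 + α 0
  have hε : Tendsto (fun ε : ℝ => (ε : ℂ) ^ size μ) (𝓝[>] 0) (𝓝 0) := by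
    have : Continuous fun ε : ℝ => (ε : ℂ) ^ size μ := by fun_prop
    simpa [size_ne_zero hμ0] using (this.tendsto 0).mono_left nhdsWithin_le_nhds
  have key := (hy.mul hε).const_mul (qC0 μ ((3 : ℂ) ^ n) 2 3 * qC0 μ ((2 : ℂ) ^ (-(N : ℤ))) 2 3 /
      (qCminus μ 2 2 3 * qCminus μ 3 2 3) * ((2 : ℂ) ^ (-(numB α : ℤ) * size μ) *
    (-((3 : ℂ) ^ ((n : ℤ) - 1) * (Complex.I * (1 : ℝ)))) ^ (((numA α : ℤ) - numB α - 2) * size μ) *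
    (2 : ℂ) ^ (((numA α : ℤ) - numB α - 2) * nStatConj μ) *
    (3 : ℂ) ^ (((numB α : ℤ) - numA α + 4) * nStat μ)))
  rw [mul_zero, mul_zero] at key
  refine key.congr fun ε => ?_
  have p1 : ∏ r with 2 ≤ r ∧ α r < -α 0, (samplePoint m n N (Complex.I * (1 : ℝ)) 2 s r₃ ε
      ((paramProd m n N / ε : ℝ) : ℂ) 1).τ r = ε := by
    rw [Finset.prod_eq_single_of_mem 2 (by simp [hlt]), samplePoint_τ_two hs' h2']
    intro r hr hr2
    simp only [Finset.mem_filter, Finset.mem_univ, true_and] at hr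
    rw [samplePoint_τ_of_three_le (three_le_iff_ne.2 ⟨hr.1, hr2⟩), if_neg]
    rintro rfl
    linarith [hr.2]
  have p2 : ∏ r with 2 ≤ r ∧ 1 + α 0 < α r, (samplePoint m n N (Complex.I * (1 : ℝ)) 2 s r₃ ε
      ((paramProd m n N / ε : ℝ) : ℂ) 1).τ r = 1 := by
    refine Finset.prod_eq_one fun r hr => ?_
    simp only [Finset.mem_filter, Finset.mem_univ, true_and] at hr
    rw [samplePoint_τ_of_three_le (three_le_iff_ne.2 ⟨hr.1, by rintro rfl; linarith [hr.2]⟩), if_neg]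
    rintro rfl
    linarith [hr.2]
  rw [lcWeight, if_neg h0.ne, if_pos h0', if_neg h2.not_ge, lcMiddleHigh, e1, p1, p2, mul_one,
    Finset.prod_empty, one_div, mul_assoc _ _ ((ε : ℂ) ^ _)]
  rfl

/-- Outside the degenerate configurations the sum of the leading coefficients does not vanish
identically. -/
theorem exists_sum_ne_zero (h : InFundamentalDomain α) (hs : slope α = 0) (hdeg : ¬Degenerate α) :
    ∃ x ∈ balanced m n N, Nondegenerate (expBound n N) x ∧
      ∑ μ ∈ boxPartitions n N, lcWeight n N α μ x ≠ 0 := by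
  have hl := h.lower
  -- if a parameter survives in a numerator, a specialization kills all but one of the terms
  by_cases hX : ∃ r, 2 ≤ r ∧ ((α 0 = 0 ∧ (α r = 0 ∨ α r = 1)) ∨ (α 0 < 0 ∧ α r = -α 0))
  · obtain ⟨r, hr, hα⟩ := hX
    exact exists_sum_ne_zero_of_numFactor h hs hr hα
  push Not at hX
  simp only [Degenerate, not_or] at hdeg
  obtain ⟨d1, d2, d3, d4⟩ := hdeg
  rcases h.upper.eq_or_lt with h0 | h0
  · have hne : ∀ r, 2 ≤ r → α r ≠ 0 ∧ α r ≠ 1 := fun r hr => (hX r hr).1 h0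
    refine exists_sum_ne_zero_of_pow h hs (k := (numA α : ℤ) - numB α - 1) (fun hk => d1 ?_)
      fun μ hμ x hx => by rw [lcWeight, if_pos h0, lcZero_eq_wellPoisedTerm hx.1 hne]
    have hA : numA α ≠ 0 := by omega
    obtain ⟨r, hr⟩ := Finset.card_ne_zero.1 hA
    simp only [Finset.mem_filter, Finset.mem_univ, true_and] at hr
    have h2 := h.two_le_apply hr.1
    have hB : numB α = 0 := by
      rw [numB, Finset.card_eq_zero, Finset.filter_eq_empty_iff]
      rintro s - ⟨hs1, hs2⟩
      linarith [h.apply_le hs1]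
    refine ⟨h0, by omega, hB, fun s hs2 k hk => ?_⟩
    have b1 := h.neg_half_le
    have b2 := h.two_le_apply hs2
    have b3 := h.apply_le hs2
    have k1 : -1 < k := by
      have : (-1 : ℝ) < k := by linarith
      exact_mod_cast this
    have k2 : k < 1 := by
      have : (k : ℝ) < 1 := by linarith
      exact_mod_cast this
    obtain rfl : k = 0 := by omega
    exact (hne s hs2).1 (by simpa using hk)
  have hne : ∀ r, 2 ≤ r → α r ≠ -α 0 := fun r hr => (hX r hr).2 h0
  rcases hl.eq_or_lt with h0' | h0'
  · have h0' := h0'.symm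
    have h2 : -(1 / 2) < α 2 := by
      refine h.neg_half_le.lt_of_ne fun h2 => ?_
      obtain ⟨s, hs2, hs3, -⟩ := exists_third_index (2 : Fin (2 * m + 6)) 2
      refine hne s hs2 ?_
      rw [half_of_slope_eq_zero h hs h0' h2.symm (three_le_iff_ne.2 ⟨hs2, hs3.symm⟩), h0']
      norm_num
    have hhalf : ∀ r, 2 ≤ r → α r ≠ 1 / 2 := fun r hr hr' => hne r hr (by rw [hr', h0']; norm_num)
    have hAB := numA_add_numB h fun r hr => by
      rcases lt_or_gt_of_ne (hne r hr) with h3 | h3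
      · exact .inl h3
      · right; linarith
    refine exists_sum_ne_zero_of_pow h hs (k := (numA α : ℤ) - (m + 3))
      (fun hk => d4 ⟨h0', h2, by omega, by omega⟩) fun μ hμ x hx => ?_
    rw [lcWeight, if_neg h0.ne, if_neg (by rw [h0']; exact lt_irrefl _), if_neg h2.ne',
      lcHalfHigh_eq_wellPoisedTerm hx hhalf (h := (numA α : ℤ) - (m + 3)) (by ring) (by omega)]
  rcases lt_or_ge (α 0) (α 2) with h2 | h2
  · by_cases hs' : ∃ s, 2 ≤ s ∧ -α 0 ≤ α s ∧ α s ≤ 1 + α 0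
    · obtain ⟨s, hs2, hsA, hsB⟩ := hs'
      exact exists_sum_ne_zero_middleHigh h hs h0 h0' h2 hne hs2 hsA hsB
    · push Not at hs'
      exact absurd (numA_eq_of_forall h hs h0 h0' h2 fun r hr =>
        (lt_or_ge (α r) (-α 0)).imp_right (hs' r hr)) fun h3 => d3 ⟨h0', h0, h3⟩
  · rcases h2.eq_or_lt with h2 | h2
    · exact exists_sum_ne_zero_middleLow h hs h0 h0' h2 hne
    · refine absurd ⟨h0', h0, h2, fun r hr => ?_⟩ d2
      obtain ⟨hr2, -⟩ := three_le_iff_ne.1 hr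
      exact ⟨lt_of_le_of_ne (neg_le_of_slope_eq_zero h hs h0 h2.le hr) (hne r hr2).symm,
        by linarith [h.apply_le hr2]⟩

end


/-! ### Adding a box to a partition -/

noncomputable section

variable {n : ℕ} {μ : Fin n → ℕ} {i : Fin n}

theorem prod_Icc_div_of_ne_zero (f : ℕ → ℂ) {a b : ℕ} (hab : a ≤ b)
    (h : ∀ j, a ≤ j → j ≤ b → f j ≠ 0) :
    ∏ j ∈ Finset.Icc (a + 1) b, f j / f (j - 1) = f b / f a := by
  induction b, hab using Nat.le_induction with
  | base => simp [div_self (h a le_rfl le_rfl)]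
  | succ b hab ih =>
    rw [Finset.prod_Icc_succ_top (by omega), ih fun j h1 h2 => h j h1 (by omega), Nat.add_sub_cancel,
      mul_comm, div_mul_div_cancel₀ (h b hab (by omega))]

theorem conjPart_eq_of_lt_of_le (hμ : Antitone μ)
    {j : ℕ} (h1 : j ≤ μ i) (h2 : ∀ k, i < k → μ k < j) : conjPart μ j = i + 1 := by
  have : (Finset.univ.filter fun k => j ≤ μ k) = Finset.Iic i := by
    ext k
    simp only [Finset.mem_filter, Finset.mem_univ, true_and, Finset.mem_Iic]
    refine ⟨fun h => ?_, fun h => h1.trans (hμ h)⟩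
    by_contra hk
    exact absurd (h2 k (not_le.1 hk)) (not_lt.2 h)
  rw [conjPart, this, Fin.card_Iic]

/-- Telescoping along the row `i`: the columns are grouped by their lengths. -/
theorem prod_row_div (hμ : Antitone μ) (h : ℕ → ℕ → ℂ)
    (h0 : ∀ a b, a ≤ μ i → (i : ℕ) < b → b ≤ n → h a b ≠ 0) :
    ∏ j ∈ Finset.Icc 1 (μ i), h j (conjPart μ j) / h (j - 1) (conjPart μ j) =
      h (μ i) (i + 1) / h 0 n * ∏ k with i < k, h (μ k) (k + 1) / h (μ k) k := by
  obtain ⟨d, hd⟩ : ∃ d, (i : ℕ) + 1 + d = n := ⟨n - (i + 1), by have := i.isLt; omega⟩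
  induction d generalizing i with
  | zero =>
    have hlast : ∀ k, ¬ i < k := fun k hk => by
      have := k.isLt; have : (i : ℕ) < k := hk; omega
    rw [Finset.filter_false_of_mem fun k _ => hlast k, Finset.prod_empty, mul_one,
      show h 0 n = h 0 (i + 1) from congrArg _ hd.symm, ← prod_Icc_div_of_ne_zero (fun j => h j (i + 1)) (Nat.zero_le (μ i))
        fun j _ hj => h0 j _ hj (by omega) (by omega), zero_add]
    refine Finset.prod_congr rfl fun j hj => ?_
    rw [conjPart_eq_of_lt_of_le hμ (Finset.mem_Icc.1 hj).2 fun k hk => absurd hk (hlast k)]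
  | succ d ih =>
    have hi' : (i : ℕ) + 1 < n := by omega
    set i' : Fin n := ⟨i + 1, hi'⟩ with hi'_def
    have e : (i' : ℕ) = i + 1 := rfl
    have hii' : i < i' := Fin.lt_def.2 (Nat.lt_succ_self _)
    have hle : μ i' ≤ μ i := hμ hii'.le
    have hsplit : (Finset.univ.filter fun k => i < k) =
        insert i' (Finset.univ.filter fun k => i' < k) := by
      ext k
      simp only [Finset.mem_filter, Finset.mem_univ, true_and, Finset.mem_insert, Fin.lt_def,
        Fin.ext_iff, hi'_def]
      omega
    have hrest : ∏ j ∈ Finset.Icc (μ i' + 1) (μ i), h j (conjPart μ j) / h (j - 1) (conjPart μ j) =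
        h (μ i) (i + 1) / h (μ i') (i + 1) := by
      rw [← prod_Icc_div_of_ne_zero (fun j => h j (i + 1)) hle
        fun j _ hj => h0 j _ hj (by omega) (by omega)]
      refine Finset.prod_congr rfl fun j hj => ?_
      obtain ⟨h1, h2⟩ := Finset.mem_Icc.1 hj
      rw [conjPart_eq_of_lt_of_le hμ h2 fun k hk =>
        lt_of_le_of_lt (hμ (show i' ≤ k from Fin.le_def.2 hk)) h1]
    have hun : Finset.Icc 1 (μ i) = Finset.Icc 1 (μ i') ∪ Finset.Icc (μ i' + 1) (μ i) := by
      ext j; simp only [Finset.mem_union, Finset.mem_Icc]; omega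
    rw [hun, Finset.prod_union (Finset.disjoint_left.2 fun j h1 h2 => by
      simp only [Finset.mem_Icc] at h1 h2; omega), hrest,
      ih (i := i') (fun a b ha hb hb' => h0 a b (ha.trans hle) (by omega) hb') (by omega), hsplit,
      Finset.prod_insert (by simp)]
    have n1 := h0 (μ i') (i + 1) hle (by omega) (by omega)
    have n2 := h0 0 n (Nat.zero_le _) i.isLt le_rfl
    rw [e]
    field_simp

section

variable {ν : Fin n → ℕ}

/-- `ν` is obtained from `μ` by adding a box to the row `i`. -/
structure AddBox (μ ν : Fin n → ℕ) (i : Fin n) : Prop where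
  left : Antitone μ
  right : Antitone ν
  eq : ν = Function.update μ i (μ i + 1)

namespace AddBox

variable (h : AddBox μ ν i)
include h

theorem same : ν i = μ i + 1 := by rw [h.eq, Function.update_self]

theorem of_ne {k : Fin n} (hk : k ≠ i) : ν k = μ k := by rw [h.eq, Function.update_of_ne hk]

theorem lt_of_lt {k : Fin n} (hk : k < i) : μ i < μ k := by
  have := h.right hk.le
  rwa [h.same, h.of_ne hk.ne] at this

theorem conjPart_of_ne {j : ℕ} (hj : j ≠ μ i + 1) : conjPart ν j = conjPart μ j := by
  unfold conjPart
  congr 1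
  ext k
  simp only [Finset.mem_filter, Finset.mem_univ, true_and]
  by_cases hk : k = i
  · subst hk; rw [h.same]; omega
  · rw [h.of_ne hk]

theorem conjPart_right : conjPart ν (μ i + 1) = i + 1 := by
  refine conjPart_eq_of_lt_of_le h.right h.same.ge fun k hk => ?_
  rw [h.of_ne hk.ne']
  exact Nat.lt_succ_of_le (h.left hk.le)

theorem conjPart_left : conjPart μ (μ i + 1) = i := by
  have : (Finset.univ.filter fun k => μ i + 1 ≤ μ k) = Finset.Iio i := by
    ext k
    simp only [Finset.mem_filter, Finset.mem_univ, true_and, Finset.mem_Iio]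
    refine ⟨fun hk => ?_, fun hk => h.lt_of_lt hk⟩
    by_contra hk'
    have := h.left (not_lt.1 hk')
    omega
  rw [conjPart, this, Fin.card_Iio]

/-- The change of a product over boxes when a box is added: the factors of the boxes in the row
and in the column of the new box change. -/
theorem prod_box (G : Fin n → ℕ → ℕ → ℕ → ℂ)
    (h1 : ∀ j ∈ Finset.Icc 1 (μ i), G i (μ i) j (conjPart μ j) ≠ 0)
    (h2 : ∀ k, k < i → G k (μ k) (μ i + 1) i ≠ 0) :
    ∏ k, ∏ j ∈ Finset.Icc 1 (ν k), G k (ν k) j (conjPart ν j) =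
      (∏ k, ∏ j ∈ Finset.Icc 1 (μ k), G k (μ k) j (conjPart μ j)) *
      ((G i (μ i + 1) (μ i + 1) (i + 1) * ∏ j ∈ Finset.Icc 1 (μ i),
        G i (μ i + 1) j (conjPart μ j) / G i (μ i) j (conjPart μ j)) *
        ∏ k with k < i, G k (μ k) (μ i + 1) (i + 1) / G k (μ k) (μ i + 1) i) := by
  set R := G i (μ i + 1) (μ i + 1) (i + 1) * ∏ j ∈ Finset.Icc 1 (μ i),
    G i (μ i + 1) j (conjPart μ j) / G i (μ i) j (conjPart μ j) with hR
  have key : ∀ k, ∏ j ∈ Finset.Icc 1 (ν k), G k (ν k) j (conjPart ν j) =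
      (∏ j ∈ Finset.Icc 1 (μ k), G k (μ k) j (conjPart μ j)) *
      ((if k = i then R else 1) * if k < i then G k (μ k) (μ i + 1) (i + 1) /
        G k (μ k) (μ i + 1) i else 1) := by
    intro k
    rcases lt_trichotomy k i with hk | rfl | hk
    · rw [if_neg hk.ne, if_pos hk, one_mul, h.of_ne hk.ne]
      have hmem : μ i + 1 ∈ Finset.Icc 1 (μ k) :=
        Finset.mem_Icc.2 ⟨by omega, h.lt_of_lt hk⟩
      rw [← Finset.mul_prod_erase _ _ hmem, ← Finset.mul_prod_erase _ _ hmem, h.conjPart_right,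
        h.conjPart_left]
      have hp : ∏ j ∈ (Finset.Icc 1 (μ k)).erase (μ i + 1), G k (μ k) j (conjPart ν j) =
          ∏ j ∈ (Finset.Icc 1 (μ k)).erase (μ i + 1), G k (μ k) j (conjPart μ j) :=
        Finset.prod_congr rfl fun j hj => by rw [h.conjPart_of_ne (Finset.ne_of_mem_erase hj)]
      rw [hp]
      have := h2 k hk
      field_simp
    · rw [if_pos rfl, if_neg (lt_irrefl _), mul_one, h.same,
        Finset.prod_Icc_succ_top (by omega), h.conjPart_right, hR, Finset.prod_div_distrib]
      have hp : ∏ j ∈ Finset.Icc 1 (μ k), G k (μ k + 1) j (conjPart ν j) =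
          ∏ j ∈ Finset.Icc 1 (μ k), G k (μ k + 1) j (conjPart μ j) :=
        Finset.prod_congr rfl fun j hj => by
          rw [h.conjPart_of_ne (by have := (Finset.mem_Icc.1 hj).2; omega)]
      rw [hp]
      have := Finset.prod_ne_zero_iff.2 h1
      field_simp
    · rw [if_neg hk.ne', if_neg hk.not_gt, mul_one, mul_one, h.of_ne hk.ne']
      refine Finset.prod_congr rfl fun j hj => ?_
      rw [h.conjPart_of_ne]
      have := (Finset.mem_Icc.1 hj).2
      have := h.left hk.le
      omega
  rw [Finset.prod_congr rfl fun k _ => key k, Finset.prod_mul_distrib, Finset.prod_mul_distrib,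
    Finset.prod_ite_eq' Finset.univ i, if_pos (Finset.mem_univ i), Finset.prod_filter]

end AddBox

end

/-- `q^{μ_i} t^{n-i}` (parts numbered from `1`). In terms of these quantities the ratio of two terms
whose partitions differ by a box is a rational function independent of the shape of the partition. -/
def node (μ : Fin n → ℕ) (q t : ℂ) (i : Fin n) : ℂ := q ^ (μ i : ℤ) * t ^ ((n : ℤ) - 1 - i)

theorem node_ne_zero {q t : ℂ} (hq : q ≠ 0) (ht : t ≠ 0) : node μ q t i ≠ 0 :=
  mul_ne_zero (zpow_ne_zero _ hq) (zpow_ne_zero _ ht)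

theorem node_div_node {q t : ℂ} (hq : q ≠ 0) (ht : t ≠ 0) (k : Fin n) :
    node μ q t i / node μ q t k = q ^ ((μ i : ℤ) - μ k) * t ^ ((k : ℤ) - i) := by
  rw [node, node, mul_div_mul_comm, ← zpow_sub₀ hq, ← zpow_sub₀ ht]
  congr 2
  ring

theorem node_mul_node {q t : ℂ} (hq : q ≠ 0) (ht : t ≠ 0) (k : Fin n) :
    node μ q t i * node μ q t k = q ^ ((μ i : ℤ) + μ k) * t ^ (2 * (n : ℤ) - 2 - i - k) := by
  rw [node, node, mul_mul_mul_comm, ← zpow_add₀ hq, ← zpow_add₀ ht]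
  congr 2
  ring

namespace AddBox

variable {ν : Fin n → ℕ} {q t : ℂ} (h : AddBox μ ν i)
include h

theorem prod_fin {f : Fin n → ℕ → ℂ} {r : ℂ} (hr : f i (μ i + 1) = f i (μ i) * r) :
    ∏ k, f k (ν k) = (∏ k, f k (μ k)) * r := by
  have key : ∀ k, f k (ν k) = f k (μ k) * if k = i then r else 1 := by
    intro k
    split_ifs with hk
    · subst hk; rw [h.same, hr]
    · rw [h.of_ne hk, mul_one]
  rw [Finset.prod_congr rfl fun k _ => key k, Finset.prod_mul_distrib,
    Finset.prod_ite_eq' Finset.univ i, if_pos (Finset.mem_univ i)]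

theorem qC0_eq (y : ℂ) : qC0 ν y q t = qC0 μ y q t * (1 - q ^ (μ i : ℤ) * t ^ (-(i : ℤ)) * y) := by
  refine h.prod_fin (f := fun k L => ∏ j ∈ Finset.Icc 1 L,
    (1 - q ^ ((j : ℤ) - 1) * t ^ (1 - ((k : ℤ) + 1)) * y)) ?_
  rw [Finset.prod_Icc_succ_top (by omega)]
  congr 4
  · push_cast; ring_nf
  · ring_nf

theorem qC0_doubleSq_eq (y : ℂ) : qC0 (doubleSq ν) y q t = qC0 (doubleSq μ) y q t *
    ((1 - q ^ (2 * (μ i : ℤ)) * t ^ (-2 * (i : ℤ)) * y) *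
      (1 - q ^ (2 * (μ i : ℤ) + 1) * t ^ (-2 * (i : ℤ)) * y) *
      ((1 - q ^ (2 * (μ i : ℤ)) * t ^ (-2 * (i : ℤ) - 1) * y) *
      (1 - q ^ (2 * (μ i : ℤ) + 1) * t ^ (-2 * (i : ℤ) - 1) * y))) := by
  unfold qC0
  rw [prod_fin_two_mul, prod_fin_two_mul]
  simp only [doubleSq_even, doubleSq_odd]
  refine h.prod_fin (f := fun k L => (∏ j ∈ Finset.Icc 1 (2 * L),
    (1 - q ^ ((j : ℤ) - 1) * t ^ (1 - (((2 * (k : ℕ) : ℕ) : ℤ) + 1)) * y)) *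
    ∏ j ∈ Finset.Icc 1 (2 * L),
    (1 - q ^ ((j : ℤ) - 1) * t ^ (1 - (((2 * (k : ℕ) + 1 : ℕ) : ℤ) + 1)) * y)) ?_
  rw [show 2 * (μ i + 1) = 2 * μ i + 1 + 1 by ring, Finset.prod_Icc_succ_top (by omega),
    Finset.prod_Icc_succ_top (by omega), Finset.prod_Icc_succ_top (by omega),
    Finset.prod_Icc_succ_top (by omega)]
  have e1 : ((2 * μ i + 1 : ℕ) : ℤ) - 1 = 2 * (μ i : ℤ) := by push_cast; ring
  have e2 : ((2 * μ i + 1 + 1 : ℕ) : ℤ) - 1 = 2 * (μ i : ℤ) + 1 := by push_cast; ring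
  have e3 : 1 - (((2 * (i : ℕ) : ℕ) : ℤ) + 1) = -2 * (i : ℤ) := by push_cast; ring
  have e4 : 1 - (((2 * (i : ℕ) + 1 : ℕ) : ℤ) + 1) = -2 * (i : ℤ) - 1 := by push_cast; ring
  rw [e1, e2, e3, e4]
  ring

/-- The arm of a box in the row of the new box grows by one, as does the leg of a box in its column.
The row product telescopes by `prod_row_div`. -/
theorem qCminus_eq (hq : q ≠ 0) (ht : t ≠ 0) {x : ℂ}
    (hx : ∀ a b : ℕ, a ≤ μ ⟨0, i.pos⟩ → b ≤ n → q ^ (a : ℤ) * t ^ (b : ℤ) * x ≠ 1) :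
    qCminus ν x q t = qCminus μ x q t * ((1 - node μ q t i * x) *
      (∏ k with i < k, (1 - node μ q t i / node μ q t k / t * x) /
        (1 - node μ q t i / node μ q t k * x)) *
      ∏ k with k < i, (1 - node μ q t k / node μ q t i / q * x) /
        (1 - node μ q t k / node μ q t i / q / t * x)) := by
  have h0 : ∀ k, μ k ≤ μ ⟨0, i.pos⟩ := fun k => h.left (Fin.mk_le_of_le_val (Nat.zero_le _))
  have hG : ∀ a b : ℤ, 0 ≤ a → a ≤ μ ⟨0, i.pos⟩ → 0 ≤ b → b ≤ n → 1 - q ^ a * t ^ b * x ≠ 0 := by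
    intro a b ha ha' hb hb'
    obtain ⟨a, rfl⟩ := Int.eq_ofNat_of_zero_le ha
    obtain ⟨b, rfl⟩ := Int.eq_ofNat_of_zero_le hb
    exact sub_ne_zero.2 (hx a b (by omega) (by omega)).symm
  have dt : ∀ z : ℤ, t ^ z / t = t ^ (z - 1) := fun z => by
    rw [zpow_sub_one₀ ht, div_eq_mul_inv]
  have dq : ∀ z : ℤ, q ^ z / q = q ^ (z - 1) := fun z => by
    rw [zpow_sub_one₀ hq, div_eq_mul_inv]
  have hi := i.isLt
  have hi0 := h0 i
  have hbox := h.prod_box (fun k L j c => 1 - q ^ ((L : ℤ) - j) * t ^ ((c : ℤ) - ((k : ℤ) + 1)) * x)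
    (fun j hj => by
      obtain ⟨hj1, hj2⟩ := Finset.mem_Icc.1 hj
      have := lt_conjPart h.left hj2
      have := conjPart_le μ j
      exact hG _ _ (by omega) (by omega) (by omega) (by omega))
    (fun k hk => by
      have := h.lt_of_lt hk
      have := h0 k
      have : (k : ℕ) < i := hk
      exact hG _ _ (by push_cast; omega) (by push_cast; omega) (by omega) (by omega))
  have hrow := prod_row_div h.left (i := i)
    (fun j c => 1 - q ^ ((μ i : ℤ) - j) * t ^ ((c : ℤ) - ((i : ℤ) + 1)) * x)
    (fun a b ha hb hb' => hG _ _ (by omega) (by omega) (by omega) (by omega))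
  rw [qCminus, hbox, ← qCminus]
  congr 1
  congr 1
  · have e : ∀ j ∈ Finset.Icc 1 (μ i),
        (1 - q ^ (((μ i + 1 : ℕ) : ℤ) - j) * t ^ ((conjPart μ j : ℤ) - ((i : ℤ) + 1)) * x) /
          (1 - q ^ ((μ i : ℤ) - j) * t ^ ((conjPart μ j : ℤ) - ((i : ℤ) + 1)) * x) =
        ((1 - q ^ ((μ i : ℤ) - j) * t ^ ((conjPart μ j : ℤ) - ((i : ℤ) + 1)) * x) /
          (1 - q ^ ((μ i : ℤ) - ((j - 1 : ℕ) : ℤ)) * t ^ ((conjPart μ j : ℤ) - ((i : ℤ) + 1)) *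
            x))⁻¹ := by
      intro j hj
      have := (Finset.mem_Icc.1 hj).1
      rw [inv_div, show ((μ i + 1 : ℕ) : ℤ) - j = (μ i : ℤ) - ((j - 1 : ℕ) : ℤ) by
        push_cast [Nat.cast_sub this]; ring]
    rw [Finset.prod_congr rfl e, Finset.prod_inv_distrib, hrow, mul_inv, inv_div,
      ← Finset.prod_inv_distrib]
    have e1 : (1 : ℂ) - q ^ (((μ i + 1 : ℕ) : ℤ) - ((μ i + 1 : ℕ) : ℤ)) *
        t ^ (((i + 1 : ℕ) : ℤ) - ((i : ℤ) + 1)) * x = 1 - x := by simp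
    have e2 : (1 : ℂ) - q ^ ((μ i : ℤ) - (μ i : ℤ)) *
        t ^ (((i + 1 : ℕ) : ℤ) - ((i : ℤ) + 1)) * x = 1 - x := by simp
    have e3 : (1 : ℂ) - q ^ ((μ i : ℤ) - ((0 : ℕ) : ℤ)) * t ^ ((n : ℤ) - ((i : ℤ) + 1)) * x =
        1 - node μ q t i * x := by
      rw [node]; congr 4; ring
    have n1 : 1 - x ≠ 0 := by simpa using hG 0 0 le_rfl (by omega) le_rfl (by omega)
    rw [e1, e2, e3, ← mul_assoc, mul_div_cancel₀ _ n1]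
    congr 1
    refine Finset.prod_congr rfl fun k _ => ?_
    rw [inv_div, node_div_node hq ht, mul_div_assoc _ _ t, dt]
    congr 5 <;> push_cast <;> ring
  · refine Finset.prod_congr rfl fun k _ => ?_
    rw [node_div_node hq ht, mul_div_right_comm, dq, mul_div_assoc _ _ t, dt]
    push_cast
    congr 5 <;> ring_nf

/-- The counterpart of `qCminus_eq` for `C̃⁺`; the factors `q^{μ_i + j - 1} t^{2 - μ'_j - i}` of a row
telescope in the same way. -/
theorem qCplus_eq {x : ℂ}
    (hx : ∀ a b : ℤ, |a| ≤ 2 * μ ⟨0, i.pos⟩ → |b| ≤ 2 * n → q ^ a * t ^ b * x ≠ 1) :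
    qCplus ν x q t = qCplus μ x q t *
      ((1 - q ^ (2 * (μ i : ℤ) + 1) * t ^ (-2 * (i : ℤ)) * x) *
        (1 - q ^ (2 * (μ i : ℤ)) * t ^ (-2 * (i : ℤ)) * x) /
        (1 - q ^ (μ i : ℤ) * t ^ (1 - (n : ℤ) - i) * x) *
      ∏ k ∈ Finset.univ.erase i, (1 - q ^ ((μ i : ℤ) + μ k) * t ^ (-(i : ℤ) - k) * x) /
        (1 - q ^ ((μ i : ℤ) + μ k) * t ^ (1 - (i : ℤ) - k) * x)) := by
  have h0 : ∀ k, μ k ≤ μ ⟨0, i.pos⟩ := fun k => h.left (Fin.mk_le_of_le_val (Nat.zero_le _))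
  have hG : ∀ a b : ℤ, |a| ≤ 2 * μ ⟨0, i.pos⟩ → |b| ≤ 2 * n → 1 - q ^ a * t ^ b * x ≠ 0 :=
    fun a b ha hb => sub_ne_zero.2 (hx a b ha hb).symm
  have hi := i.isLt
  have hi0 := h0 i
  have hbox := h.prod_box
    (fun k L j c => 1 - q ^ ((L : ℤ) + j - 1) * t ^ (2 - (c : ℤ) - ((k : ℤ) + 1)) * x)
    (fun j hj => by
      obtain ⟨hj1, hj2⟩ := Finset.mem_Icc.1 hj
      have := lt_conjPart h.left hj2
      have := conjPart_le μ j
      exact hG _ _ (abs_le.2 ⟨by omega, by omega⟩) (abs_le.2 ⟨by omega, by omega⟩))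
    (fun k hk => by
      have := h.lt_of_lt hk
      have := h0 k
      have : (k : ℕ) < i := hk
      exact hG _ _ (abs_le.2 ⟨by push_cast; omega, by push_cast; omega⟩)
        (abs_le.2 ⟨by omega, by omega⟩))
  have hrow := prod_row_div h.left (i := i)
    (fun j c => 1 - q ^ ((μ i : ℤ) + j) * t ^ (2 - (c : ℤ) - ((i : ℤ) + 1)) * x)
    (fun a b ha hb hb' => hG _ _ (abs_le.2 ⟨by omega, by omega⟩) (abs_le.2 ⟨by omega, by omega⟩))
  have hsplit : Finset.univ.erase i = (Finset.univ.filter fun k => i < k) ∪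
      Finset.univ.filter fun k => k < i := by
    ext k
    simp only [Finset.mem_erase, Finset.mem_univ, and_true, Finset.mem_union, Finset.mem_filter,
      true_and, ne_eq]
    constructor
    · exact fun hk => (lt_or_gt_of_ne hk).symm
    · rintro (hk | hk)
      · exact hk.ne'
      · exact hk.ne
  rw [qCplus, hbox, ← qCplus, hsplit, Finset.prod_union (Finset.disjoint_filter.2 fun k _ h1 h2 =>
    absurd h1 h2.not_gt), ← mul_assoc (_ / _)]
  congr 1
  congr 1
  · have e : ∀ j ∈ Finset.Icc 1 (μ i),
        (1 - q ^ (((μ i + 1 : ℕ) : ℤ) + j - 1) * t ^ (2 - (conjPart μ j : ℤ) - ((i : ℤ) + 1)) * x) /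
          (1 - q ^ ((μ i : ℤ) + j - 1) * t ^ (2 - (conjPart μ j : ℤ) - ((i : ℤ) + 1)) * x) =
        (1 - q ^ ((μ i : ℤ) + j) * t ^ (2 - (conjPart μ j : ℤ) - ((i : ℤ) + 1)) * x) /
          (1 - q ^ ((μ i : ℤ) + ((j - 1 : ℕ) : ℤ)) *
            t ^ (2 - (conjPart μ j : ℤ) - ((i : ℤ) + 1)) * x) := by
      intro j hj
      have := (Finset.mem_Icc.1 hj).1
      rw [show ((μ i + 1 : ℕ) : ℤ) + j - 1 = (μ i : ℤ) + j by push_cast; ring,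
        show (μ i : ℤ) + j - 1 = (μ i : ℤ) + ((j - 1 : ℕ) : ℤ) by push_cast [Nat.cast_sub this]; ring]
    rw [Finset.prod_congr rfl e, hrow, ← mul_assoc, ← mul_div_assoc]
    congr 1
    · push_cast
      congr 1
      · congr 5 <;> ring
      · congr 4 <;> ring
    · refine Finset.prod_congr rfl fun k _ => ?_
      push_cast
      congr 5 <;> ring
  · refine Finset.prod_congr rfl fun k _ => ?_
    push_cast
    congr 5 <;> ring

end AddBox

end


/-! ### Detailed balance for the very-well-poised terms -/

noncomputable section

variable {n N : ℕ} {μ ν : Fin n → ℕ} {i : Fin n} {q t c : ℂ}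

/-- `q`, `t` are nonzero and satisfy no relation `q^a t^b = 1` with small exponents. -/
structure GenericBase (M : ℕ) (q t : ℂ) : Prop where
  q_ne : q ≠ 0
  t_ne : t ≠ 0
  ne_one : ∀ a b : ℤ, |a| ≤ M → |b| ≤ M → ¬(a = 0 ∧ b = 0) → q ^ a * t ^ b ≠ 1

/-- `c` is nonzero and satisfies no relation `q^a t^b c = 1` with small exponents. -/
structure GenericScalar (M : ℕ) (q t c : ℂ) : Prop where
  c_ne : c ≠ 0
  ne_one : ∀ a b : ℤ, |a| ≤ M → |b| ≤ M → q ^ a * t ^ b * c ≠ 1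

/-- The coefficient with which the box of row `i` is added to `μ`. -/
def upRate (N : ℕ) (μ : Fin n → ℕ) (q t c : ℂ) (i : Fin n) : ℂ :=
  (∏ k ∈ Finset.univ.erase i,
    (t * node μ q t i - node μ q t k) * (1 - c * t * node μ q t i * node μ q t k) /
      ((node μ q t i - node μ q t k) * (1 - c * node μ q t i * node μ q t k))) *
    ((1 - c * node μ q t i) * (q ^ N - node μ q t i / t ^ ((n : ℤ) - 1)) /
      (1 - c * node μ q t i ^ 2))

/-- The coefficient with which the last box of row `i` is removed from `μ`. -/
def downRate (N : ℕ) (μ : Fin n → ℕ) (q t c : ℂ) (i : Fin n) : ℂ :=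
  (∏ k ∈ Finset.univ.erase i,
    (node μ q t i - t * node μ q t k) * (1 - c * node μ q t i * node μ q t k / t) /
      ((node μ q t i - node μ q t k) * (1 - c * node μ q t i * node μ q t k))) *
    ((1 - node μ q t i) * (1 - q ^ N * t ^ ((n : ℤ) - 1) * c * node μ q t i) /
      (1 - c * node μ q t i ^ 2))

theorem node_sub_ne_zero (hq : q ≠ 0) (ht : t ≠ 0) {a b : ℤ} (k : Fin n)
    (h : q ^ ((μ i : ℤ) - μ k + a) * t ^ ((k : ℤ) - i + b) ≠ 1) :
    q ^ a * t ^ b * node μ q t i - node μ q t k ≠ 0 := by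
  have hk := node_ne_zero (i := k) (μ := μ) hq ht
  intro h0
  refine h ?_
  rw [zpow_add₀ hq, zpow_add₀ ht]
  have e := node_div_node (i := i) (μ := μ) hq ht k
  rw [div_eq_iff hk] at e
  have : (q ^ ((μ i : ℤ) - μ k) * q ^ a * (t ^ ((k : ℤ) - i) * t ^ b) - 1) * node μ q t k = 0 := by
    linear_combination h0 - q ^ a * t ^ b * e
  exact sub_eq_zero.1 ((mul_eq_zero.1 this).resolve_right hk)

theorem GenericScalar.one_sub_node_ne (h : GenericScalar (expBound n N) q t c) (hq : q ≠ 0)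
    (ht : t ≠ 0) (hμ : ∀ k, μ k ≤ N) {a b : ℤ} (ha : |a| ≤ N + 1) (hb : |b| ≤ n) :
    1 - q ^ a * t ^ b * c * node μ q t i ≠ 0 := by
  have hi := i.isLt
  have h1 := hμ i
  obtain ⟨ha1, ha2⟩ := abs_le.1 ha
  obtain ⟨hb1, hb2⟩ := abs_le.1 hb
  refine sub_ne_zero.2 (Ne.symm ?_)
  convert! h.ne_one (a + μ i) (b + ((n : ℤ) - 1 - i))
    (abs_le.2 ⟨by simp only [expBound]; push_cast; omega, by simp only [expBound]; push_cast; omega⟩)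
    (abs_le.2 ⟨by simp only [expBound]; push_cast; omega, by simp only [expBound]; push_cast; omega⟩)
    using 1
  rw [zpow_add₀ hq, zpow_add₀ ht, node]
  ring

theorem GenericScalar.one_sub_node_mul_node_ne (h : GenericScalar (expBound n N) q t c) (hq : q ≠ 0)
    (ht : t ≠ 0) (hμ : ∀ k, μ k ≤ N) {a b : ℤ} (ha : |a| ≤ 2) (hb : |b| ≤ 1) (k : Fin n) :
    1 - q ^ a * t ^ b * c * (node μ q t i * node μ q t k) ≠ 0 := by
  have hi := i.isLt
  have hk := k.isLt
  have h1 := hμ i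
  have h2 := hμ k
  obtain ⟨ha1, ha2⟩ := abs_le.1 ha
  obtain ⟨hb1, hb2⟩ := abs_le.1 hb
  refine sub_ne_zero.2 (Ne.symm ?_)
  convert! h.ne_one (a + (μ i + μ k)) (b + (2 * (n : ℤ) - 2 - i - k))
    (abs_le.2 ⟨by simp only [expBound]; push_cast; omega, by simp only [expBound]; push_cast; omega⟩)
    (abs_le.2 ⟨by simp only [expBound]; push_cast; omega, by simp only [expBound]; push_cast; omega⟩)
    using 1
  rw [zpow_add₀ hq, zpow_add₀ ht, node_mul_node hq ht]
  ring

/-- The factors of a row `k ≠ i` in the detailed balance equation. -/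
theorem pair_algebra {a b r s u v w z : ℂ} (ha : a ≠ 0) (hb : b ≠ 0) (hr : r ≠ 0) (hs : s ≠ 0)
    (hu : u ≠ 0) (hv : v ≠ 0) : z * w / (b * v) = a * z / (r * b) * (s * w / (u * v)) *
      (r * u / (a * s)) := by
  field_simp

/-- The factors not belonging to a row `k ≠ i` in the detailed balance equation: the `y`'s stand for
the factors `1 - …` of the box, the other letters for quantities that cancel. -/
theorem balance_algebra {Q A₁ A₂ P₁ P₂ D₁ D₂ M₁ M₂ F₁ F₂ y₁ y₂ y₃ y₄ y₅ y₆ y₇ y₈ y₉ y₁₀ y₁₁ T s z G H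
      U : ℂ} (h₁ : y₁ ≠ 0) (h₂ : y₂ ≠ 0) (h₃ : y₃ ≠ 0) (h₄ : y₄ ≠ 0) (h₅ : y₅ ≠ 0) (h₆ : y₆ ≠ 0)
    (h₇ : y₇ ≠ 0) (h₈ : y₈ ≠ 0) (h₉ : y₉ ≠ 0) (h₁₀ : y₁₀ ≠ 0) (hT : T ≠ 0) (hs : s ≠ 0)
    (hz : z ≠ 0) (hG : G ≠ 0) (hH : H ≠ 0) :
    Q * (y₂ * y₃ * (y₄ * y₅)) / (A₁ * y₇ * (A₂ * y₈) *
      (P₁ * P₂ * (y₂ * y₁ / y₆ * (y₅ * y₄ / y₇) * H))) *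
      (D₁ * y₁₀ * (D₂ * (y₁₁ / T)) / (M₁ * M₂ * (y₉ * y₁₀ * z * G))) * (F₁ * (T / s)) *
      (F₂ * (z * s)) * (G * H * U * (y₉ * y₈ / y₃)) =
    Q / (A₁ * A₂ * (P₁ * P₂)) * (D₁ * D₂ / (M₁ * M₂)) * F₁ * F₂ * (U * (y₆ * y₁₁ / y₁)) := by
  have e : Q * (y₂ * y₃ * (y₄ * y₅)) / (A₁ * y₇ * (A₂ * y₈) *
      (P₁ * P₂ * (y₂ * y₁ / y₆ * (y₅ * y₄ / y₇) * H))) =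
      Q / (A₁ * A₂ * (P₁ * P₂)) * (y₃ * y₆ / (y₁ * y₈ * H)) := by
    simp only [div_eq_mul_inv, mul_inv, inv_inv]
    field_simp
  have e' : D₁ * y₁₀ * (D₂ * (y₁₁ / T)) / (M₁ * M₂ * (y₉ * y₁₀ * z * G)) =
      D₁ * D₂ / (M₁ * M₂) * (y₁₁ / (T * y₉ * z * G)) := by
    simp only [div_eq_mul_inv, mul_inv]
    field_simp
  rw [e, e']
  generalize Q / (A₁ * A₂ * (P₁ * P₂)) = w₁
  generalize D₁ * D₂ / (M₁ * M₂) = w₂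
  field_simp

namespace AddBox

variable (h : AddBox μ ν i) (hb : GenericBase (expBound n N) q t) (hν : ∀ k, ν k ≤ N)
include h

theorem le_of_le (hν : ∀ k, ν k ≤ N) (k : Fin n) : μ k ≤ N := by
  by_cases hk : k = i
  · subst hk; have := hν k; rw [h.same] at this; omega
  · rw [← h.of_ne hk]; exact hν k

theorem node_same (hq : q ≠ 0) : node ν q t i = q * node μ q t i := by
  rw [node, node, h.same]; push_cast; rw [zpow_add_one₀ hq]; ring

theorem node_of_ne {k : Fin n} (hk : k ≠ i) : node ν q t k = node μ q t k := by
  rw [node, node, h.of_ne hk]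

include hb hν

/-- The quotient of two nodes is `q^a t^b` with `(a, b)` the difference of two distinct positions, and
no relation between `q` and `t` makes the four differences vanish. -/
theorem sub_ne_zero_of_ne {k : Fin n} (hk : k ≠ i) :
    node μ q t i - node μ q t k ≠ 0 ∧ q * node μ q t i - node μ q t k ≠ 0 ∧
      t * node μ q t i - node μ q t k ≠ 0 ∧ q * node μ q t i - t * node μ q t k ≠ 0 := by
  have hq := hb.q_ne
  have ht := hb.t_ne
  have hki : (k : ℕ) ≠ i := fun h => hk (Fin.ext h)
  have hi := i.isLt
  have hk' := k.isLt
  have h1 := h.le_of_le hν i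
  have h2 := h.le_of_le hν k
  have hlt : (k : ℕ) < i → μ i < μ k := fun hlt => h.lt_of_lt hlt
  have hgt : (i : ℕ) < k → μ k ≤ μ i := fun hgt => h.left (le_of_lt hgt)
  have key : ∀ a b : ℤ, |a| ≤ 1 → |b| ≤ 1 → ¬((μ i : ℤ) - μ k + a = 0 ∧ (k : ℤ) - i + b = 0) →
      q ^ a * t ^ b * node μ q t i - node μ q t k ≠ 0 := by
    intro a b ha hb' hab
    obtain ⟨ha1, ha2⟩ := abs_le.1 ha
    obtain ⟨hb1, hb2⟩ := abs_le.1 hb'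
    exact node_sub_ne_zero hq ht k (hb.ne_one _ _
      (abs_le.2 ⟨by simp only [expBound]; push_cast; omega, by simp only [expBound]; push_cast; omega⟩)
      (abs_le.2 ⟨by simp only [expBound]; push_cast; omega, by simp only [expBound]; push_cast; omega⟩)
      hab)
  refine ⟨?_, ?_, ?_, ?_⟩
  · simpa using key 0 0 (by norm_num) (by norm_num) (by omega)
  · simpa using key 1 0 (by norm_num) (by norm_num) (by omega)
  · simpa using key 0 1 (by norm_num) (by norm_num) (by omega)
  · have := key 1 (-1) (by norm_num) (by norm_num) (by omega)
    intro h0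
    apply this
    rw [zpow_one, zpow_neg_one]
    field_simp
    linear_combination h0

/-- The two products `C̃⁻(q)` and `C̃⁻(t)` together are symmetric in the rows above and below the new
box. -/
theorem qCminus_mul_qCminus : qCminus ν q q t * qCminus ν t q t = qCminus μ q q t * qCminus μ t q t *
    ((1 - q * node μ q t i) * (1 - t * node μ q t i) * t ^ (2 * (i : ℤ) + 1 - n) *
      ∏ k ∈ Finset.univ.erase i, (node μ q t i - node μ q t k) * (q * node μ q t i - t * node μ q t k) /
        ((t * node μ q t i - node μ q t k) * (q * node μ q t i - node μ q t k))) := by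
  have hq := hb.q_ne
  have ht := hb.t_ne
  have hi := i.isLt
  have h0 := h.le_of_le hν ⟨0, i.pos⟩
  have hX := node_ne_zero (i := i) (μ := μ) hq ht
  rw [h.qCminus_eq hq ht (x := q), h.qCminus_eq hq ht (x := t)]
  · have hsplit : Finset.univ.erase i = (Finset.univ.filter fun k => i < k) ∪
        Finset.univ.filter fun k => k < i := by
      ext k
      simp only [Finset.mem_erase, Finset.mem_univ, and_true, Finset.mem_union, Finset.mem_filter,
        true_and, ne_eq]
      exact ⟨fun hk => (lt_or_gt_of_ne hk).symm, fun hk => hk.elim (fun h => h.ne') fun h => h.ne⟩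
    rw [hsplit, Finset.prod_union (Finset.disjoint_filter.2 fun k _ h1 h2 => absurd h1 h2.not_gt)]
    have e1 : (∏ k with i < k, (1 - node μ q t i / node μ q t k / t * q) /
        (1 - node μ q t i / node μ q t k * q)) *
        (∏ k with i < k, (1 - node μ q t i / node μ q t k / t * t) /
        (1 - node μ q t i / node μ q t k * t)) = t⁻¹ ^ (n - 1 - i) *
        ∏ k with i < k, (node μ q t i - node μ q t k) * (q * node μ q t i - t * node μ q t k) /
        ((t * node μ q t i - node μ q t k) * (q * node μ q t i - node μ q t k)) := by
      have hcard : (Finset.univ.filter fun k => i < k).card = n - 1 - i := by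
        have : (Finset.univ.filter fun k => i < k) = Finset.Ioi i := by ext; simp
        rw [this, Fin.card_Ioi]
      rw [← hcard, ← Finset.prod_const, ← Finset.prod_mul_distrib, ← Finset.prod_mul_distrib]
      refine Finset.prod_congr rfl fun k hk => ?_
      have hk : i < k := by simpa using hk
      obtain ⟨n1, n2, n3, n4⟩ := h.sub_ne_zero_of_ne hb hν hk.ne'
      have hXk := node_ne_zero (i := k) (μ := μ) hq ht
      have d2 : 1 - node μ q t i / node μ q t k * q = -(q * node μ q t i - node μ q t k) /
        node μ q t k := by field_simp; ring
      have d3 : 1 - node μ q t i / node μ q t k * t = -(t * node μ q t i - node μ q t k) /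
        node μ q t k := by field_simp; ring
      rw [d2, d3]
      field_simp
      ring
    have e2 : (∏ k with k < i, (1 - node μ q t k / node μ q t i / q * q) /
        (1 - node μ q t k / node μ q t i / q / t * q)) *
        (∏ k with k < i, (1 - node μ q t k / node μ q t i / q * t) /
        (1 - node μ q t k / node μ q t i / q / t * t)) = t ^ (i : ℕ) *
        ∏ k with k < i, (node μ q t i - node μ q t k) * (q * node μ q t i - t * node μ q t k) /
        ((t * node μ q t i - node μ q t k) * (q * node μ q t i - node μ q t k)) := by
      have hcard : (Finset.univ.filter fun k => k < i).card = i := by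
        have : (Finset.univ.filter fun k => k < i) = Finset.Iio i := by ext; simp
        rw [this, Fin.card_Iio]
      have hpow : t ^ (i : ℕ) = ∏ k with k < i, t := by rw [Finset.prod_const, hcard]
      rw [hpow, ← Finset.prod_mul_distrib, ← Finset.prod_mul_distrib]
      refine Finset.prod_congr rfl fun k hk => ?_
      have hk : k < i := by simpa using hk
      obtain ⟨n1, n2, n3, n4⟩ := h.sub_ne_zero_of_ne hb hν hk.ne
      have d2 : 1 - node μ q t k / node μ q t i / q / t * q = (t * node μ q t i - node μ q t k) /
        (node μ q t i * t) := by field_simp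
      have d3 : 1 - node μ q t k / node μ q t i / q / t * t = (q * node μ q t i - node μ q t k) /
        (node μ q t i * q) := by field_simp
      rw [d2, d3]
      field_simp
    have e3 : t ^ (2 * (i : ℤ) + 1 - n) = t⁻¹ ^ (n - 1 - (i : ℕ)) * t ^ (i : ℕ) := by
      rw [inv_pow, ← zpow_natCast, ← zpow_neg, ← zpow_natCast, ← zpow_add₀ ht]
      congr 1
      rw [Nat.cast_sub (by omega), Nat.cast_sub (by omega)]
      push_cast
      ring
    rw [e3]
    linear_combination (qCminus μ q q t * qCminus μ t q t * (1 - q * node μ q t i) *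
      (1 - t * node μ q t i)) * ((∏ k with k < i, (1 - node μ q t k / node μ q t i / q * q) /
        (1 - node μ q t k / node μ q t i / q / t * q)) *
        (∏ k with k < i, (1 - node μ q t k / node μ q t i / q * t) /
        (1 - node μ q t k / node μ q t i / q / t * t)) * e1 + t⁻¹ ^ (n - 1 - (i : ℕ)) *
        (∏ k with i < k, (node μ q t i - node μ q t k) * (q * node μ q t i - t * node μ q t k) /
        ((t * node μ q t i - node μ q t k) * (q * node μ q t i - node μ q t k))) * e2)
  · intro a b ha hb'
    rw [mul_assoc, ← zpow_add_one₀ ht]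
    exact hb.ne_one _ _ (abs_le.2 ⟨by omega, by simp only [expBound]; push_cast; omega⟩)
      (abs_le.2 ⟨by omega, by simp only [expBound]; push_cast; omega⟩) (by omega)
  · intro a b ha hb'
    rw [mul_right_comm, ← zpow_add_one₀ hq]
    exact hb.ne_one _ _ (abs_le.2 ⟨by omega, by simp only [expBound]; push_cast; omega⟩)
      (abs_le.2 ⟨by omega, by simp only [expBound]; push_cast; omega⟩) (by omega)

variable (hc : GenericScalar (expBound n N) q t c)
include hc

/-- The counterpart of `qCminus_mul_qCminus` for the two factors `C̃⁺`. -/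
theorem qCplus_mul_qCplus :
    qCplus ν (t ^ (2 * ((n : ℤ) - 1)) * c) q t * qCplus ν (q * t ^ (2 * (n : ℤ) - 3) * c) q t =
    qCplus μ (t ^ (2 * ((n : ℤ) - 1)) * c) q t * qCplus μ (q * t ^ (2 * (n : ℤ) - 3) * c) q t *
      ((1 - q * c * node μ q t i ^ 2) * (1 - c * node μ q t i ^ 2) / (1 - c * node μ q t i) *
        ((1 - q ^ 2 * c * node μ q t i ^ 2 / t) * (1 - q * c * node μ q t i ^ 2 / t) /
          (1 - q * c * node μ q t i / t)) *
        ∏ k ∈ Finset.univ.erase i, (1 - c * node μ q t i * node μ q t k) *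
          (1 - q * c * node μ q t i * node μ q t k / t) /
          ((1 - c * t * node μ q t i * node μ q t k) * (1 - q * c * node μ q t i * node μ q t k))) := by
  have hq := hb.q_ne
  have ht := hb.t_ne
  have hi := i.isLt
  have h0 := h.le_of_le hν ⟨0, i.pos⟩
  have dt : ∀ z : ℤ, t ^ (z - 1) = t ^ z / t := fun z => by
    rw [zpow_sub_one₀ ht, div_eq_mul_inv]
  rw [h.qCplus_eq (x := t ^ (2 * ((n : ℤ) - 1)) * c), h.qCplus_eq (x := q * t ^ (2 * (n : ℤ) - 3) * c)]
  · have hXX : ∀ k, node μ q t i * node μ q t k =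
        q ^ ((μ i : ℤ) + μ k) * t ^ (2 * (n : ℤ) - 2 - i - k) := fun k => node_mul_node hq ht k
    have hX2 : node μ q t i ^ 2 = q ^ (2 * (μ i : ℤ)) * t ^ (2 * (n : ℤ) - 2 - 2 * i) := by
      rw [sq, hXX]; congr 2 <;> ring
    have a1 : q ^ (2 * (μ i : ℤ) + 1) * t ^ (-2 * (i : ℤ)) * (t ^ (2 * ((n : ℤ) - 1)) * c) =
        q * c * node μ q t i ^ 2 := by
      rw [hX2, zpow_add_one₀ hq,
        show 2 * (n : ℤ) - 2 - 2 * i = -2 * (i : ℤ) + 2 * ((n : ℤ) - 1) by ring, zpow_add₀ ht]; ring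
    have a2 : q ^ (2 * (μ i : ℤ)) * t ^ (-2 * (i : ℤ)) * (t ^ (2 * ((n : ℤ) - 1)) * c) =
        c * node μ q t i ^ 2 := by
      rw [hX2, show 2 * (n : ℤ) - 2 - 2 * i = -2 * (i : ℤ) + 2 * ((n : ℤ) - 1) by ring,
        zpow_add₀ ht]; ring
    have a3 : q ^ (μ i : ℤ) * t ^ (1 - (n : ℤ) - i) * (t ^ (2 * ((n : ℤ) - 1)) * c) =
        c * node μ q t i := by
      rw [node, show (n : ℤ) - 1 - i = 1 - (n : ℤ) - i + 2 * ((n : ℤ) - 1) by ring,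
        zpow_add₀ ht]; ring
    have b1 : q ^ (2 * (μ i : ℤ) + 1) * t ^ (-2 * (i : ℤ)) * (q * t ^ (2 * (n : ℤ) - 3) * c) =
        q ^ 2 * c * node μ q t i ^ 2 / t := by
      rw [hX2, zpow_add_one₀ hq, mul_div_assoc, mul_div_assoc, ← dt,
        show 2 * (n : ℤ) - 2 - 2 * i - 1 = -2 * (i : ℤ) + (2 * (n : ℤ) - 3) by ring,
        zpow_add₀ ht]; ring
    have b2 : q ^ (2 * (μ i : ℤ)) * t ^ (-2 * (i : ℤ)) * (q * t ^ (2 * (n : ℤ) - 3) * c) =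
        q * c * node μ q t i ^ 2 / t := by
      rw [hX2, mul_div_assoc, mul_div_assoc, ← dt,
        show 2 * (n : ℤ) - 2 - 2 * i - 1 = -2 * (i : ℤ) + (2 * (n : ℤ) - 3) by ring,
        zpow_add₀ ht]; ring
    have b3 : q ^ (μ i : ℤ) * t ^ (1 - (n : ℤ) - i) * (q * t ^ (2 * (n : ℤ) - 3) * c) =
        q * c * node μ q t i / t := by
      rw [node, mul_div_assoc, mul_div_assoc, ← dt,
        show (n : ℤ) - 1 - i - 1 = 1 - (n : ℤ) - i + (2 * (n : ℤ) - 3) by ring,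
        zpow_add₀ ht]; ring
    have p1 : ∀ k, q ^ ((μ i : ℤ) + μ k) * t ^ (-(i : ℤ) - k) * (t ^ (2 * ((n : ℤ) - 1)) * c) =
        c * node μ q t i * node μ q t k := fun k => by
      rw [mul_assoc c, hXX, show 2 * (n : ℤ) - 2 - i - k = -(i : ℤ) - k + 2 * ((n : ℤ) - 1) by ring,
        zpow_add₀ ht]; ring
    have p2 : ∀ k, q ^ ((μ i : ℤ) + μ k) * t ^ (1 - (i : ℤ) - k) * (t ^ (2 * ((n : ℤ) - 1)) * c) =
        c * t * node μ q t i * node μ q t k := fun k => by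
      rw [mul_assoc (c * t), hXX, mul_assoc c, mul_left_comm t, ← zpow_one_add₀ ht,
        show 1 + (2 * (n : ℤ) - 2 - i - k) = 1 - (i : ℤ) - k + 2 * ((n : ℤ) - 1) by ring,
        zpow_add₀ ht]; ring
    have p3 : ∀ k, q ^ ((μ i : ℤ) + μ k) * t ^ (-(i : ℤ) - k) * (q * t ^ (2 * (n : ℤ) - 3) * c) =
        q * c * node μ q t i * node μ q t k / t := fun k => by
      rw [mul_assoc (q * c), hXX, mul_div_assoc, mul_div_assoc, ← dt,
        show 2 * (n : ℤ) - 2 - i - k - 1 = -(i : ℤ) - k + (2 * (n : ℤ) - 3) by ring,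
        zpow_add₀ ht]; ring
    have p4 : ∀ k, q ^ ((μ i : ℤ) + μ k) * t ^ (1 - (i : ℤ) - k) * (q * t ^ (2 * (n : ℤ) - 3) * c) =
        q * c * node μ q t i * node μ q t k := fun k => by
      rw [mul_assoc (q * c), hXX,
        show 2 * (n : ℤ) - 2 - i - k = 1 - (i : ℤ) - k + (2 * (n : ℤ) - 3) by ring,
        zpow_add₀ ht]; ring
    simp only [a1, a2, a3, b1, b2, b3, p1, p2, p3, p4, Finset.prod_mul_distrib, div_eq_mul_inv, mul_inv]
    ring
  · intro a b ha hb'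
    have := hc.ne_one (a + 1) (b + (2 * (n : ℤ) - 3))
      (abs_le.2 ⟨by have := abs_le.1 ha; simp only [expBound]; push_cast; omega,
        by have := abs_le.1 ha; simp only [expBound]; push_cast; omega⟩)
      (abs_le.2 ⟨by have := abs_le.1 hb'; simp only [expBound]; push_cast; omega,
        by have := abs_le.1 hb'; simp only [expBound]; push_cast; omega⟩)
    rw [zpow_add_one₀ hq, zpow_add₀ ht] at this
    convert! this using 1
    ring
  · intro a b ha hb'
    have := hc.ne_one a (b + (2 * ((n : ℤ) - 1)))
      (abs_le.2 ⟨by have := abs_le.1 ha; simp only [expBound]; push_cast; omega,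
        by have := abs_le.1 ha; simp only [expBound]; push_cast; omega⟩)
      (abs_le.2 ⟨by have := abs_le.1 hb'; simp only [expBound]; push_cast; omega,
        by have := abs_le.1 hb'; simp only [expBound]; push_cast; omega⟩)
    rw [zpow_add₀ ht] at this
    convert! this using 1
    ring

/-- Detailed balance: the weights `wellPoisedTerm` are reversible for the box dynamics with rates
`upRate` and `downRate`. -/
theorem wellPoisedTerm_mul_downRate :
    wellPoisedTerm N ν q t c * downRate N ν q t c i =
      wellPoisedTerm N μ q t c * upRate N μ q t c i := by
  have hq := hb.q_ne
  have ht := hb.t_ne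
  have hcne := hc.c_ne
  have hμ := h.le_of_le hν
  have hi := i.isLt
  have hX := node_ne_zero (i := i) (μ := μ) hq ht
  have dt : ∀ z : ℤ, t ^ (z - 1) = t ^ z / t := fun z => by
    rw [zpow_sub_one₀ ht, div_eq_mul_inv]
  have hsize : size ν = size μ + 1 := by
    have : (∑ k, ν k) = ∑ k, (μ k + if k = i then 1 else 0) := Finset.sum_congr rfl fun k _ => by
      split_ifs with hk
      · rw [hk, h.same]
      · rw [h.of_ne hk, add_zero]
    rw [size, this, Finset.sum_add_distrib, Finset.sum_ite_eq', if_pos (Finset.mem_univ i), size]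
  have hnStat : nStat ν = nStat μ + i := by
    have : (∑ k : Fin n, (k : ℕ) * ν k) = ∑ k : Fin n, ((k : ℕ) * μ k + if k = i then (i : ℕ) else 0) :=
      Finset.sum_congr rfl fun k _ => by
        split_ifs with hk
        · rw [hk, h.same]; ring
        · rw [h.of_ne hk, add_zero]
    rw [nStat, this, Finset.sum_add_distrib, Finset.sum_ite_eq', if_pos (Finset.mem_univ i), nStat]
  have hs0 : t ^ ((n : ℤ) - 1) ≠ 0 := zpow_ne_zero _ ht
  have hT0 : q ^ N ≠ 0 := pow_ne_zero _ hq
  have htX : t * node μ q t i = q ^ (μ i : ℤ) * t ^ (-(i : ℤ)) * t ^ n := by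
    rw [node, mul_left_comm, ← zpow_one_add₀ ht, mul_assoc, ← zpow_natCast t n, ← zpow_add₀ ht]
    congr 2; ring
  have hsX : q ^ (μ i : ℤ) * t ^ (-(i : ℤ)) = node μ q t i / t ^ ((n : ℤ) - 1) := by
    rw [node, mul_div_assoc, ← zpow_sub₀ ht]
    congr 2; ring
  have hX2 : node μ q t i ^ 2 = q ^ (2 * (μ i : ℤ)) * t ^ (2 * (n : ℤ) - 2 - 2 * i) := by
    rw [sq, node_mul_node hq ht]; congr 2 <;> ring
  have c1 : q ^ (μ i : ℤ) * t ^ (-(i : ℤ)) * q ^ (-(N : ℤ)) =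
      node μ q t i / (t ^ ((n : ℤ) - 1) * q ^ N) := by
    rw [hsX, zpow_neg, zpow_natCast]; field_simp
  have c2 : q ^ (μ i : ℤ) * t ^ (-(i : ℤ)) * (q * t ^ ((n : ℤ) - 2) * c) =
      q * c * node μ q t i / t := by
    rw [node, mul_div_assoc, mul_div_assoc, ← dt,
      show (n : ℤ) - 1 - i - 1 = -(i : ℤ) + ((n : ℤ) - 2) by ring, zpow_add₀ ht]; ring
  have c3 : q ^ (μ i : ℤ) * t ^ (-(i : ℤ)) * (q ^ (N + 1) * t ^ (2 * ((n : ℤ) - 1)) * c) =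
      q * q ^ N * t ^ ((n : ℤ) - 1) * c * node μ q t i := by
    rw [hsX, two_mul ((n : ℤ) - 1), zpow_add₀ ht]; field_simp; ring
  have d1 : q ^ (2 * (μ i : ℤ)) * t ^ (-2 * (i : ℤ)) * (q * t ^ (2 * ((n : ℤ) - 1)) * c) =
      q * c * node μ q t i ^ 2 := by
    rw [hX2, show 2 * (n : ℤ) - 2 - 2 * i = -2 * (i : ℤ) + 2 * ((n : ℤ) - 1) by ring,
      zpow_add₀ ht]; ring
  have d2 : q ^ (2 * (μ i : ℤ) + 1) * t ^ (-2 * (i : ℤ)) * (q * t ^ (2 * ((n : ℤ) - 1)) * c) =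
      q ^ 2 * c * node μ q t i ^ 2 := by
    rw [zpow_add_one₀ hq]; linear_combination q * d1
  have d3 : q ^ (2 * (μ i : ℤ)) * t ^ (-2 * (i : ℤ) - 1) * (q * t ^ (2 * ((n : ℤ) - 1)) * c) =
      q * c * node μ q t i ^ 2 / t := by
    rw [← d1, dt]; ring
  have d4 : q ^ (2 * (μ i : ℤ) + 1) * t ^ (-2 * (i : ℤ) - 1) * (q * t ^ (2 * ((n : ℤ) - 1)) * c) =
      q ^ 2 * c * node μ q t i ^ 2 / t := by
    rw [← d2, dt]; ring
  have e1 : t ^ (2 * nStat ν) = t ^ (2 * nStat μ) * (t ^ (2 * (i : ℤ) + 1 - n) * t ^ ((n : ℤ) - 1)) := by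
    rw [hnStat, ← zpow_add₀ ht, mul_add, pow_add, ← zpow_natCast t (2 * (i : ℕ))]
    congr 2; push_cast; ring
  have e2 : (q ^ N * t ^ (1 - (n : ℤ))) ^ size ν = (q ^ N * t ^ (1 - (n : ℤ))) ^ size μ *
      (q ^ N / t ^ ((n : ℤ) - 1)) := by
    rw [hsize, pow_succ, show 1 - (n : ℤ) = -((n : ℤ) - 1) by ring, zpow_neg, div_eq_mul_inv]
  have hprod : ∏ k ∈ Finset.univ.erase i,
      (node ν q t i - t * node ν q t k) * (1 - c * node ν q t i * node ν q t k / t) /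
        ((node ν q t i - node ν q t k) * (1 - c * node ν q t i * node ν q t k)) =
      (∏ k ∈ Finset.univ.erase i, (node μ q t i - node μ q t k) *
        (q * node μ q t i - t * node μ q t k) /
        ((t * node μ q t i - node μ q t k) * (q * node μ q t i - node μ q t k))) *
      (∏ k ∈ Finset.univ.erase i, (1 - c * node μ q t i * node μ q t k) *
          (1 - q * c * node μ q t i * node μ q t k / t) /
          ((1 - c * t * node μ q t i * node μ q t k) * (1 - q * c * node μ q t i * node μ q t k))) *
      ∏ k ∈ Finset.univ.erase i,
        (t * node μ q t i - node μ q t k) * (1 - c * t * node μ q t i * node μ q t k) /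
        ((node μ q t i - node μ q t k) * (1 - c * node μ q t i * node μ q t k)) := by
    rw [← Finset.prod_mul_distrib, ← Finset.prod_mul_distrib]
    refine Finset.prod_congr rfl fun k hk => ?_
    have hk := Finset.ne_of_mem_erase hk
    obtain ⟨n1, n2, n3, n4⟩ := h.sub_ne_zero_of_ne hb hν hk
    have m1 : 1 - c * node μ q t i * node μ q t k ≠ 0 := by
      have := hc.one_sub_node_mul_node_ne hq ht hμ (i := i) (a := 0) (b := 0) (by norm_num)
        (by norm_num) k
      simpa [mul_assoc] using this
    have m2 : 1 - c * t * node μ q t i * node μ q t k ≠ 0 := by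
      have := hc.one_sub_node_mul_node_ne hq ht hμ (i := i) (a := 0) (b := 1) (by norm_num)
        (by norm_num) k
      rw [zpow_zero, zpow_one, one_mul] at this
      intro h0; apply this; linear_combination h0
    rw [h.node_same hq, h.node_of_ne hk]
    rcases eq_or_ne (1 - q * c * node μ q t i * node μ q t k) 0 with m3 | m3
    · rw [show c * (q * node μ q t i) * node μ q t k = q * c * node μ q t i * node μ q t k by ring, m3]
      simp
    · rw [show c * (q * node μ q t i) * node μ q t k = q * c * node μ q t i * node μ q t k by ring]
      exact pair_algebra n1 n2 n3 m1 m2 m3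
  have hG : ∏ k ∈ Finset.univ.erase i, (node μ q t i - node μ q t k) *
        (q * node μ q t i - t * node μ q t k) /
        ((t * node μ q t i - node μ q t k) * (q * node μ q t i - node μ q t k)) ≠ 0 :=
    Finset.prod_ne_zero_iff.2 fun k hk => by
      obtain ⟨n1, n2, n3, n4⟩ := h.sub_ne_zero_of_ne hb hν (Finset.ne_of_mem_erase hk)
      exact div_ne_zero (mul_ne_zero n1 n4) (mul_ne_zero n3 n2)
  have hH : ∏ k ∈ Finset.univ.erase i, (1 - c * node μ q t i * node μ q t k) *
          (1 - q * c * node μ q t i * node μ q t k / t) /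
          ((1 - c * t * node μ q t i * node μ q t k) * (1 - q * c * node μ q t i * node μ q t k)) ≠ 0 :=
    Finset.prod_ne_zero_iff.2 fun k hk => by
      have key : ∀ a b : ℤ, |a| ≤ 2 → |b| ≤ 1 → _ := fun a b ha hb =>
        hc.one_sub_node_mul_node_ne hq ht hμ (i := i) (a := a) (b := b) ha hb k
      refine div_ne_zero (mul_ne_zero ?_ ?_) (mul_ne_zero ?_ ?_)
      · have := key 0 0 (by norm_num) (by norm_num)
        simpa [mul_assoc] using this
      · have := key 1 (-1) (by norm_num) (by norm_num)
        rw [zpow_one, zpow_neg_one] at this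
        intro h0; apply this; rw [← h0]; field_simp
      · have := key 0 1 (by norm_num) (by norm_num)
        rw [zpow_zero, zpow_one, one_mul] at this
        intro h0; apply this; linear_combination h0
      · have := key 1 0 (by norm_num) (by norm_num)
        rw [zpow_zero, zpow_one, mul_one] at this
        intro h0; apply this; linear_combination h0
  have sq : ∀ a b : ℤ, |a| ≤ 2 → |b| ≤ 1 → 1 - q ^ a * t ^ b * c * node μ q t i ^ 2 ≠ 0 := by
    intro a b ha hb'
    have := hc.one_sub_node_mul_node_ne hq ht hμ (i := i) (a := a) (b := b) ha hb' i
    rwa [← _root_.sq] at this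
  have g1 : 1 - c * node μ q t i ^ 2 ≠ 0 := by simpa using sq 0 0 (by norm_num) (by norm_num)
  have g2 : 1 - q * c * node μ q t i ^ 2 ≠ 0 := by simpa using sq 1 0 (by norm_num) (by norm_num)
  have g3 : 1 - q ^ 2 * c * node μ q t i ^ 2 ≠ 0 := by
    have := sq 2 0 (by norm_num) (by norm_num)
    rwa [zpow_zero, mul_one, zpow_ofNat] at this
  have g4 : 1 - q * c * node μ q t i ^ 2 / t ≠ 0 := by
    have := sq 1 (-1) (by norm_num) (by norm_num)
    rw [zpow_one, zpow_neg_one] at this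
    intro h0; apply this; rw [← h0]; field_simp
  have g5 : 1 - q ^ 2 * c * node μ q t i ^ 2 / t ≠ 0 := by
    have := sq 2 (-1) (by norm_num) (by norm_num)
    rw [zpow_ofNat, zpow_neg_one] at this
    intro h0; apply this; rw [← h0]; field_simp
  have g6 : 1 - c * node μ q t i ≠ 0 := by
    simpa using hc.one_sub_node_ne hq ht hμ (i := i) (a := 0) (b := 0) (by simp; omega) (by simp)
  have g7 : 1 - q * c * node μ q t i / t ≠ 0 := by
    have := hc.one_sub_node_ne hq ht hμ (i := i) (a := 1) (b := -1) (by simp) (by simp; omega)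
    rw [zpow_one, zpow_neg_one] at this
    intro h0; apply this; rw [← h0]; field_simp
  have g8 : 1 - q * q ^ N * t ^ ((n : ℤ) - 1) * c * node μ q t i ≠ 0 := by
    have := hc.one_sub_node_ne hq ht hμ (i := i) (a := N + 1) (b := n - 1)
      (abs_le.2 ⟨by omega, by omega⟩) (abs_le.2 ⟨by omega, by omega⟩)
    rw [zpow_add_one₀ hq, zpow_natCast, mul_comm (q ^ N)] at this
    exact this
  have hbase : ∀ a b : ℤ, |a| ≤ 1 → |b| ≤ 1 → 0 < (μ i : ℤ) + a ∨ 0 < (n : ℤ) - 1 - i + b →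
      1 - q ^ a * t ^ b * node μ q t i ≠ 0 := by
    intro a b ha hb' hpos
    obtain ⟨ha1, ha2⟩ := abs_le.1 ha
    obtain ⟨hb1, hb2⟩ := abs_le.1 hb'
    have h1 := hμ i
    refine sub_ne_zero.2 (Ne.symm ?_)
    have := hb.ne_one ((μ i : ℤ) + a) ((n : ℤ) - 1 - i + b)
      (abs_le.2 ⟨by simp only [expBound]; push_cast; omega, by simp only [expBound]; push_cast; omega⟩)
      (abs_le.2 ⟨by simp only [expBound]; push_cast; omega, by simp only [expBound]; push_cast; omega⟩)
      (by omega)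
    rw [zpow_add₀ hq, zpow_add₀ ht] at this
    rw [node]
    intro h0; apply this; rw [← h0]; ring
  have g9 : 1 - q * node μ q t i ≠ 0 := by
    simpa using hbase 1 0 (by norm_num) (by norm_num) (.inl (by omega))
  have g10 : 1 - t * node μ q t i ≠ 0 := by
    simpa using hbase 0 1 (by norm_num) (by norm_num) (.inr (by omega))
  have hz := zpow_ne_zero (2 * (i : ℤ) + 1 - n) ht
  have hm := h.qCminus_mul_qCminus hb hν
  have hp := h.qCplus_mul_qCplus hb hν hc
  rw [wellPoisedTerm, wellPoisedTerm, wellPoisedRatio, wellPoisedRatio, hm, hp, h.qC0_eq, h.qC0_eq,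
    h.qC0_eq, h.qC0_eq, h.qC0_doubleSq_eq, downRate, upRate, hprod, h.node_same hq, c1, c2, c3, d1, d2,
    d3, d4, ← htX, e1, e2]
  have k1 : 1 - node μ q t i / (t ^ ((n : ℤ) - 1) * q ^ N) =
      (q ^ N - node μ q t i / t ^ ((n : ℤ) - 1)) / q ^ N := by field_simp
  have k2 : 1 - c * (q * node μ q t i) ^ 2 = 1 - q ^ 2 * c * node μ q t i ^ 2 := by ring
  have k3 : 1 - q ^ N * t ^ ((n : ℤ) - 1) * c * (q * node μ q t i) =
      1 - q * q ^ N * t ^ ((n : ℤ) - 1) * c * node μ q t i := by ring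
  rw [k1, k2, k3]
  exact balance_algebra g1 g2 g3 g4 g5 g6 g7 g8 g9 g10 hT0 hs0 hz hG hH

end AddBox

end


/-! ### The sum of the rates -/

noncomputable section

theorem prod_univ_erase_inl {α β : Type*} [Fintype α] [Fintype β] [DecidableEq α] [DecidableEq β]
    (f : α ⊕ β → ℂ) (i : α) : ∏ j ∈ Finset.univ.erase (Sum.inl i), f j =
      (∏ k ∈ Finset.univ.erase i, f (Sum.inl k)) * ∏ k, f (Sum.inr k) := by
  have : (Finset.univ.erase (Sum.inl i) : Finset (α ⊕ β)) =
      (Finset.univ.erase i).disjSum Finset.univ := by ext (a | b) <;> simp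
  rw [this, Finset.prod_disjSum]

theorem prod_univ_erase_inr {α β : Type*} [Fintype α] [Fintype β] [DecidableEq α] [DecidableEq β]
    (f : α ⊕ β → ℂ) (i : β) : ∏ j ∈ Finset.univ.erase (Sum.inr i), f j =
      (∏ k, f (Sum.inl k)) * ∏ k ∈ Finset.univ.erase i, f (Sum.inr k) := by
  have : (Finset.univ.erase (Sum.inr i) : Finset (α ⊕ β)) =
      Finset.univ.disjSum (Finset.univ.erase i) := by ext (a | b) <;> simp
  rw [this, Finset.prod_disjSum]

section

variable {n : ℕ} (X : Fin n → ℂ) (c t T s ρ : ℂ)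

/-- The interpolation nodes `X_k`, `1 / (c X_k)`, `0`, `ρ`, `-ρ`. -/
def rateNode : Fin n ⊕ (Fin n ⊕ Fin 3) → ℂ :=
  Sum.elim X (Sum.elim (fun k => (c * X k)⁻¹) ![0, ρ, -ρ])

/-- The polynomial `∏ (t y - X_k) (1 - c t X_k y) (1 - c y) (T - y / s)` in `y`. -/
def ratePoly : Polynomial ℂ :=
  (∏ k, (Polynomial.C (-(c * t ^ 2 * X k)) * Polynomial.X ^ 2 +
    Polynomial.C (t + c * t * X k ^ 2) * Polynomial.X + Polynomial.C (-X k))) *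
    (Polynomial.C (c / s) * Polynomial.X ^ 2 + Polynomial.C (-(1 / s) - c * T) * Polynomial.X +
      Polynomial.C T)

theorem eval_ratePoly (y : ℂ) : (ratePoly X c t T s).eval y =
    (∏ k, (t * y - X k) * (1 - c * t * y * X k)) * ((1 - c * y) * (T - y / s)) := by
  simp only [ratePoly, Polynomial.eval_mul, Polynomial.eval_prod, Polynomial.eval_add,
    Polynomial.eval_C, Polynomial.eval_X, Polynomial.eval_pow]
  congr 1
  · exact Finset.prod_congr rfl fun k _ => by ring
  · ring

theorem natDegree_ratePoly_le : (ratePoly X c t T s).natDegree ≤ n * 2 + 2 := by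
  refine Polynomial.natDegree_mul_le_of_le ?_ Polynomial.natDegree_quadratic_le
  refine (Polynomial.natDegree_prod_le _ _).trans ?_
  refine (Finset.sum_le_card_nsmul _ _ 2 fun k _ => Polynomial.natDegree_quadratic_le).trans ?_
  simp

theorem coeff_ratePoly : (ratePoly X c t T s).coeff (n * 2 + 2) =
    (∏ k, -(c * t ^ 2 * X k)) * (c / s) := by
  have h1 : ∀ a b d : ℂ, (Polynomial.C a * Polynomial.X ^ 2 + Polynomial.C b * Polynomial.X +
      Polynomial.C d).coeff 2 = a := fun a b d => by simp
  have h2 := Polynomial.coeff_prod_of_natDegree_le (Finset.univ : Finset (Fin n))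
    (fun k => Polynomial.C (-(c * t ^ 2 * X k)) * Polynomial.X ^ 2 +
    Polynomial.C (t + c * t * X k ^ 2) * Polynomial.X + Polynomial.C (-X k)) 2
    fun k _ => Polynomial.natDegree_quadratic_le
  rw [Finset.card_univ, Fintype.card_fin] at h2
  rw [ratePoly, Polynomial.coeff_mul_add_eq_of_natDegree_le ?_ Polynomial.natDegree_quadratic_le, h2, h1]
  · simp only [h1]
  · refine (Polynomial.natDegree_prod_le _ _).trans ?_
    refine (Finset.sum_le_card_nsmul _ _ 2 fun k _ => Polynomial.natDegree_quadratic_le).trans ?_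
    simp

variable {X c t T s ρ}

theorem rateNode_injective (hX : ∀ i, X i ≠ 0) (hinj : Function.Injective X) (hc : c ≠ 0)
    (hρ0 : ρ ≠ 0) (h1 : ∀ i k, 1 - c * X i * X k ≠ 0) (h2 : ∀ i, X i ^ 2 ≠ ρ ^ 2)
    (h3 : ∀ i, (c * X i)⁻¹ ^ 2 ≠ ρ ^ 2) : Function.Injective (rateNode X c ρ) := by
  have hcX : ∀ i, c * X i ≠ 0 := fun i => mul_ne_zero hc (hX i)
  refine hinj.sumElim (Function.Injective.sumElim ?_ ?_ ?_) ?_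
  · intro i k h
    exact hinj (mul_left_cancel₀ hc (inv_injective h))
  · intro a b h
    fin_cases a <;> fin_cases b <;>
      simp_all [eq_comm (a := (0 : ℂ)), self_eq_neg, neg_eq_self]
  · intro i b h
    fin_cases b
    · exact inv_ne_zero (hcX i) h
    · exact h3 i (congrArg (· ^ 2) h)
    · exact h3 i ((congrArg (· ^ 2) h).trans (neg_sq ρ))
  · rintro i (k | b) h
    · refine h1 i k (sub_eq_zero.2 ?_)
      have h : X i = (c * X k)⁻¹ := h
      rw [mul_right_comm, h, mul_inv_cancel₀ (hcX k)]
    · fin_cases b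
      · exact hX i h
      · exact h2 i (congrArg (· ^ 2) h)
      · exact h2 i ((congrArg (· ^ 2) h).trans (neg_sq ρ))

/-- The interpolation term at the node `X_i`. -/
theorem rate_term_inl {i : Fin n} (hX : ∀ i, X i ≠ 0) (hinj : Function.Injective X) (hc : c ≠ 0)
    (ht : t ≠ 0) (hρ : c * t * ρ ^ 2 = 1) (h1 : ∀ i k, 1 - c * X i * X k ≠ 0)
    (h2 : ∀ i, 1 - c * t * X i * X i ≠ 0) :
    (ratePoly X c t T s).eval (X i) / ((∏ k ∈ Finset.univ.erase i, (X i - X k)) *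
      ((∏ k, (X i - (c * X k)⁻¹)) * (X i * (X i - ρ) * (X i + ρ)))) =
    (∏ k, -(c * X k)) * -(c * t) * ((t - 1) *
      ((∏ k ∈ Finset.univ.erase i, (t * X i - X k) * (1 - c * t * X i * X k) /
        ((X i - X k) * (1 - c * X i * X k))) *
          ((1 - c * X i) * (T - X i / s) / (1 - c * X i ^ 2)))) := by
  have hi := hX i
  have e1 : (∏ k ∈ Finset.univ.erase i, (t * X i - X k) * (1 - c * t * X i * X k)) /
      ((∏ k ∈ Finset.univ.erase i, (X i - X k)) *
        ∏ k ∈ Finset.univ.erase i, (X i - (c * X k)⁻¹)) =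
      (∏ k ∈ Finset.univ.erase i, -(c * X k)) *
        ∏ k ∈ Finset.univ.erase i, (t * X i - X k) * (1 - c * t * X i * X k) /
        ((X i - X k) * (1 - c * X i * X k)) := by
    rw [← Finset.prod_mul_distrib, ← Finset.prod_div_distrib, ← Finset.prod_mul_distrib]
    refine Finset.prod_congr rfl fun k hk => ?_
    have n1 : X i - X k ≠ 0 := sub_ne_zero.2 fun h => (Finset.ne_of_mem_erase hk) (hinj h).symm
    have n2 := h1 i k
    have n3 := hX k
    rw [show X i - (c * X k)⁻¹ = (1 - c * X i * X k) / -(c * X k) by field_simp; ring]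
    field_simp
  have e2 : (t * X i - X i) * (1 - c * t * X i * X i) * ((1 - c * X i) * (T - X i / s)) /
      ((X i - (c * X i)⁻¹) * (X i * (X i - ρ) * (X i + ρ))) =
      -(c * X i) * -(c * t) * (t - 1) * ((1 - c * X i) * (T - X i / s) / (1 - c * X i ^ 2)) := by
    have n1 := h1 i i
    have n2 := h2 i
    have d1 : X i - (c * X i)⁻¹ = (1 - c * X i * X i) / -(c * X i) := by field_simp; ring
    have d2 : X i * (X i - ρ) * (X i + ρ) = X i * (1 - c * t * X i * X i) / -(c * t) := by
      rw [eq_div_iff (neg_ne_zero.2 (mul_ne_zero hc ht))]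
      linear_combination X i * hρ
    have d3 : 1 - c * X i ^ 2 = 1 - c * X i * X i := by ring
    rw [d1, d2, d3]
    generalize T - X i / s = z
    generalize 1 - c * X i = z'
    generalize 1 - c * t * X i * X i = u at n2
    generalize 1 - c * X i * X i = u' at n1
    field_simp
  rw [eval_ratePoly, ← Finset.mul_prod_erase _ _ (Finset.mem_univ i),
    ← Finset.mul_prod_erase Finset.univ (fun k => X i - (c * X k)⁻¹) (Finset.mem_univ i),
    ← Finset.mul_prod_erase Finset.univ (fun k => -(c * X k)) (Finset.mem_univ i)]
  have split : ∀ a b R A B B' D : ℂ, a * b * R / (A * (B * B' * D)) =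
      b / (A * B') * (a * R / (B * D)) := fun a b R A B B' D => by
    simp only [div_eq_mul_inv, mul_inv]; ring
  rw [split, e1, e2]
  ring

/-- The interpolation term at the node `1 / (c X_i)`. -/
theorem rate_term_inr {i : Fin n} (hX : ∀ i, X i ≠ 0) (hinj : Function.Injective X) (hc : c ≠ 0)
    (ht : t ≠ 0) (hs : s * t = t ^ n) (hρ : c * t * ρ ^ 2 = 1) (h1 : ∀ i k, 1 - c * X i * X k ≠ 0)
    (h3 : ∀ i, t - c * X i * X i ≠ 0) :
    (ratePoly X c t T s).eval (c * X i)⁻¹ / ((∏ k, ((c * X i)⁻¹ - X k)) *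
      ((∏ k ∈ Finset.univ.erase i, ((c * X i)⁻¹ - (c * X k)⁻¹)) *
        ((c * X i)⁻¹ * ((c * X i)⁻¹ - ρ) * ((c * X i)⁻¹ + ρ)))) =
    -((∏ k, -(c * X k)) * -(c * t) * ((t - 1) *
      ((∏ k ∈ Finset.univ.erase i, (X i - t * X k) * (1 - c * X i * X k / t) /
        ((X i - X k) * (1 - c * X i * X k))) *
          ((1 - X i) * (1 - T * s * c * X i) / (1 - c * X i ^ 2))))) := by
  have hi := hX i
  have hn : n = n - 1 + 1 := by have := i.pos; omega
  have hs0 : s ≠ 0 := by rintro rfl; rw [zero_mul] at hs; exact pow_ne_zero n ht hs.symm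
  have hs' : ∏ k ∈ Finset.univ.erase i, t = s := by
    rw [Finset.prod_const, Finset.card_erase_of_mem (Finset.mem_univ i), Finset.card_univ,
      Fintype.card_fin]
    rw [hn, pow_succ] at hs
    exact (mul_right_cancel₀ ht hs).symm
  have e1 : (∏ k ∈ Finset.univ.erase i,
      (t * (c * X i)⁻¹ - X k) * (1 - c * t * (c * X i)⁻¹ * X k)) /
      ((∏ k ∈ Finset.univ.erase i, ((c * X i)⁻¹ - X k)) *
        ∏ k ∈ Finset.univ.erase i, ((c * X i)⁻¹ - (c * X k)⁻¹)) =
      (∏ k ∈ Finset.univ.erase i, -(c * X k)) * s *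
        ∏ k ∈ Finset.univ.erase i, (X i - t * X k) * (1 - c * X i * X k / t) /
        ((X i - X k) * (1 - c * X i * X k)) := by
    rw [← hs', ← Finset.prod_mul_distrib, ← Finset.prod_div_distrib, ← Finset.prod_mul_distrib,
      ← Finset.prod_mul_distrib]
    refine Finset.prod_congr rfl fun k hk => ?_
    have n1 : X i - X k ≠ 0 := sub_ne_zero.2 fun h => (Finset.ne_of_mem_erase hk) (hinj h).symm
    have n2 := h1 i k
    have n3 := hX k
    have d1 : t * (c * X i)⁻¹ - X k = t * (1 - c * X i * X k / t) / (c * X i) := by field_simp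
    have d2 : 1 - c * t * (c * X i)⁻¹ * X k = (X i - t * X k) / X i := by field_simp
    have d3 : (c * X i)⁻¹ - X k = (1 - c * X i * X k) / (c * X i) := by field_simp
    have d4 : (c * X i)⁻¹ - (c * X k)⁻¹ = (X i - X k) / -(c * X i * X k) := by field_simp; ring
    rw [d1, d2, d3, d4]
    generalize 1 - c * X i * X k / t = z
    field_simp
  have e2 : (t * (c * X i)⁻¹ - X i) * (1 - c * t * (c * X i)⁻¹ * X i) *
      ((1 - c * (c * X i)⁻¹) * (T - (c * X i)⁻¹ / s)) / (((c * X i)⁻¹ - X i) *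
        ((c * X i)⁻¹ * ((c * X i)⁻¹ - ρ) * ((c * X i)⁻¹ + ρ))) * s =
      -(-(c * X i) * -(c * t) * (t - 1) *
        ((1 - X i) * (1 - T * s * c * X i) / (1 - c * X i ^ 2))) := by
    have n1 := h1 i i
    have n2 := h3 i
    have d1 : t * (c * X i)⁻¹ - X i = (t - c * X i * X i) / (c * X i) := by field_simp
    have d2 : 1 - c * t * (c * X i)⁻¹ * X i = 1 - t := by field_simp
    have d3 : (c * X i)⁻¹ - X i = (1 - c * X i * X i) / (c * X i) := by field_simp
    have d4 : (c * X i)⁻¹ * ((c * X i)⁻¹ - ρ) * ((c * X i)⁻¹ + ρ) =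
        (t - c * X i * X i) / (c ^ 3 * t * X i ^ 3) := by
      rw [eq_div_iff (by positivity)]
      have : (c * X i)⁻¹ * ((c * X i)⁻¹ - ρ) * ((c * X i)⁻¹ + ρ) * (c ^ 3 * t * X i ^ 3) =
          t - c * X i * X i * (c * t * ρ ^ 2) := by field_simp; ring
      rw [this, hρ, mul_one]
    have d5 : 1 - c * (c * X i)⁻¹ = -(1 - X i) / X i := by field_simp; ring
    have d6 : T - (c * X i)⁻¹ / s = -(1 - T * s * c * X i) / (c * s * X i) := by field_simp; ring
    rw [d1, d2, d3, d4, d5, d6, show 1 - c * X i ^ 2 = 1 - c * X i * X i by ring]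
    generalize 1 - T * s * c * X i = z
    generalize 1 - X i = z'
    generalize t - c * X i * X i = u at n2
    generalize 1 - c * X i * X i = u' at n1
    field_simp
    ring
  rw [eval_ratePoly, ← Finset.mul_prod_erase _ _ (Finset.mem_univ i),
    ← Finset.mul_prod_erase Finset.univ (fun k => (c * X i)⁻¹ - X k) (Finset.mem_univ i),
    ← Finset.mul_prod_erase Finset.univ (fun k => -(c * X k)) (Finset.mem_univ i)]
  have split : ∀ a b R A B B' D : ℂ, a * b * R / (B * B' * (A * D)) =
      b / (B' * A) * (a * R / (B * D)) := fun a b R A B B' D => by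
    simp only [div_eq_mul_inv, mul_inv]; ring
  rw [split, e1]
  linear_combination ((∏ k ∈ Finset.univ.erase i, -(c * X k)) *
    ∏ k ∈ Finset.univ.erase i, (X i - t * X k) * (1 - c * X i * X k / t) /
        ((X i - X k) * (1 - c * X i * X k))) * e2

/-- At the two zeros `y` of `1 - c t y²` every factor of the product has the same value: the numerator
and the denominator of the factor of index `k` are proportional. -/
theorem rate_prod_of_sq {y : ℂ} (hX : ∀ i, X i ≠ 0) (hc : c ≠ 0)
    (hy : c * t * y ^ 2 = 1) (n1 : ∀ k, y - X k ≠ 0) (n2 : ∀ k, t * y - X k ≠ 0) :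
    (∏ k, (t * y - X k) * (1 - c * t * y * X k)) / ((∏ k, (y - X k)) * ∏ k, (y - (c * X k)⁻¹)) =
      (∏ k, -(c * X k)) * t ^ n := by
  have hpow : t ^ n = ∏ _k : Fin n, t := by simp
  have hy0 : y ≠ 0 := by rintro rfl; simp at hy
  rw [hpow, ← Finset.prod_mul_distrib, ← Finset.prod_div_distrib, ← Finset.prod_mul_distrib]
  refine Finset.prod_congr rfl fun k _ => ?_
  have a := n1 k
  have b := n2 k
  have n3 := hX k
  have d1 : 1 - c * t * y * X k = c * t * y * (y - X k) := by linear_combination -hy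
  have d2 : y - (c * X k)⁻¹ = y * (t * y - X k) / -X k := by
    have hci : c⁻¹ = t * y ^ 2 := by field_simp; linear_combination -hy
    rw [eq_div_iff (neg_ne_zero.2 n3), mul_inv, hci]
    field_simp
    ring
  rw [d1, d2]
  field_simp

/-- The sum of the rates, by comparison of the leading coefficients in the Lagrange interpolation
of `ratePoly`; equivalently, by the residue theorem for
`∏ (t y - X_k) (1 - c t X_k y) / ((y - X_k) (1 - c X_k y)) · (1 - c y) (T - y / s) / (y (1 - c t y²))`. -/
theorem sum_rates (hX : ∀ i, X i ≠ 0) (hinj : Function.Injective X) (hc : c ≠ 0) (ht : t ≠ 0)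
    (hs : s * t = t ^ n) (h1 : ∀ i k, 1 - c * X i * X k ≠ 0) (h2 : ∀ i, 1 - c * t * X i * X i ≠ 0)
    (h3 : ∀ i, t - c * X i * X i ≠ 0) :
    (t - 1) * ∑ i, ((∏ k ∈ Finset.univ.erase i, (t * X i - X k) * (1 - c * t * X i * X k) /
        ((X i - X k) * (1 - c * X i * X k))) *
          ((1 - c * X i) * (T - X i / s) / (1 - c * X i ^ 2)) -
      (∏ k ∈ Finset.univ.erase i, (X i - t * X k) * (1 - c * X i * X k / t) /
        ((X i - X k) * (1 - c * X i * X k))) *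
          ((1 - X i) * (1 - T * s * c * X i) / (1 - c * X i ^ 2))) = (T - 1) * (t ^ n - 1) := by
  have hs0 : s ≠ 0 := by rintro rfl; rw [zero_mul] at hs; exact pow_ne_zero n ht hs.symm
  obtain ⟨ρ, hρ'⟩ := IsAlgClosed.exists_pow_nat_eq (c * t)⁻¹ two_pos
  have hct : c * t ≠ 0 := mul_ne_zero hc ht
  have hρ : c * t * ρ ^ 2 = 1 := by rw [hρ', mul_inv_cancel₀ hct]
  have hρ0 : ρ ≠ 0 := by rintro rfl; simp at hρ
  have k2 : ∀ i, X i ^ 2 ≠ ρ ^ 2 := fun i h => h2 i (by linear_combination -c * t * h - hρ)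
  have k3 : ∀ i, (c * X i)⁻¹ ^ 2 ≠ ρ ^ 2 := fun i h => h3 i (by
    have hi := hX i
    rw [hρ'] at h
    field_simp at h
    linear_combination h)
  have hv := rateNode_injective hX hinj hc hρ0 h1 k2 k3
  have hcard : (Finset.univ : Finset (Fin n ⊕ (Fin n ⊕ Fin 3))).card = n * 2 + 2 + 1 := by
    simp; omega
  have key := Lagrange.coeff_eq_sum (s := Finset.univ) (v := rateNode X c ρ) hv.injOn
    (P := ratePoly X c t T s) (by
      refine lt_of_le_of_lt (Polynomial.degree_le_natDegree) ?_
      rw [hcard]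
      exact_mod_cast Nat.lt_succ_of_le (natDegree_ratePoly_le X c t T s))
  rw [hcard, Nat.add_sub_cancel, coeff_ratePoly, Fintype.sum_sum_type, Fintype.sum_sum_type,
    Fin.sum_univ_three] at key
  simp only [prod_univ_erase_inl, prod_univ_erase_inr, Fintype.prod_sum_type] at key
  have three : ∀ f : Fin 3 → ℂ, (∏ k, f k) = f 0 * f 1 * f 2 ∧
      (∏ k ∈ Finset.univ.erase (0 : Fin 3), f k) = f 1 * f 2 ∧
      (∏ k ∈ Finset.univ.erase (1 : Fin 3), f k) = f 0 * f 2 ∧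
      (∏ k ∈ Finset.univ.erase (2 : Fin 3), f k) = f 0 * f 1 := fun f => by
    refine ⟨Fin.prod_univ_three f, ?_, ?_, ?_⟩
    · rw [show (Finset.univ.erase (0 : Fin 3)) = {1, 2} from rfl, Finset.prod_pair (by decide)]
    · rw [show (Finset.univ.erase (1 : Fin 3)) = {0, 2} from rfl, Finset.prod_pair (by decide)]
    · rw [show (Finset.univ.erase (2 : Fin 3)) = {0, 1} from rfl, Finset.prod_pair (by decide)]
  simp only [(three _).1, (three _).2.1, (three _).2.2.1, (three _).2.2.2] at key
  have v1 : ∀ i, rateNode X c ρ (Sum.inl i) = X i := fun _ => rfl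
  have v2 : ∀ i, rateNode X c ρ (Sum.inr (Sum.inl i)) = (c * X i)⁻¹ := fun _ => rfl
  have v3 : rateNode X c ρ (Sum.inr (Sum.inr 0)) = 0 := rfl
  have v4 : rateNode X c ρ (Sum.inr (Sum.inr 1)) = ρ := rfl
  have v5 : rateNode X c ρ (Sum.inr (Sum.inr 2)) = -ρ := rfl
  simp only [v1, v2, v3, v4, v5, sub_zero, sub_neg_eq_add] at key
  simp only [rate_term_inl hX hinj hc ht hρ h1 h2, rate_term_inr hX hinj hc ht hs hρ h1 h3] at key
  rw [Finset.sum_neg_distrib, ← Finset.mul_sum, ← Finset.mul_sum, ← Finset.mul_sum,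
    ← Finset.mul_sum] at key
  -- the term at the node `0`
  have e0 : (ratePoly X c t T s).eval 0 / ((∏ k, (0 - X k)) *
      ((∏ k, (0 - (c * X k)⁻¹)) * ((0 - ρ) * (0 + ρ)))) = (∏ k, -(c * X k)) * -(c * t) * T := by
    have hprod : (∏ k, (t * 0 - X k) * (1 - c * t * 0 * X k)) /
        ((∏ k, (0 - X k)) * ∏ k, (0 - (c * X k)⁻¹)) = ∏ k, -(c * X k) := by
      rw [← Finset.prod_mul_distrib, ← Finset.prod_div_distrib]
      refine Finset.prod_congr rfl fun k _ => ?_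
      have := hX k
      simp only [mul_zero, zero_mul, zero_sub, sub_zero, mul_one]
      field_simp
    rw [eval_ratePoly, ← mul_assoc (∏ k, (0 - X k)), mul_div_mul_comm, hprod]
    have : (1 - c * 0) * (T - 0 / s) / ((0 - ρ) * (0 + ρ)) = -(c * t) * T := by
      rw [div_eq_iff (by simp [hρ0])]
      simp only [zero_div]
      linear_combination -T * hρ
    rw [this]
    ring
  -- the terms at the nodes `ρ` and `-ρ`
  have side : ∀ y, y ^ 2 = ρ ^ 2 → (ratePoly X c t T s).eval y / ((∏ k, (y - X k)) *
      ((∏ k, (y - (c * X k)⁻¹)) * (y * (y + y)))) =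
      (∏ k, -(c * X k)) * t ^ n * ((1 - c * y) * (T - y / s) / (2 * ρ ^ 2)) := by
    intro y hy
    rw [eval_ratePoly, ← mul_assoc (∏ k, (y - X k)), mul_div_mul_comm,
      rate_prod_of_sq hX hc (by rw [hy, hρ]), show y * (y + y) = 2 * ρ ^ 2 by rw [← hy]; ring]
    · intro k h
      refine k2 k ?_
      rw [← sub_eq_zero.1 h, hy]
    · intro k h
      refine k3 k ?_
      have hk := hX k
      rw [← hy, eq_comm, ← sub_eq_zero.1 h]
      have hty : c * t * y ^ 2 = 1 := by rw [hy, hρ]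
      have hy0 : y ≠ 0 := by rintro rfl; simp at hty
      field_simp
      linear_combination (c * t * y ^ 2 + 1) * hty
  have e1 := side ρ rfl
  have e2 := side (-ρ) (neg_sq ρ)
  rw [← sub_eq_add_neg] at e2
  have ePr : ∏ k, -(c * t ^ 2 * X k) = (∏ k, -(c * X k)) * (t ^ n * t ^ n) := by
    have hpow : t ^ n = ∏ _k : Fin n, t := by simp
    rw [hpow, ← Finset.prod_mul_distrib, ← Finset.prod_mul_distrib]
    exact Finset.prod_congr rfl fun k _ => by ring
  have hP : (∏ k, -(c * X k)) ≠ 0 :=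
    Finset.prod_ne_zero_iff.2 fun k _ => neg_ne_zero.2 (mul_ne_zero hc (hX k))
  have eρ : (1 - c * ρ) * (T - ρ / s) / (2 * ρ ^ 2) + (1 - c * -ρ) * (T - -ρ / s) / (2 * ρ ^ 2) =
      c * t * T + c / s := by
    rw [← add_div, div_eq_iff (by simp [hρ0])]
    linear_combination -2 * T * hρ
  rw [e0, e1, e2, ePr] at key
  rw [Finset.sum_sub_distrib]
  -- the factor `-c t ∏ (-c X_k)` is common to all terms and to the leading coefficient
  refine mul_left_cancel₀ (mul_ne_zero hP hct) ?_
  have hst : c / s * t ^ n = c * t := by rw [← hs]; field_simp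
  linear_combination key + (∏ k, -(c * X k)) * t ^ n * eρ + (∏ k, -(c * X k)) * (1 - t ^ n) * hst

end

end


/-! ### Vanishing of the very-well-poised sum and of its limits -/

noncomputable section

variable {n N : ℕ} {μ ν : Fin n → ℕ} {i : Fin n} {q t c : ℂ}

theorem GenericBase.node_injective (hb : GenericBase (expBound n N) q t) (hμ : ∀ k, μ k ≤ N) :
    Function.Injective (node μ q t) := by
  intro i k hik
  by_contra hne
  have hik' : (i : ℕ) ≠ k := fun h => hne (Fin.ext h)
  have hi := i.isLt
  have hk := k.isLt
  have h1 := hμ i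
  have h2 := hμ k
  have e := node_div_node (i := i) (μ := μ) hb.q_ne hb.t_ne k
  rw [hik, div_self (node_ne_zero hb.q_ne hb.t_ne)] at e
  refine hb.ne_one ((μ i : ℤ) - μ k) ((k : ℤ) - i) ?_ ?_ (by omega) e.symm <;>
    exact abs_le.2 ⟨by simp only [expBound]; push_cast; omega,
      by simp only [expBound]; push_cast; omega⟩

/-- The total rate does not depend on the partition. -/
theorem sum_upRate_sub_downRate (hb : GenericBase (expBound n N) q t)
    (hc : GenericScalar (expBound n N) q t c) (hμ : ∀ k, μ k ≤ N) :
    (t - 1) * ∑ i, (upRate N μ q t c i - downRate N μ q t c i) = (q ^ N - 1) * (t ^ n - 1) := by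
  have hq := hb.q_ne
  have ht := hb.t_ne
  refine sum_rates (fun i => node_ne_zero hq ht) (hb.node_injective hμ) hc.c_ne ht ?_
    (fun i k => ?_) (fun i => ?_) fun i => ?_
  · rw [← zpow_add_one₀ ht, sub_add_cancel, zpow_natCast]
  · have := hc.one_sub_node_mul_node_ne hq ht hμ (i := i) (a := 0) (b := 0) (by norm_num)
      (by norm_num) k
    simpa [mul_assoc] using this
  · have := hc.one_sub_node_mul_node_ne hq ht hμ (i := i) (a := 0) (b := 1) (by norm_num)
      (by norm_num) i
    rw [zpow_zero, zpow_one, one_mul] at this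
    intro h0; apply this; linear_combination h0
  · have := hc.one_sub_node_mul_node_ne hq ht hμ (i := i) (a := 0) (b := -1) (by norm_num)
      (by norm_num) i
    rw [zpow_zero, zpow_neg_one, one_mul] at this
    intro h0; apply this
    field_simp
    linear_combination h0

theorem node_eq_mul_node_of_eq (ht : t ≠ 0) {k : Fin n} (hk : (k : ℕ) = i + 1) (h : μ i = μ k) :
    node μ q t i = t * node μ q t k := by
  rw [node, node, h, hk, mul_left_comm, ← zpow_one_add₀ ht]
  congr 2; push_cast; ring

/-- A box that does not fit into the rectangle, or that does not leave a partition, is added at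
rate zero. -/
theorem addBox_of_upRate_ne_zero (ht : t ≠ 0) (hμ : μ ∈ boxPartitions n N)
    (h : upRate N μ q t c i ≠ 0) :
    Function.update μ i (μ i + 1) ∈ boxPartitions n N ∧
      AddBox μ (Function.update μ i (μ i + 1)) i := by
  obtain ⟨hle, hanti⟩ := mem_boxPartitions.1 hμ
  have hprev : ∀ k, k < i → μ i + 1 ≤ μ k := by
    intro k hk
    have hk' : (k : ℕ) < i := hk
    have hi := i.isLt
    set k' : Fin n := ⟨i - 1, by omega⟩ with hk'_def
    have hkk' : k ≤ k' := Fin.le_def.2 (by simp only [hk'_def]; omega)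
    have hk'i : k' < i := Fin.lt_def.2 (by simp only [hk'_def]; omega)
    refine le_trans ?_ (hanti hkk')
    by_contra hlt
    have heq : μ k' = μ i := le_antisymm (by omega) (hanti hk'i.le)
    -- equal adjacent parts: the factor `t X_i - X_{i-1}` vanishes
    refine h ?_
    rw [upRate, Finset.prod_eq_zero (Finset.mem_erase.2 ⟨hk'i.ne, Finset.mem_univ k'⟩), zero_mul]
    rw [node_eq_mul_node_of_eq ht (i := k') (k := i) (by simp only [hk'_def]; omega) heq]
    simp
  have hlast : μ i + 1 ≤ N := by
    by_cases hi0 : (i : ℕ) = 0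
    · by_contra hlt
      have heq : μ i = N := le_antisymm (hle i) (by omega)
      -- a first part equal to `N`: the factor `q^N - X_1 / t^{n-1}` vanishes
      refine h ?_
      have : node μ q t i = q ^ N * t ^ ((n : ℤ) - 1) := by
        rw [node, heq, hi0]; simp
      rw [upRate, this, mul_div_cancel_right₀ _ (zpow_ne_zero _ ht)]
      simp
    · exact (hprev ⟨0, i.pos⟩ (Fin.lt_def.2 (Nat.pos_of_ne_zero hi0))).trans (hle _)
  have hν : Antitone (Function.update μ i (μ i + 1)) := by
    intro a b hab
    rcases eq_or_ne a i with rfl | ha <;> rcases eq_or_ne b a with rfl | hb'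
    · exact le_rfl
    · rw [Function.update_of_ne hb', Function.update_self]
      exact (hanti hab).trans (Nat.le_succ _)
    · exact le_rfl
    · rw [Function.update_of_ne ha]
      rcases eq_or_ne b i with rfl | hb
      · rw [Function.update_self]; exact hprev a (lt_of_le_of_ne hab ha)
      · rw [Function.update_of_ne hb]; exact hanti hab
  refine ⟨mem_boxPartitions.2 ⟨fun k => ?_, hν⟩, hanti, hν, rfl⟩
  rcases eq_or_ne k i with rfl | hk
  · rwa [Function.update_self]
  · rw [Function.update_of_ne hk]; exact hle k

/-- A box whose removal does not leave a partition is removed at rate zero. -/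
theorem addBox_of_downRate_ne_zero (ht : t ≠ 0) (hν : ν ∈ boxPartitions n N)
    (h : downRate N ν q t c i ≠ 0) :
    Function.update ν i (ν i - 1) ∈ boxPartitions n N ∧
      AddBox (Function.update ν i (ν i - 1)) ν i := by
  obtain ⟨hle, hanti⟩ := mem_boxPartitions.1 hν
  have hnext : ∀ k, i < k → ν k + 1 ≤ ν i := by
    intro k hk
    have hk' : (i : ℕ) < k := hk
    have hkn := k.isLt
    set k' : Fin n := ⟨i + 1, by omega⟩ with hk'_def
    have hkk' : k' ≤ k := Fin.le_def.2 (by simp only [hk'_def]; omega)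
    have hik' : i < k' := Fin.lt_def.2 (by simp only [hk'_def]; omega)
    refine (Nat.succ_le_succ (hanti hkk')).trans ?_
    by_contra hlt
    have heq : ν i = ν k' := le_antisymm (by omega) (hanti hik'.le)
    -- equal adjacent parts: the factor `X_i - t X_{i+1}` vanishes
    refine h ?_
    rw [downRate, Finset.prod_eq_zero (Finset.mem_erase.2 ⟨hik'.ne', Finset.mem_univ k'⟩), zero_mul]
    rw [node_eq_mul_node_of_eq ht (i := i) (k := k') (by simp only [hk'_def]) heq]
    simp
  have hpos : 1 ≤ ν i := by
    by_cases hi0 : (i : ℕ) + 1 = n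
    · by_contra hlt
      have heq : ν i = 0 := by omega
      -- an empty last part: the factor `1 - X_n` vanishes
      refine h ?_
      have : node ν q t i = 1 := by
        rw [node, heq, show (n : ℤ) - 1 - (i : ℕ) = 0 by omega]; simp
      rw [downRate, this]
      simp
    · have hi := i.isLt
      have := hnext ⟨i + 1, by omega⟩ (Fin.lt_def.2 (Nat.lt_succ_self _))
      omega
  have hμ : Antitone (Function.update ν i (ν i - 1)) := by
    intro a b hab
    rcases eq_or_ne b i with rfl | hb <;> rcases eq_or_ne a b with rfl | ha'
    · exact le_rfl
    · rw [Function.update_of_ne ha', Function.update_self]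
      exact (Nat.sub_le _ _).trans (hanti hab)
    · exact le_rfl
    · rw [Function.update_of_ne hb]
      rcases eq_or_ne a i with rfl | ha
      · rw [Function.update_self]
        have := hnext b (lt_of_le_of_ne hab ha')
        omega
      · rw [Function.update_of_ne ha]; exact hanti hab
  refine ⟨mem_boxPartitions.2 ⟨fun k => ?_, hμ⟩, hμ, hanti, ?_⟩
  · rcases eq_or_ne k i with rfl | hk
    · rw [Function.update_self]; exact (Nat.sub_le _ _).trans (hle k)
    · rw [Function.update_of_ne hk]; exact hle k
  · rw [Function.update_self, Nat.sub_add_cancel hpos, Function.update_idem, Function.update_eq_self]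

/-- By detailed balance the total flow upwards equals the total flow downwards. -/
theorem sum_wellPoisedTerm_mul_sum_rates (hb : GenericBase (expBound n N) q t)
    (hc : GenericScalar (expBound n N) q t c) :
    ∑ μ ∈ boxPartitions n N, ∑ i, wellPoisedTerm N μ q t c * upRate N μ q t c i =
      ∑ ν ∈ boxPartitions n N, ∑ i, wellPoisedTerm N ν q t c * downRate N ν q t c i := by
  rw [← Finset.sum_product', ← Finset.sum_product']
  have key : ∀ a : (Fin n → ℕ) × Fin n, a ∈ boxPartitions n N ×ˢ Finset.univ →
      wellPoisedTerm N a.1 q t c * upRate N a.1 q t c a.2 ≠ 0 →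
      Function.update a.1 a.2 (a.1 a.2 + 1) ∈ boxPartitions n N ∧
        AddBox a.1 (Function.update a.1 a.2 (a.1 a.2 + 1)) a.2 := fun a h1 h2 =>
    addBox_of_upRate_ne_zero hb.t_ne (Finset.mem_product.1 h1).1 (right_ne_zero_of_mul h2)
  refine Finset.sum_bij_ne_zero (fun a _ _ => (Function.update a.1 a.2 (a.1 a.2 + 1), a.2)) ?_ ?_ ?_ ?_
  · intro a h1 h2
    exact Finset.mem_product.2 ⟨(key a h1 h2).1, Finset.mem_univ _⟩
  · rintro ⟨μ, i⟩ _ _ ⟨μ', i'⟩ _ _ h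
    obtain ⟨h, rfl⟩ := Prod.ext_iff.1 h
    refine Prod.ext (funext fun k => ?_) rfl
    have hk := congrFun h k
    simp only at hk
    rcases eq_or_ne k i with rfl | hki
    · rw [Function.update_self, Function.update_self] at hk
      exact Nat.succ_injective hk
    · rwa [Function.update_of_ne hki, Function.update_of_ne hki] at hk
  · rintro ⟨ν, i⟩ h1 h2
    obtain ⟨h3, h4⟩ := addBox_of_downRate_ne_zero hb.t_ne (Finset.mem_product.1 h1).1
      (right_ne_zero_of_mul h2)
    refine ⟨(Function.update ν i (ν i - 1), i), Finset.mem_product.2 ⟨h3, Finset.mem_univ _⟩, ?_,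
      Prod.ext h4.eq.symm rfl⟩
    rwa [← h4.wellPoisedTerm_mul_downRate hb (mem_boxPartitions.1 (Finset.mem_product.1 h1).1).1 hc]
  · intro a h1 h2
    obtain ⟨h3, h4⟩ := key a h1 h2
    exact (h4.wellPoisedTerm_mul_downRate hb (mem_boxPartitions.1 h3).1 hc).symm

/-- The very-well-poised sum vanishes: multiplied by the total rate, which is a nonzero constant, each
term becomes the difference of the flows out of `μ` upwards and downwards, and these cancel. -/
theorem sum_wellPoisedTerm (hn : 1 ≤ n) (hN : 1 ≤ N) (hb : GenericBase (expBound n N) q t)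
    (hc : GenericScalar (expBound n N) q t c) :
    ∑ μ ∈ boxPartitions n N, wellPoisedTerm N μ q t c = 0 := by
  have hqN : q ^ N - 1 ≠ 0 := by
    have := hb.ne_one N 0 (abs_le.2 ⟨by omega, by simp only [expBound]; push_cast; omega⟩)
      (by simp) (by omega)
    rw [zpow_zero, mul_one, zpow_natCast] at this
    exact sub_ne_zero.2 this
  have htn : t ^ n - 1 ≠ 0 := by
    have := hb.ne_one 0 n (by simp)
      (abs_le.2 ⟨by omega, by simp only [expBound]; push_cast; omega⟩) (by omega)
    rw [zpow_zero, one_mul, zpow_natCast] at this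
    exact sub_ne_zero.2 this
  refine (mul_eq_zero.1 ?_).resolve_right (mul_ne_zero hqN htn)
  rw [Finset.sum_mul]
  have h := sum_wellPoisedTerm_mul_sum_rates hb hc
  rw [← sub_eq_zero, ← Finset.sum_sub_distrib] at h
  rw [← mul_zero (t - 1), ← h, Finset.mul_sum]
  refine Finset.sum_congr rfl fun μ hμ => ?_
  rw [← sum_upRate_sub_downRate hb hc (mem_boxPartitions.1 hμ).1, ← Finset.sum_sub_distrib,
    mul_left_comm, Finset.mul_sum]
  simp only [mul_sub]

/-- Only finitely many values of `c` are excluded. -/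
theorem eventually_genericScalar (M : ℕ) {l : Filter ℂ}
    (hl : ∀ y : ℂ, ∀ᶠ c in l, c ≠ y) : ∀ᶠ c in l, GenericScalar M q t c := by
  have h : ∀ᶠ c in l, ∀ a ∈ Finset.Icc (-(M : ℤ)) M, ∀ b ∈ Finset.Icc (-(M : ℤ)) M,
      c ≠ (q ^ a * t ^ b)⁻¹ :=
    (Filter.eventually_all_finset _).2 fun a _ => (Filter.eventually_all_finset _).2 fun b _ => hl _
  filter_upwards [h, hl 0] with c h1 h2
  refine ⟨h2, fun a b ha hb h3 => ?_⟩
  exact h1 a (Finset.mem_Icc.2 (abs_le.1 ha)) b (Finset.mem_Icc.2 (abs_le.1 hb))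
    (eq_inv_of_mul_eq_one_right h3)

/-- Passage to the limit in `sum_wellPoisedTerm` along a filter that avoids every point. -/
theorem sum_eq_zero_of_tendsto_wellPoisedRatio (hn : 1 ≤ n) (hN : 1 ≤ N)
    (hb : GenericBase (expBound n N) q t) {l : Filter ℂ} [l.NeBot] (hl : ∀ y : ℂ, ∀ᶠ c in l, c ≠ y)
    {f : (Fin n → ℕ) → ℂ}
    (hf : ∀ μ ∈ boxPartitions n N, Tendsto (wellPoisedRatio N μ q t) l (𝓝 (f μ))) :
    ∑ μ ∈ boxPartitions n N, f μ * (qC0 μ (t ^ n) q t * qC0 μ (q ^ (-(N : ℤ))) q t /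
      (qCminus μ q q t * qCminus μ t q t)) * (q ^ N * t ^ (1 - (n : ℤ))) ^ size μ *
        t ^ (2 * nStat μ) = 0 := by
  have h1 : Tendsto (fun c => ∑ μ ∈ boxPartitions n N, wellPoisedTerm N μ q t c) l
      (𝓝 (∑ μ ∈ boxPartitions n N, f μ * (qC0 μ (t ^ n) q t * qC0 μ (q ^ (-(N : ℤ))) q t /
      (qCminus μ q q t * qCminus μ t q t)) * (q ^ N * t ^ (1 - (n : ℤ))) ^ size μ *
        t ^ (2 * nStat μ))) :=
    tendsto_finsetSum _ fun μ hμ => (((hf μ hμ).mul_const _).mul_const _).mul_const _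
  refine tendsto_nhds_unique h1 ((tendsto_const_nhds (x := (0 : ℂ))).congr' ?_)
  filter_upwards [eventually_genericScalar (expBound n N) hl] with c hc
  exact (sum_wellPoisedTerm hn hN hb hc).symm

/-- The limit `c → 0` of `sum_wellPoisedTerm`. -/
theorem sum_prefactor_zero (hn : 1 ≤ n) (hN : 1 ≤ N) (hb : GenericBase (expBound n N) q t) :
    ∑ μ ∈ boxPartitions n N, qC0 μ (t ^ n) q t * qC0 μ (q ^ (-(N : ℤ))) q t /
      (qCminus μ q q t * qCminus μ t q t) * (q ^ N * t ^ (1 - (n : ℤ))) ^ size μ *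
        t ^ (2 * nStat μ) = 0 := by
  have := sum_eq_zero_of_tendsto_wellPoisedRatio hn hN hb (l := 𝓝[≠] (0 : ℂ)) (f := fun _ => 1)
    (fun y => ?_) fun μ _ => tendsto_wellPoisedRatio_zero.mono_left nhdsWithin_le_nhds
  · simpa using this
  · rcases eq_or_ne y 0 with rfl | hy
    · exact self_mem_nhdsWithin
    · exact nhdsWithin_le_nhds (isOpen_ne.mem_nhds hy.symm)

/-- The limit `c → ∞` of `sum_wellPoisedTerm`. -/
theorem sum_prefactor_infty (hn : 1 ≤ n) (hN : 1 ≤ N) (hb : GenericBase (expBound n N) q t) :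
    ∑ μ ∈ boxPartitions n N, qC0 μ (t ^ n) q t * qC0 μ (q ^ (-(N : ℤ))) q t /
      (qCminus μ q q t * qCminus μ t q t) * t ^ (2 * nStat μ) * q ^ size μ = 0 := by
  have hq := hb.q_ne
  have ht := hb.t_ne
  have := sum_eq_zero_of_tendsto_wellPoisedRatio hn hN hb (l := Bornology.cobounded ℂ)
    (fun y => ?_) fun μ hμ =>
      tendsto_wellPoisedRatio_cobounded (mem_boxPartitions.1 hμ).2 hq ht
  · rw [← this]
    refine Finset.sum_congr rfl fun μ _ => ?_
    have e : q ^ size μ = (q ^ (1 - (N : ℤ)) * t ^ ((n : ℤ) - 1)) ^ size μ *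
        (q ^ N * t ^ (1 - (n : ℤ))) ^ size μ := by
      rw [← mul_pow, ← zpow_natCast q N, mul_mul_mul_comm, ← zpow_add₀ hq, ← zpow_add₀ ht]
      simp
    rw [e]
    ring
  · exact Bornology.isBounded_def.1 (Bornology.isBounded_singleton (x := y))

end


/-! ### The degenerate configurations -/

noncomputable section

variable {m n N : ℕ} {α : Fin (2 * m + 6) → ℝ} {x : Params m}

theorem Nondegenerate.genericBase {M : ℕ} (h : Nondegenerate M x) (hx : ∀ i, x i ≠ 0) :
    GenericBase M x.q x.t :=
  ⟨hx _, hx _, fun _ _ => h.qt_ne⟩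

theorem Nondegenerate.genericScalar {M : ℕ} (h : Nondegenerate M x) (hx : ∀ i, x i ≠ 0) :
    GenericScalar M x.q x.t (x.τ 0 ^ 2) :=
  ⟨pow_ne_zero 2 (hx _), fun _ _ => h.sq_ne⟩

theorem disjoint_numA_numB (h : InFundamentalDomain α) :
    Disjoint (Finset.univ.filter fun r : Fin (2 * m + 6) => 2 ≤ r ∧ α r < -α 0)
      (Finset.univ.filter fun r : Fin (2 * m + 6) => 2 ≤ r ∧ 1 + α 0 < α r) :=
  Finset.disjoint_filter.2 fun r _ h1 h2 => by linarith [h1.2, h2.2, h.lower]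

/-- The number of indices `r ≥ 2` is `2 m + 4`, so `A + B = 2 m + 4` says that every one of them is
counted by `A` or by `B`. -/
theorem union_numA_numB (h : InFundamentalDomain α) (hAB : numA α + numB α = 2 * m + 4) :
    (Finset.univ.filter fun r : Fin (2 * m + 6) => 2 ≤ r ∧ α r < -α 0) ∪
      (Finset.univ.filter fun r : Fin (2 * m + 6) => 2 ≤ r ∧ 1 + α 0 < α r) =
      Finset.univ.filter fun r : Fin (2 * m + 6) => 2 ≤ r := by
  refine Finset.eq_of_subset_of_card_le (fun r hr => ?_) ?_
  · simp only [Finset.mem_union, Finset.mem_filter, Finset.mem_univ, true_and] at hr ⊢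
    exact hr.elim And.left And.left
  · rw [card_two_le, Finset.card_union_of_disjoint (disjoint_numA_numB h)]
    exact hAB.ge

theorem lt_or_lt_of_numA_add_numB (h : InFundamentalDomain α) (hAB : numA α + numB α = 2 * m + 4)
    {r : Fin (2 * m + 6)} (hr : 2 ≤ r) : α r < -α 0 ∨ 1 + α 0 < α r := by
  have : r ∈ Finset.univ.filter fun r : Fin (2 * m + 6) => 2 ≤ r := by simpa using hr
  rw [← union_numA_numB h hAB] at this
  simp only [Finset.mem_union, Finset.mem_filter, Finset.mem_univ, true_and] at this
  exact this.imp And.right And.right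

/-- In each degenerate configuration the leading coefficients are the very-well-poised terms
or one of their limits. -/
theorem sum_lcWeight_eq_zero (hn : 1 ≤ n) (hN : 1 ≤ N) (h : InFundamentalDomain α)
    (hs : slope α = 0) (hdeg : Degenerate α) (hx : x ∈ balanced m n N)
    (hnd : Nondegenerate (expBound n N) x) :
    ∑ μ ∈ boxPartitions n N, lcWeight n N α μ x = 0 := by
  have hb := hnd.genericBase hx.1
  have hq := hb.q_ne
  have hwp := sum_wellPoisedTerm hn hN hb (hnd.genericScalar hx.1)
  rcases hdeg with ⟨h0, hA, hB, hne⟩ | ⟨h0', h0, h2, hne⟩ | ⟨h0', h0, hA, hB⟩ | ⟨h0, h2, hA, hB⟩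
  · -- the very-well-poised sum itself
    rw [← hwp]
    refine Finset.sum_congr rfl fun μ _ => ?_
    rw [lcWeight, if_pos h0, lcZero_eq_wellPoisedTerm hx.1 fun r hr =>
      ⟨by simpa using hne r hr 0, by simpa using hne r hr 1⟩, hA, hB]
    simp
  · -- its limit `t_0 → ∞`
    rw [← sum_prefactor_infty hn hN hb]
    refine Finset.sum_congr rfl fun μ _ => ?_
    rw [lcWeight, if_neg h0.ne, if_pos h0', if_pos h2.le, lcMiddleLow, if_neg h2.ne,
      Finset.filter_false_of_mem (fun r _ hr => (hne r hr.1).1.ne' hr.2),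
      Finset.filter_false_of_mem (fun r _ hr => (hne r hr.1).2.ne hr.2)]
    simp [prefactor]
  · -- its limit `t_0 → 0`: `A + B = 2 m + 4` says that `z` is the product of all `t_r` with `r ≥ 2`
    have h2 : α 0 < α 2 := by
      by_contra hle
      have hA1 : numA α ≤ 1 := by
        rw [numA]
        refine (Finset.card_le_card (t := {2}) fun r hr => ?_).trans (Finset.card_singleton _).le
        simp only [Finset.mem_filter, Finset.mem_univ, true_and] at hr
        rw [Finset.mem_singleton]
        by_contra hr2
        have := neg_le_of_slope_eq_zero h hs h0 (not_lt.1 hle) (three_le_iff_ne.2 ⟨hr.1, hr2⟩)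
        linarith [hr.2]
      omega
    have hne := fun r => lt_or_lt_of_numA_add_numB h (r := r) (by omega)
    rw [← sum_prefactor_zero hn hN hb]
    refine Finset.sum_congr rfl fun μ _ => ?_
    rw [lcWeight, if_neg h0.ne, if_pos h0', if_neg (not_le.2 h2), lcMiddleHigh,
      ← Finset.prod_union (disjoint_numA_numB h), union_numA_numB h (by omega), prod_two_le_of_mem_balanced hx,
      monomialFactor_eq hx.1 (h := 0) (by rw [hA]; push_cast; ring) (by rw [hB]; push_cast; ring),
      Finset.filter_false_of_mem (fun r _ hr => by
        rcases hne r (three_le_iff_ne.1 hr.1).1 with h3 | h3 <;> linarith [hr.2]),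
      Finset.filter_false_of_mem (fun r _ hr => by
        rcases hne r (three_le_iff_ne.1 hr.1).1 with h3 | h3 <;> linarith [hr.2])]
    have e : (x.q ^ (-((m : ℤ) + 1))) ^ size μ * (x.q ^ (m + 1 + N) * x.t ^ (1 - (n : ℤ))) ^ size μ =
        (x.q ^ N * x.t ^ (1 - (n : ℤ))) ^ size μ := by
      rw [← mul_pow, ← mul_assoc, ← zpow_natCast x.q (m + 1 + N), ← zpow_natCast x.q N,
        ← zpow_add₀ hq]
      congr 4
      push_cast
      ring
    rw [← e, prefactor, zpow_zero, Finset.prod_empty, Finset.prod_empty]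
    ring
  · -- the very-well-poised sum again, since no `α_r` equals `1 / 2`
    rw [← hwp]
    refine Finset.sum_congr rfl fun μ _ => ?_
    have hne : ∀ r, 2 ≤ r → α r ≠ 1 / 2 := fun r hr hr' => by
      rcases lt_or_lt_of_numA_add_numB h (by omega) hr with h3 | h3 <;> rw [hr', h0] at h3 <;>
        norm_num at h3
    have h0n : α 0 ≠ 0 := by rw [h0]; norm_num
    rw [lcWeight, if_neg h0n, if_neg (by rw [h0]; exact lt_irrefl _), if_neg h2.ne',
      lcHalfHigh_eq_wellPoisedTerm hx hne (h := 0) (by rw [hA]; push_cast; ring)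
        (by rw [hB]; push_cast; ring), zpow_zero, mul_one]

end

end EllipticSeries

theorem mainTheorem3 (m n N : ℕ) (hn : 1 ≤ n) (α : Fin (2 * m + 6) → ℝ)
    (hα : EllipticSeries.InFundamentalDomain α) (hslope : EllipticSeries.slope α = 0) :
    (∀ μ ∈ EllipticSeries.boxPartitions n N,
      EllipticSeries.HasLeadingTerm (EllipticSeries.balanced m n N)
        (EllipticSeries.scaledWeight m n α μ) 0 (EllipticSeries.lcWeight n N α μ)) ∧
    (¬ EllipticSeries.Degenerate α →
      EllipticSeries.HasLeadingTerm (EllipticSeries.balanced m n N)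
        (fun x p => ∑ μ ∈ EllipticSeries.boxPartitions n N,
          EllipticSeries.scaledWeight m n α μ x p) 0
        (fun x => ∑ μ ∈ EllipticSeries.boxPartitions n N, EllipticSeries.lcWeight n N α μ x)) ∧
    (EllipticSeries.Degenerate α → 1 ≤ N →
      EllipticSeries.Generically (EllipticSeries.balanced m n N) fun x =>
        ∑ μ ∈ EllipticSeries.boxPartitions n N, EllipticSeries.lcWeight n N α μ x = 0) := by
  refine ⟨fun μ hμ => EllipticSeries.hasLeadingTerm_scaledWeight hα hslope hμ, fun hdeg =>
    EllipticSeries.hasLeadingTerm_sum hα hslope (EllipticSeries.exists_sum_ne_zero hα hslope hdeg),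
    fun hdeg hN => ?_⟩
  obtain ⟨D, hD⟩ := EllipticSeries.condition_nondegenerate (S := EllipticSeries.balanced m n N)
    (fun x hx => hx.1) (EllipticSeries.expBound n N)
  obtain ⟨x, hx, hnd, -⟩ := EllipticSeries.exists_weightLc_ne_zero (m := m) (n := n) (N := N) α
  exact ⟨D, ⟨x, hx, (hD x hx).2 hnd⟩, fun y hy hyD =>
    EllipticSeries.sum_lcWeight_eq_zero hn hN hα hslope hdeg hy ((hD y hy).1 hyD)⟩
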